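/- Let $N\ge 2$, $\ell,g,\sigma,\theta,s,\alpha>0$, $\Sigma=\mathbb T^{N-1}=\mathbb R^{N-1}/\mathbb Z^{N-1}$ and $\Omega=\Sigma\times(0,\ell)$, with points $(x,y)$, $x\in\Sigma$, $y\in(0,\ell)$. Write $\hat f(\xi)=\int_\Sigma f(x)e^{-2\pi i\xi\cdot x}\,dx$, $\xi\in\mathbb Z^{N-1}$, for the Fourier coefficients in the horizontal variable. Let $\mu:\mathbb Z^{N-1}\to\mathbb R$ satisfy $\theta\le\mu(\xi)\le\theta^{-1}(1+|\xi|)^3$ for all $\xi$, and let $M$ be the Fourier multiplication operator $\widehat{M(h)}(\xi)=\mu(\xi)\hat h(\xi)$. Let $\mathcal H=\{v\in H^1(\Omega;\mathbb R^N): \operatorname{div}v=0,\ v=0\text{ on }\{y=0\}\}$ and $(\mathbb Du)_{ij}=\partial_iu_j+\partial_ju_i$. A weak solution with data $(u_0,h_0)$ is a pair $(u,h)$ with $u\in L^2_{loc}([0,\infty);\mathcal H)$, $\partial_tu\in L^2_{loc}([0,\infty);\mathcal H^*)$, $h,\,M(h)\in L^2_{loc}([0,\infty);L^2(\Sigma))$,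 $\partial_th\in L^2_{loc}([0,\infty);H^{1/2}(\Sigma))$ such that, for a.e. $t>0$ and all $v\in\mathcal H$, $$[\partial_tu,v]_{\mathcal H^*,\mathcal H}+\tfrac12(\mathbb Du,\mathbb Dv)_{L^2(\Omega)}+\int_{\{y=\ell\}}M(h)\,v_N\,dx=0,\qquad \partial_th=u_N\ \text{ on }\{y=\ell\},$$ with $\int_\Sigma h(x,t)\,dx=0$ for all $t\ge0$, and $u(0)=u_0$, $h(0)=h_0$; here $u$ and $h$ are taken to be their representatives that are continuous in time with values in $L^2$. The energy is $$\mathcal E(t)=\tfrac12\int_\Omega|u|^2+\tfrac12\int_\Sigma M(h)h=\tfrac12\int_\Omega|u(t)|^2+\tfrac12\sum_{\xi\in\mathbb Z^{N-1}}\mu(\xi)|\hat h(\xi,t)|^2 .$$ For data put $$B=\int_0^\ell\sum_{\xi}(1+|\xi|^2)^{s}|\hat u_0(\xi,y)|^2\,dy+\sum_\xi(1+|\xi|^2)^{s+3}|\hat h_0(\xi)|^2=\|u_0\|_{H^s_x(L^2_y)}^2+\|h_0\|_{H^{s+3}(\Sigma)}^2 .$$ 1. There are constants $K,C>0$, depending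 only on $N,\ell,g,\sigma,\theta,s,\alpha$, such that if $$\mu(\xi)=g+2\pi\sigma\frac{|\xi|}{(\log|\xi|)^\alpha}\quad\text{for }|\xi|>1,$$ then every weak solution whose data satisfy $B<\infty$ (that is, $u_0\in H^s_x(L^2_y)$ and $h_0\in H^{s+3}(\Sigma)$) obeys $$\mathcal E(t)\le K\,B\,\exp\bigl(-C\,t^{1/(1+\alpha)}\bigr)\quad\text{for all }t\ge0 .$$ 2. There is a constant $C>0$, depending only on $N,\ell,g,\sigma,\theta,s,\alpha$, and for every $t_0>1$ a constant $K>0$, depending only on $t_0$ and these parameters, such that if $$\mu(\xi)=g+2\pi\sigma\frac{|\xi|}{(\log\log|\xi|)^\alpha}\quad\text{for }|\xi|>e,$$ then every weak solution whose data satisfy $B<\infty$ obeys $$\mathcal E(t)\le K\,B\,\exp\Bigl(-C\,\frac{t}{(\log t)^\alpha}\Bigr)\quad\text{for all }t\ge t_0 .$$ -/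

import Mathlib

open MeasureTheory Set Filter Topology
open scoped ENNReal ContDiff

noncomputable section

namespace ViscousSlab

/-! ### The periodic slab

The horizontal cross section is the torus `𝕋^d = ℝ^d / ℤ^d`, where the total space dimension is
`N = d + 1`; the fluid occupies `𝕋^d × (0, ℓ)`.  Coordinates are indexed by `Fin (d + 1)`, the
last one being the vertical one. -/

/-- The product `𝕋^d × ℝ`, which contains the slab `𝕋^d × (0, ℓ)`. -/
abbrev Slab (d : ℕ) : Type := UnitAddTorus (Fin d) × ℝ

/-- Lebesgue (Haar) measure on `𝕋^d`, of total mass one. -/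
def torusMeasure (d : ℕ) : Measure (UnitAddTorus (Fin d)) :=
  Measure.pi fun _ => (AddCircle.haarAddCircle : Measure UnitAddCircle)

instance (d : ℕ) : IsProbabilityMeasure (torusMeasure d) := by
  unfold torusMeasure; infer_instance

/-- Lebesgue measure on `Ω = 𝕋^d × (0, ℓ)`. -/
def slabMeasure (d : ℕ) (ℓ : ℝ) : Measure (Slab d) :=
  (torusMeasure d).prod ((volume : Measure ℝ).restrict (Ioo 0 ℓ))

instance (d : ℕ) (ℓ : ℝ) : IsFiniteMeasure (slabMeasure d ℓ) := by
  unfold slabMeasure; infer_instance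

/-- The quotient map `ℝ^d × ℝ → 𝕋^d × ℝ`. -/
def toSlab (d : ℕ) (a : Fin (d + 1) → ℝ) : Slab d :=
  (fun i => (a i.castSucc : UnitAddCircle), a (Fin.last d))

/-- `φ` is a smooth function on `𝕋^d × ℝ`; restricting such `φ` to `𝕋^d × [0, ℓ]` gives the
functions that are smooth up to the boundary. -/
def IsSmooth {d : ℕ} (φ : Slab d → ℝ) : Prop := ContDiff ℝ ∞ (φ ∘ toSlab d)

/-- The classical partial derivative in the `i`-th coordinate direction. -/
def pderiv {d : ℕ} (i : Fin (d + 1)) (φ : Slab d → ℝ) (z : Slab d) : ℝ :=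
  deriv (fun s : ℝ => φ (z + toSlab d (Pi.single i s))) 0

/-! ### Square-integrable fields -/

/-- `L²(Ω; ℝ^N)`. -/
abbrev L2Vel (d : ℕ) (ℓ : ℝ) : Type :=
  Lp (EuclideanSpace ℝ (Fin (d + 1))) 2 (slabMeasure d ℓ)

/-- `L²(Ω; ℝ^{N × N})`. -/
abbrev L2Grad (d : ℕ) (ℓ : ℝ) : Type :=
  Lp (EuclideanSpace ℝ (Fin (d + 1) × Fin (d + 1))) 2 (slabMeasure d ℓ)

/-- `L²(Σ)` for `Σ = 𝕋^d`. -/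
abbrev L2Surf (d : ℕ) : Type := Lp ℝ 2 (torusMeasure d)

/-! ### Helper facts, used only to see that the solenoidal fields form a vector space -/

lemma toSlab_add (d : ℕ) (a b : Fin (d + 1) → ℝ) :
    toSlab d (a + b) = toSlab d a + toSlab d b := by
  ext i <;> simp [toSlab]

lemma isOpenQuotientMap_toSlab (d : ℕ) : IsOpenQuotientMap (toSlab d) := by
  have h1 : IsOpenQuotientMap (Pi.map fun (_ : Fin d) (r : ℝ) => (r : UnitAddCircle)) :=
    IsOpenQuotientMap.piMap fun _ => QuotientAddGroup.isOpenQuotientMap_mk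
  have h2 := h1.prodMap (IsOpenQuotientMap.id (X := ℝ))
  let e : (Fin (d + 1) → ℝ) ≃ₜ (Fin d → ℝ) × ℝ :=
    { toFun := fun a => (fun i => a i.castSucc, a (Fin.last d))
      invFun := fun p => Fin.snoc (α := fun _ => ℝ) p.1 p.2
      left_inv := fun a => by
        funext j
        refine Fin.lastCases ?_ (fun i => ?_) j <;> simp
      right_inv := fun p => by ext <;> simp
      continuous_toFun := by fun_prop
      continuous_invFun := by fun_prop }
  exact h2.comp e.isOpenQuotientMap

lemma IsSmooth.continuous {d : ℕ} {φ : Slab d → ℝ} (hφ : IsSmooth φ) : Continuous φ :=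
  (isOpenQuotientMap_toSlab d).continuous_comp_iff.1 (ContDiff.continuous hφ)

lemma pderiv_toSlab {d : ℕ} (i : Fin (d + 1)) {φ : Slab d → ℝ} (hφ : IsSmooth φ)
    (a : Fin (d + 1) → ℝ) :
    pderiv i φ (toSlab d a) = fderiv ℝ (φ ∘ toSlab d) a (Pi.single i 1) := by
  have hd : DifferentiableAt ℝ (φ ∘ toSlab d) a :=
    (ContDiff.differentiable hφ (by simp)) a
  rw [← hd.lineDeriv_eq_fderiv]
  unfold pderiv lineDeriv
  congr 1
  funext s
  rw [← toSlab_add]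
  congr 2
  rw [← Pi.single_smul]
  simp

lemma continuous_pderiv {d : ℕ} (i : Fin (d + 1)) {φ : Slab d → ℝ} (hφ : IsSmooth φ) :
    Continuous (pderiv i φ) := by
  refine (isOpenQuotientMap_toSlab d).continuous_comp_iff.1 ?_
  have : pderiv i φ ∘ toSlab d = fun a => fderiv ℝ (φ ∘ toSlab d) a (Pi.single i 1) :=
    funext fun a => pderiv_toSlab i hφ a
  rw [this]
  exact (ContDiff.continuous_fderiv hφ (by simp)).clm_apply continuous_const

lemma integrable_coord_mul {d : ℕ} {ℓ : ℝ} {ι : Type*} [Fintype ι]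
    (f : Lp (EuclideanSpace ℝ ι) 2 (slabMeasure d ℓ)) (j : ι)
    {ψ : Slab d → ℝ} (hψ : Continuous ψ) :
    Integrable (fun z => f z j * ψ z) (slabMeasure d ℓ) := by
  have hf : Integrable (fun z => f z j) (slabMeasure d ℓ) :=
    (EuclideanSpace.proj (𝕜 := ℝ) j).integrable_comp ((Lp.memLp f).integrable (by norm_num))
  have hK : IsCompact ((univ : Set (UnitAddTorus (Fin d))) ×ˢ Icc 0 ℓ) :=
    isCompact_univ.prod isCompact_Icc
  obtain ⟨C, hC⟩ := hK.exists_bound_of_continuousOn hψ.continuousOn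
  refine hf.mul_bdd (c := C) hψ.aestronglyMeasurable ?_
  have hmem : ∀ᵐ z ∂(slabMeasure d ℓ), z.2 ∈ Ioo 0 ℓ :=
    Measure.quasiMeasurePreserving_snd.ae (ae_restrict_mem measurableSet_Ioo)
  filter_upwards [hmem] with z hz
  exact hC z ⟨mem_univ _, Ioo_subset_Icc_self hz⟩

lemma integral_add_coord_mul {d : ℕ} {ℓ : ℝ} {ι : Type*} [Fintype ι]
    (f g : Lp (EuclideanSpace ℝ ι) 2 (slabMeasure d ℓ)) (j : ι)
    {ψ : Slab d → ℝ} (hψ : Continuous ψ) :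
    ∫ z, (f + g : Lp (EuclideanSpace ℝ ι) 2 (slabMeasure d ℓ)) z j * ψ z ∂(slabMeasure d ℓ)
      = (∫ z, f z j * ψ z ∂(slabMeasure d ℓ)) + ∫ z, g z j * ψ z ∂(slabMeasure d ℓ) := by
  rw [← integral_add (integrable_coord_mul f j hψ) (integrable_coord_mul g j hψ)]
  refine integral_congr_ae ?_
  filter_upwards [Lp.coeFn_add f g] with z hz
  rw [hz]
  simp [add_mul]

lemma integral_smul_coord_mul {d : ℕ} {ℓ : ℝ} {ι : Type*} [Fintype ι] (c : ℝ)
    (f : Lp (EuclideanSpace ℝ ι) 2 (slabMeasure d ℓ)) (j : ι) (ψ : Slab d → ℝ) :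
    ∫ z, (c • f : Lp (EuclideanSpace ℝ ι) 2 (slabMeasure d ℓ)) z j * ψ z ∂(slabMeasure d ℓ)
      = c * ∫ z, f z j * ψ z ∂(slabMeasure d ℓ) := by
  rw [← integral_const_mul]
  refine integral_congr_ae ?_
  filter_upwards [Lp.coeFn_smul c f] with z hz
  rw [hz]
  simp [mul_assoc]

lemma integral_zero_coord_mul {d : ℕ} {ℓ : ℝ} {ι : Type*} [Fintype ι] (j : ι)
    (ψ : Slab d → ℝ) :
    ∫ z, (0 : Lp (EuclideanSpace ℝ ι) 2 (slabMeasure d ℓ)) z j * ψ z ∂(slabMeasure d ℓ) = 0 := by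
  have := integral_smul_coord_mul (0 : ℝ)
    (0 : Lp (EuclideanSpace ℝ ι) 2 (slabMeasure d ℓ)) j ψ
  simpa using this

/-! ### Sobolev fields on the slab -/

/-- `G` is the weak gradient of `v` on `Ω`, with `G (i, j) = ∂_i v_j`: the test functions are the
smooth functions with compact support in the open slab. -/
def IsWeakGrad {d : ℕ} {ℓ : ℝ} (v : L2Vel d ℓ) (G : L2Grad d ℓ) : Prop :=
  ∀ i j : Fin (d + 1), ∀ φ : Slab d → ℝ, IsSmooth φ → tsupport φ ⊆ {z | z.2 ∈ Ioo 0 ℓ} →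
    ∫ z, v z j * pderiv i φ z ∂(slabMeasure d ℓ) = -∫ z, G z (i, j) * φ z ∂(slabMeasure d ℓ)

/-- For `v ∈ H¹(Ω; ℝ^N)` with weak gradient `G`, the trace of `v` on `{y = 0}` vanishes.  The trace
is the one determined by integration by parts in the vertical direction; the test functions are
smooth up to the boundary and vanish on `{y = ℓ}`, so that only `{y = 0}` contributes. -/
def BottomTraceZero {d : ℕ} {ℓ : ℝ} (v : L2Vel d ℓ) (G : L2Grad d ℓ) : Prop :=
  ∀ j : Fin (d + 1), ∀ φ : Slab d → ℝ, IsSmooth φ → (∀ x, φ (x, ℓ) = 0) →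
    ∫ z, v z j * pderiv (Fin.last d) φ z ∂(slabMeasure d ℓ)
      + ∫ z, G z (Fin.last d, j) * φ z ∂(slabMeasure d ℓ) = 0

/-- The velocity space: all `u ∈ H¹(Ω; ℝ^N)` with `div u = 0` in `Ω` and `u = 0` on `{y = 0}`.
An element is stored as the pair `(u, ∇u)` in `L² × L²`, which gives it the `H¹` norm (up to
equivalence). -/
def Hsol (d : ℕ) (ℓ : ℝ) : Submodule ℝ (L2Vel d ℓ × L2Grad d ℓ) where
  carrier := {p | IsWeakGrad p.1 p.2 ∧ BottomTraceZero p.1 p.2 ∧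
    ∀ᵐ z ∂(slabMeasure d ℓ), ∑ i : Fin (d + 1), p.2 z (i, i) = 0}
  add_mem' := by
    rintro ⟨v, G⟩ ⟨w, K⟩ ⟨h1, h2, h3⟩ ⟨k1, k2, k3⟩
    refine ⟨fun i j φ hφ hs => ?_, fun j φ hφ hs => ?_, ?_⟩
    · have a := h1 i j φ hφ hs
      have b := k1 i j φ hφ hs
      simp only [Prod.mk_add_mk] at a b ⊢
      rw [integral_add_coord_mul _ _ _ (continuous_pderiv i hφ),
        integral_add_coord_mul _ _ _ hφ.continuous, a, b]
      ring
    · have a := h2 j φ hφ hs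
      have b := k2 j φ hφ hs
      simp only [Prod.mk_add_mk] at a b ⊢
      rw [integral_add_coord_mul _ _ _ (continuous_pderiv _ hφ),
        integral_add_coord_mul _ _ _ hφ.continuous]
      linarith
    · filter_upwards [h3, k3, Lp.coeFn_add G K] with z a b c
      simp only [Prod.mk_add_mk] at a b ⊢
      rw [c]
      simp only [Pi.add_apply, PiLp.add_apply, Finset.sum_add_distrib, a, b, add_zero]
  zero_mem' := by
    refine ⟨fun i j φ _ _ => ?_, fun j φ _ _ => ?_, ?_⟩
    · simp only [Prod.fst_zero, Prod.snd_zero, integral_zero_coord_mul, neg_zero]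
    · simp only [Prod.fst_zero, Prod.snd_zero, integral_zero_coord_mul, add_zero]
    · filter_upwards [Lp.coeFn_zero (EuclideanSpace ℝ (Fin (d + 1) × Fin (d + 1))) 2
        (slabMeasure d ℓ)] with z hz
      simp only [Prod.snd_zero]
      rw [hz]
      simp
  smul_mem' := by
    rintro c ⟨v, G⟩ ⟨h1, h2, h3⟩
    refine ⟨fun i j φ hφ hs => ?_, fun j φ hφ hs => ?_, ?_⟩
    · have a := h1 i j φ hφ hs
      simp only [Prod.smul_mk] at a ⊢
      rw [integral_smul_coord_mul, integral_smul_coord_mul, a]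
      ring
    · have a := h2 j φ hφ hs
      simp only [Prod.smul_mk] at a ⊢
      rw [integral_smul_coord_mul, integral_smul_coord_mul, ← mul_add, a, mul_zero]
    · filter_upwards [h3, Lp.coeFn_smul c G] with z a b
      simp only [Prod.smul_mk] at a ⊢
      rw [b]
      simp only [Pi.smul_apply, PiLp.smul_apply, smul_eq_mul, ← Finset.mul_sum, a, mul_zero]

/-- The underlying `L²` field `u`. -/
abbrev Hsol.vel {d : ℕ} {ℓ : ℝ} (w : Hsol d ℓ) : L2Vel d ℓ := w.1.1

/-- The gradient, `Hsol.grad w z (i, j) = ∂_i u_j (z)`. -/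
abbrev Hsol.grad {d : ℕ} {ℓ : ℝ} (w : Hsol d ℓ) : L2Grad d ℓ := w.1.2

/-- `τ ∈ L²(Σ)` is the trace of the vertical component `u_N` on the top surface `{y = ℓ}`, again
through integration by parts; the test functions vanish on `{y = 0}`. -/
def IsTopTrace {d : ℕ} {ℓ : ℝ} (w : Hsol d ℓ) (τ : L2Surf d) : Prop :=
  ∀ φ : Slab d → ℝ, IsSmooth φ → (∀ x, φ (x, 0) = 0) →
    ∫ z, Hsol.vel w z (Fin.last d) * pderiv (Fin.last d) φ z ∂(slabMeasure d ℓ)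
      + ∫ z, Hsol.grad w z (Fin.last d, Fin.last d) * φ z ∂(slabMeasure d ℓ)
      = ∫ x, τ x * φ (x, ℓ) ∂(torusMeasure d)

/-- The `L²(Ω)` inner product of the symmetrized gradients, `(𝔻u, 𝔻v)`, where
`(𝔻u)_{ij} = ∂_i u_j + ∂_j u_i`. -/
def symGradInner {d : ℕ} {ℓ : ℝ} (u v : Hsol d ℓ) : ℝ :=
  ∫ z, ∑ i : Fin (d + 1), ∑ j : Fin (d + 1),
    (Hsol.grad u z (i, j) + Hsol.grad u z (j, i)) * (Hsol.grad v z (i, j) + Hsol.grad v z (j, i)) ∂(slabMeasure d ℓ)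

/-- The embedding of `L²(Ω; ℝ^N)` into the dual of `Hsol` through the `L²` inner product. -/
def toDual {d : ℕ} {ℓ : ℝ} (w : L2Vel d ℓ) : StrongDual ℝ (Hsol d ℓ) :=
  (innerSL ℝ w).comp ((ContinuousLinearMap.fst ℝ (L2Vel d ℓ) (L2Grad d ℓ)).comp (Hsol d ℓ).subtypeL)

/-! ### Functions of time with values in a normed space -/

/-- `f ∈ L²_loc([0, ∞); X)`. -/
def IsL2Loc {X : Type*} [NormedAddCommGroup X] (f : ℝ → X) : Prop :=
  ∀ T : ℝ, 0 < T → MemLp f 2 ((volume : Measure ℝ).restrict (Ioo 0 T))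

/-- `f'` is the weak derivative of `f` on the time interval `(0, ∞)`. -/
def HasWeakTimeDeriv {X : Type*} [NormedAddCommGroup X] [NormedSpace ℝ X] (f f' : ℝ → X) : Prop :=
  ∀ φ : ℝ → ℝ, ContDiff ℝ ∞ φ → HasCompactSupport φ → tsupport φ ⊆ Ioi 0 →
    ∫ t in Ioi 0, deriv φ t • f t = -∫ t in Ioi 0, φ t • f' t

/-! ### Fourier side -/

/-- The Euclidean length of a frequency `ξ ∈ ℤ^d`. -/
def freqNorm {d : ℕ} (ξ : Fin d → ℤ) : ℝ := Real.sqrt (∑ i, (ξ i : ℝ) ^ 2)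

/-- The Fourier coefficient `∫_Σ f(x) e^{-2πi ξ·x} dx`. -/
def surfFourier {d : ℕ} (f : UnitAddTorus (Fin d) → ℝ) (ξ : Fin d → ℤ) : ℂ :=
  UnitAddTorus.mFourierCoeff (fun x => (f x : ℂ)) ξ

/-- The squared norm of `H^s(Σ)`. -/
def surfSobolevSq {d : ℕ} (s : ℝ) (f : L2Surf d) : ℝ≥0∞ :=
  ∑' ξ : Fin d → ℤ, ENNReal.ofReal ((1 + freqNorm ξ ^ 2) ^ s * ‖surfFourier f ξ‖ ^ 2)

/-- The squared norm of `H^s_x(L²_y)` on the slab: `∫_0^ℓ ∑_ξ (1 + |ξ|²)^s |û(ξ, y)|² dy`. -/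
def slabSobolevSq {d : ℕ} {ℓ : ℝ} (s : ℝ) (u : L2Vel d ℓ) : ℝ≥0∞ :=
  ∫⁻ y in Ioo 0 ℓ, ∑' ξ : Fin d → ℤ, ENNReal.ofReal ((1 + freqNorm ξ ^ 2) ^ s *
    ∑ j : Fin (d + 1), ‖surfFourier (fun x => u (x, y) j) ξ‖ ^ 2)

/-- The standing two-sided bound on the symbol of the boundary operator. -/
def SymbolBound {d : ℕ} (θ : ℝ) (μ : (Fin d → ℤ) → ℝ) : Prop :=
  ∀ ξ, θ ≤ μ ξ ∧ μ ξ ≤ 1 / θ * (1 + freqNorm ξ) ^ 3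

/-- `k = M(f)`, where `M` is the Fourier multiplication operator with symbol `μ`. -/
def IsMultiplier {d : ℕ} (μ : (Fin d → ℤ) → ℝ) (f k : L2Surf d) : Prop :=
  ∀ ξ, surfFourier k ξ = (μ ξ : ℂ) * surfFourier f ξ

/-- The energy `½ ∫_Ω |u|² + ½ ∫_Σ M(h) h`; the second integral is expressed on the Fourier side
as `∑_ξ μ(ξ) |ĥ(ξ)|²`, which has a meaning in `[0, ∞]` for every `h ∈ L²(Σ)`. -/
def energy {d : ℕ} {ℓ : ℝ} (μ : (Fin d → ℤ) → ℝ) (u : L2Vel d ℓ) (h : L2Surf d) : ℝ≥0∞ :=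
  ENNReal.ofReal (1 / 2 * ∫ z, ‖u z‖ ^ 2 ∂(slabMeasure d ℓ))
    + ∑' ξ : Fin d → ℤ, ENNReal.ofReal (1 / 2 * (μ ξ * ‖surfFourier h ξ‖ ^ 2))

/-! ### Weak solutions -/

/-- `(u, h)` is a weak solution on `[0, ∞)` of the linearized problem with boundary operator `M` of
symbol `μ` and initial data `(u₀, h₀)`.  As usual `u` and `h` denote the representatives that are
continuous in time with values in `L²` (these exist by the regularity required below, and they give
the initial conditions their meaning); `w` is `u` as a function with values in `Hsol`, `u'` and `h'`
are the weak time derivatives, and `Mh` is `M(h)`. -/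
structure IsWeakSolution {d : ℕ} {ℓ : ℝ} (μ : (Fin d → ℤ) → ℝ) (u₀ : L2Vel d ℓ) (h₀ : L2Surf d)
    (u : ℝ → L2Vel d ℓ) (h : ℝ → L2Surf d) : Prop where
  continuousOn_u : ContinuousOn u (Ici 0)
  continuousOn_h : ContinuousOn h (Ici 0)
  initial_u : u 0 = u₀
  initial_h : h 0 = h₀
  zero_average : ∀ t, 0 ≤ t → ∫ x, h t x ∂(torusMeasure d) = 0
  weak_form : ∃ (w : ℝ → Hsol d ℓ) (u' : ℝ → StrongDual ℝ (Hsol d ℓ)) (Mh h' : ℝ → L2Surf d),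
    (∀ᵐ t ∂((volume : Measure ℝ).restrict (Ioi 0)), Hsol.vel (w t) = u t) ∧
    IsL2Loc w ∧
    IsL2Loc u' ∧ HasWeakTimeDeriv (fun t => toDual (u t)) u' ∧
    IsL2Loc h ∧
    IsL2Loc Mh ∧ (∀ᵐ t ∂((volume : Measure ℝ).restrict (Ioi 0)), IsMultiplier μ (h t) (Mh t)) ∧
    IsL2Loc h' ∧ HasWeakTimeDeriv h h' ∧
    (∀ T : ℝ, 0 < T → ∫⁻ t in Ioo 0 T, surfSobolevSq (1 / 2) (h' t) < ⊤) ∧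
    -- the momentum equation, as an identity in the dual of `Hsol`; `τ` is `v_N` on `{y = ℓ}`
    (∀ᵐ t ∂((volume : Measure ℝ).restrict (Ioi 0)), ∀ (v : Hsol d ℓ) (τ : L2Surf d),
      IsTopTrace v τ →
        u' t v + 1 / 2 * symGradInner (w t) v + ∫ x, Mh t x * τ x ∂(torusMeasure d) = 0) ∧
    -- the kinematic boundary condition `∂_t h = u_N` on `{y = ℓ}`
    (∀ᵐ t ∂((volume : Measure ℝ).restrict (Ioi 0)), IsTopTrace (w t) (h' t))

end ViscousSlab

end

noncomputable section

namespace ViscousSlab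

/-! ### Smooth functions on the slab -/

/-! The problem is linear and invariant under horizontal translations, so it decouples into the
frequencies `ξ`. Pairing with the cosine and sine of frequency `ξ` leaves a system in `y` alone,
whose energy decreases at half the rate `Q`, the squared `L²` norm of the symmetrized gradient of
these modes (`IsModeFlow.hasDerivAt_energy`). A Korn–Poincaré inequality bounds the velocity by `Q`
(`IsMode.sum_norm_sq_le`), but `Q` does not see the height.

The height is recovered by testing the momentum equation with a solenoidal field `v_k` whose
vertical trace is a single surface mode. Concentrated in a layer of thickness about `1/|ξ|` below
the surface, it has bounded `L²` norm and squared gradient norm `O(|ξ|)` (`exists_extension`).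
Adding `δ ∑ η_k (u, v_k)` to the energy produces the missing term `-δ μ |η|²`, at a cost of order `δ
(1 + |ξ|/μ) Q`. This cost is absorbed when `δ` is a small multiple of `1/(1 + |ξ|/μ)`, and the
energy at frequency `ξ` then decays like `exp(-c t/(1 + |ξ|/μ))` (`exists_decay_rate`).

Weak solutions are not differentiable enough in time for this computation. Averaging over slightly
later times preserves the equations and gives differentiable velocities and heights. The decay
estimate has constants independent of the averaging and passes to the limit because `u` and `h` are
continuous in `L²` (`exists_modeEnergy_decay`).

By Parseval the energy is the sum over frequencies (`energy_eq_tsum`). The rate degenerates at high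
frequency, where `|ξ|/μ` grows like a power of `log|ξ|` or of `log log|ξ|`; there the smoothness of
the data contributes `(1 + |ξ|²)^(-s)`. It remains to bound `c t/(1 + |ξ|/μ) + s log(1 + |ξ|²)`
below uniformly in `ξ` (`exists_energy_le`). The split is at `log|ξ| = t^(1/(1+α))` in the first
case and at `log|ξ| = t` in the second (`exists_exponent_log`, `exists_exponent_loglog`). -/

lemma toSlab_surjective (d : ℕ) : Function.Surjective (toSlab d) :=
  (isOpenQuotientMap_toSlab d).surjective

lemma toSlab_single_castSucc {d : ℕ} (i : Fin d) (s : ℝ) :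
    toSlab d (Pi.single i.castSucc s) = (Pi.single i (s : UnitAddCircle), 0) := by
  ext j
  · by_cases h : j = i
    · subst h; simp [toSlab]
    · simp [toSlab, Pi.single_apply, h]
  · simp [toSlab, Pi.single_apply, (Fin.castSucc_ne_last i).symm]

lemma toSlab_single_last {d : ℕ} (s : ℝ) :
    toSlab d (Pi.single (Fin.last d) s) = (0, s) := by
  ext j
  · simp [toSlab, Fin.castSucc_ne_last]
  · simp [toSlab]

lemma IsSmooth.hasDerivAt_line {d : ℕ} {φ : Slab d → ℝ} (hφ : IsSmooth φ) (i : Fin (d + 1))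
    (z : Slab d) (s : ℝ) :
    HasDerivAt (fun s : ℝ => φ (z + toSlab d (Pi.single i s)))
      (pderiv i φ (z + toSlab d (Pi.single i s))) s := by
  obtain ⟨a, rfl⟩ := toSlab_surjective d z
  rw [← toSlab_add, pderiv_toSlab i hφ]
  have hd : DifferentiableAt ℝ (φ ∘ toSlab d) (a + Pi.single i s) :=
    (ContDiff.differentiable hφ (by simp)) _
  have hl : HasDerivAt (fun s : ℝ => a + Pi.single i s) (Pi.single i (1 : ℝ)) s := by
    refine HasDerivAt.const_add _ ?_
    have := (hasDerivAt_id s).smul_const (Pi.single i (1 : ℝ) : Fin (d + 1) → ℝ)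
    simpa [← Pi.single_smul] using this
  have := hd.hasFDerivAt.comp_hasDerivAt s hl
  simpa only [Function.comp_def, toSlab_add] using this

lemma IsSmooth.hasDerivAt_vert {d : ℕ} {φ : Slab d → ℝ} (hφ : IsSmooth φ)
    (x : UnitAddTorus (Fin d)) (y : ℝ) :
    HasDerivAt (fun y => φ (x, y)) (pderiv (Fin.last d) φ (x, y)) y := by
  simpa [toSlab_single_last] using hφ.hasDerivAt_line (Fin.last d) (x, 0) y

lemma IsSmooth.contDiff_vert {d : ℕ} {φ : Slab d → ℝ} (hφ : IsSmooth φ)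
    (x : UnitAddTorus (Fin d)) : ContDiff ℝ ∞ (fun y => φ (x, y)) := by
  obtain ⟨a, ha⟩ := toSlab_surjective d (x, 0)
  have : (fun y : ℝ => φ (x, y)) = (φ ∘ toSlab d) ∘ fun y => a + Pi.single (Fin.last d) y := by
    funext y
    simp [toSlab_add, ha, toSlab_single_last]
  rw [this]
  refine ContDiff.comp hφ (contDiff_const.add ?_)
  exact (LinearMap.single ℝ (fun _ : Fin (d + 1) => ℝ) (Fin.last d)).toContinuousLinearMap.contDiff

lemma IsSmooth.mul {d : ℕ} {φ ψ : Slab d → ℝ} (hφ : IsSmooth φ) (hψ : IsSmooth ψ) :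
    IsSmooth (fun z => φ z * ψ z) := ContDiff.mul hφ hψ

lemma pderiv_eq_of_hasDerivAt {d : ℕ} {i : Fin (d + 1)} {φ : Slab d → ℝ} {z : Slab d} {c : ℝ}
    (h : HasDerivAt (fun s : ℝ => φ (z + toSlab d (Pi.single i s))) c 0) : pderiv i φ z = c :=
  h.deriv

lemma IsSmooth.hasDerivAt_zero {d : ℕ} {φ : Slab d → ℝ} (hφ : IsSmooth φ) (i : Fin (d + 1))
    (z : Slab d) :
    HasDerivAt (fun s : ℝ => φ (z + toSlab d (Pi.single i s))) (pderiv i φ z) 0 := by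
  have := hφ.hasDerivAt_line i z 0
  have h0 : toSlab d (0 : Fin (d + 1) → ℝ) = 0 := by
    ext j <;> simp [toSlab]
  simpa [h0] using this

lemma pderiv_mul {d : ℕ} (i : Fin (d + 1)) {φ ψ : Slab d → ℝ} (hφ : IsSmooth φ)
    (hψ : IsSmooth ψ) (z : Slab d) :
    pderiv i (fun z => φ z * ψ z) z = pderiv i φ z * ψ z + φ z * pderiv i ψ z := by
  refine pderiv_eq_of_hasDerivAt ?_
  have := (hφ.hasDerivAt_zero i z).mul (hψ.hasDerivAt_zero i z)
  have h0 : toSlab d (0 : Fin (d + 1) → ℝ) = 0 := by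
    ext j <;> simp [toSlab]
  simp only [h0, Pi.single_zero, add_zero] at this
  exact this

/-! ### Integration over the torus. -/

instance (d : ℕ) : (torusMeasure d).IsAddRightInvariant := by
  unfold torusMeasure; infer_instance

lemma integrable_torus {d : ℕ} {f : UnitAddTorus (Fin d) → ℝ} (hf : Continuous f) :
    Integrable f (torusMeasure d) := by
  obtain ⟨C, hC⟩ := isCompact_univ.exists_bound_of_continuousOn hf.continuousOn
  exact Integrable.of_bound hf.aestronglyMeasurable C (ae_of_all _ fun x => hC x (mem_univ x))

/-- The integral over the torus of a horizontal derivative vanishes. -/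
lemma integral_pderiv_castSucc {d : ℕ} (i : Fin d) {φ : Slab d → ℝ} (hφ : IsSmooth φ) (y : ℝ) :
    ∫ x, pderiv i.castSucc φ (x, y) ∂(torusMeasure d) = 0 := by
  -- Average over all translates in direction `i`: translation invariance makes the torus integral
  -- independent of `s`, while for fixed `x` the integral over one period `s ∈ [0, 1]` vanishes.
  -- Fubini compares the two.
  set F : ℝ → UnitAddTorus (Fin d) → ℝ := fun s x =>
    pderiv i.castSucc φ ((x, y) + toSlab d (Pi.single i.castSucc s)) with hF
  have hline : Continuous fun s : ℝ => toSlab d (Pi.single i.castSucc s) :=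
    (isOpenQuotientMap_toSlab d).continuous.comp (continuous_single (A := fun _ : Fin (d + 1) => ℝ) i.castSucc)
  have hcont : Continuous (Function.uncurry F) :=
    (continuous_pderiv _ hφ).comp
      (Continuous.add (by fun_prop) (hline.comp continuous_fst))
  have h1 : ∀ s, ∫ x, F s x ∂(torusMeasure d) = ∫ x, pderiv i.castSucc φ (x, y) ∂(torusMeasure d) := by
    intro s
    have := integral_add_right_eq_self (μ := torusMeasure d)
      (fun x => pderiv i.castSucc φ (x, y)) (Pi.single i (s : UnitAddCircle))
    rw [← this]
    simp [hF, toSlab_single_castSucc]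
  have h2 : ∀ x, ∫ s in (0 : ℝ)..1, F s x = 0 := by
    intro x
    rw [intervalIntegral.integral_eq_sub_of_hasDerivAt
      (fun s _ => hφ.hasDerivAt_line i.castSucc (x, y) s)]
    · have h1 : ((1 : ℝ) : UnitAddCircle) = 0 := AddCircle.coe_period 1
      simp only [toSlab_single_castSucc, h1]
      simp
    · exact (hcont.comp (by fun_prop : Continuous fun s : ℝ => (s, x))).intervalIntegrable _ _
  have h3 : ∫ s in (0 : ℝ)..1, ∫ x, F s x ∂(torusMeasure d)
      = ∫ x, (∫ s in (0 : ℝ)..1, F s x) ∂(torusMeasure d) := by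
    simp only [intervalIntegral.integral_of_le zero_le_one]
    refine integral_integral_swap ?_
    obtain ⟨C, hC⟩ := (isCompact_Icc.prod isCompact_univ :
      IsCompact (Icc (0 : ℝ) 1 ×ˢ (univ : Set (UnitAddTorus (Fin d))))).exists_bound_of_continuousOn
      hcont.continuousOn
    refine Integrable.of_bound hcont.aestronglyMeasurable C ?_
    have hmem : ∀ᵐ z ∂(((volume : Measure ℝ).restrict (Ioc 0 1)).prod (torusMeasure d)),
        z.1 ∈ Ioc (0 : ℝ) 1 :=
      Measure.quasiMeasurePreserving_fst.ae (ae_restrict_mem measurableSet_Ioc)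
    filter_upwards [hmem] with z hz
    exact hC z ⟨Ioc_subset_Icc_self hz, mem_univ _⟩
  simpa [h1, h2] using h3

/-! ### Trigonometric modes -/

/-- The real modes `cos (2π ξ·x)` (index `false`) and `sin (2π ξ·x)` (index `true`). -/
def trig {d : ℕ} (ξ : Fin d → ℤ) (k : Bool) (x : UnitAddTorus (Fin d)) : ℝ :=
  if k then (UnitAddTorus.mFourier ξ x).im else (UnitAddTorus.mFourier ξ x).re

/-- The sign in the derivative of a mode. -/
def trigSign (k : Bool) : ℝ := if k then 1 else -1

lemma trigSign_sq (k : Bool) : trigSign k * trigSign k = 1 := by cases k <;> simp [trigSign]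

lemma continuous_trig {d : ℕ} (ξ : Fin d → ℤ) (k : Bool) : Continuous (trig ξ k) := by
  cases k
  · exact Complex.continuous_re.comp (UnitAddTorus.mFourier ξ).continuous
  · exact Complex.continuous_im.comp (UnitAddTorus.mFourier ξ).continuous

lemma norm_mFourier_apply {d : ℕ} (ξ : Fin d → ℤ) (x : UnitAddTorus (Fin d)) :
    ‖UnitAddTorus.mFourier ξ x‖ = 1 := by
  simp only [UnitAddTorus.mFourier, ContinuousMap.coe_mk, norm_prod, fourier_apply,
    Circle.norm_coe, Finset.prod_const_one]

lemma abs_trig_le {d : ℕ} (ξ : Fin d → ℤ) (k : Bool) (x : UnitAddTorus (Fin d)) :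
    |trig ξ k x| ≤ 1 := by
  rw [← norm_mFourier_apply ξ x]
  cases k
  · exact Complex.abs_re_le_norm _
  · exact Complex.abs_im_le_norm _

/-- The phase `2π ξ·a`. -/
def phase {d : ℕ} (ξ : Fin d → ℤ) (a : Fin d → ℝ) : ℝ := 2 * Real.pi * ∑ i, ξ i * a i

lemma mFourier_coe {d : ℕ} (ξ : Fin d → ℤ) (a : Fin d → ℝ) :
    UnitAddTorus.mFourier ξ (fun i => (a i : UnitAddCircle)) =
      Complex.exp (phase ξ a * Complex.I) := by
  simp only [UnitAddTorus.mFourier, ContinuousMap.coe_mk, fourier_coe_apply, phase]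
  rw [← Complex.exp_sum]
  congr 1
  push_cast
  rw [Finset.mul_sum, Finset.sum_mul]
  refine Finset.sum_congr rfl fun i _ => ?_
  simp; ring

lemma trig_coe {d : ℕ} (ξ : Fin d → ℤ) (k : Bool) (a : Fin d → ℝ) :
    trig ξ k (fun i => (a i : UnitAddCircle)) =
      if k then Real.sin (phase ξ a) else Real.cos (phase ξ a) := by
  unfold trig
  rw [mFourier_coe, Complex.exp_mul_I]
  cases k <;> simp [← Complex.ofReal_cos, ← Complex.ofReal_sin]

lemma contDiff_phase {d : ℕ} (ξ : Fin d → ℤ) :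
    ContDiff ℝ ∞ (fun a : Fin (d + 1) → ℝ => phase ξ (fun i => a i.castSucc)) := by
  unfold phase
  fun_prop

lemma isSmooth_trig {d : ℕ} (ξ : Fin d → ℤ) (k : Bool) :
    IsSmooth (fun z : Slab d => trig ξ k z.1) := by
  have : (fun z : Slab d => trig ξ k z.1) ∘ toSlab d = fun a =>
      if k then Real.sin (phase ξ (fun i => a i.castSucc))
      else Real.cos (phase ξ (fun i => a i.castSucc)) := by
    funext a
    simp only [Function.comp, toSlab, trig_coe]
  unfold IsSmooth
  rw [this]
  cases k
  · simpa using (contDiff_phase ξ).cos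
  · simpa using (contDiff_phase ξ).sin

lemma isSmooth_vert {d : ℕ} {η : ℝ → ℝ} (hη : ContDiff ℝ ∞ η) :
    IsSmooth (fun z : Slab d => η z.2) := by
  change ContDiff ℝ ∞ fun a : Fin (d + 1) → ℝ => η (a (Fin.last d))
  exact hη.comp (by fun_prop)

lemma pderiv_castSucc_trig {d : ℕ} (ξ : Fin d → ℤ) (k : Bool) (i : Fin d) (z : Slab d) :
    pderiv i.castSucc (fun z : Slab d => trig ξ k z.1) z =
      2 * Real.pi * ξ i * trigSign k * trig ξ (!k) z.1 := by
  obtain ⟨a, rfl⟩ := toSlab_surjective d z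
  refine pderiv_eq_of_hasDerivAt ?_
  have hph : HasDerivAt (fun s : ℝ => phase ξ fun j =>
      (a + Pi.single i.castSucc s : Fin (d + 1) → ℝ) j.castSucc) (2 * Real.pi * ξ i) 0 := by
    have : (fun s : ℝ => phase ξ fun j => (a + Pi.single i.castSucc s : Fin (d + 1) → ℝ) j.castSucc)
        = fun s => phase ξ (fun j => a j.castSucc) + (2 * Real.pi * ξ i) * s := by
      funext s
      simp only [phase, Pi.add_apply, mul_add, Finset.sum_add_distrib, Pi.single_apply,
        Fin.castSucc_inj, mul_ite, mul_zero, Finset.sum_ite_eq', Finset.mem_univ, if_true]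
      ring
    rw [this]
    simpa using ((hasDerivAt_id (0 : ℝ)).const_mul (2 * Real.pi * ξ i)).const_add
      (phase ξ (fun j => a j.castSucc))
  have hz : (a + Pi.single i.castSucc (0 : ℝ) : Fin (d + 1) → ℝ) = a := by simp
  simp only [← toSlab_add]
  simp only [toSlab, trig_coe]
  cases k
  · have := hph.cos
    simp only [hz] at this
    refine HasDerivAt.congr_deriv this ?_
    simp only [trigSign, Bool.not_false, if_true, Bool.false_eq_true, if_false]
    ring
  · have := hph.sin
    simp only [hz] at this
    refine HasDerivAt.congr_deriv this ?_
    simp only [trigSign, Bool.not_true, if_true, Bool.false_eq_true, if_false]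
    ring

lemma pderiv_last_trig {d : ℕ} (ξ : Fin d → ℤ) (k : Bool) (z : Slab d) :
    pderiv (Fin.last d) (fun z : Slab d => trig ξ k z.1) z = 0 := by
  refine pderiv_eq_of_hasDerivAt ?_
  simpa [toSlab_single_last] using hasDerivAt_const (0 : ℝ) (trig ξ k z.1)

lemma pderiv_castSucc_vert {d : ℕ} (η : ℝ → ℝ) (i : Fin d) (z : Slab d) :
    pderiv i.castSucc (fun z : Slab d => η z.2) z = 0 := by
  refine pderiv_eq_of_hasDerivAt ?_
  simpa [toSlab_single_castSucc] using hasDerivAt_const (0 : ℝ) (η z.2)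

lemma pderiv_last_vert {d : ℕ} {η : ℝ → ℝ} (hη : ContDiff ℝ ∞ η) (z : Slab d) :
    pderiv (Fin.last d) (fun z : Slab d => η z.2) z = deriv η z.2 := by
  have h := (isSmooth_vert (d := d) hη).hasDerivAt_vert z.1 z.2
  exact h.deriv.symm

/-- Integration by parts on the torus against a mode. -/
lemma integral_trig_mul_pderiv {d : ℕ} (ξ : Fin d → ℤ) (k : Bool) (i : Fin d) {φ : Slab d → ℝ}
    (hφ : IsSmooth φ) (y : ℝ) :
    ∫ x, trig ξ k x * pderiv i.castSucc φ (x, y) ∂(torusMeasure d) =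
      -(2 * Real.pi * ξ i * trigSign k) * ∫ x, trig ξ (!k) x * φ (x, y) ∂(torusMeasure d) := by
  have h0 := integral_pderiv_castSucc i ((isSmooth_trig ξ k).mul hφ) y
  simp only [pderiv_mul i.castSucc (isSmooth_trig ξ k) hφ, pderiv_castSucc_trig] at h0
  have hc1 : Continuous fun x => φ (x, y) := hφ.continuous.comp (by fun_prop)
  have hc2 : Continuous fun x => pderiv i.castSucc φ (x, y) :=
    (continuous_pderiv _ hφ).comp (by fun_prop)
  rw [integral_add] at h0
  · rw [eq_neg_of_add_eq_zero_right h0, ← integral_const_mul, ← integral_neg]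
    refine integral_congr_ae (ae_of_all _ fun x => ?_)
    simp only
    ring
  · exact integrable_torus ((continuous_const.mul (continuous_trig ξ (!k))).mul hc1)
  · exact integrable_torus ((continuous_trig ξ k).mul hc2)

end ViscousSlab
end

noncomputable section

namespace ViscousSlab

/-! ### Synthesis and analysis of a single mode -/

/-- `L²(0, ℓ; E)`. -/
abbrev L2Int (ℓ : ℝ) (E : Type*) [NormedAddCommGroup E] : Type _ :=
  Lp E 2 ((volume : Measure ℝ).restrict (Ioo 0 ℓ))

section Modes

variable {d : ℕ} {ℓ : ℝ}
variable {E : Type*} [NormedAddCommGroup E] [InnerProductSpace ℝ E]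
variable {F : Type*} [NormedAddCommGroup F] [InnerProductSpace ℝ F]

/-- The torus has total mass one, so functions of `y` alone lift to the slab without change of `L²`
norm. -/
lemma measurePreserving_height (d : ℕ) (ℓ : ℝ) :
    MeasurePreserving (Prod.snd : Slab d → ℝ) (slabMeasure d ℓ)
      ((volume : Measure ℝ).restrict (Ioo 0 ℓ)) :=
  measurePreserving_snd

lemma memLp_synth (ξ : Fin d → ℤ) (k : Bool) (a : L2Int ℓ E) :
    MemLp (fun z : Slab d => trig ξ k z.1 • a z.2) 2 (slabMeasure d ℓ) := by
  have h := (Lp.memLp a).comp_measurePreserving (measurePreserving_height d ℓ)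
  refine h.of_le ?_ (ae_of_all _ fun z => ?_)
  · exact ((continuous_trig ξ k).comp continuous_fst).aestronglyMeasurable.smul
      h.aestronglyMeasurable
  · simpa [norm_smul] using mul_le_mul_of_nonneg_right (abs_trig_le ξ k z.1) (norm_nonneg (a z.2))

/-- The synthesis operator `a ↦ trig(x) a(y)`. -/
def synth (ξ : Fin d → ℤ) (k : Bool) : L2Int ℓ E →L[ℝ] Lp E 2 (slabMeasure d ℓ) :=
  LinearMap.mkContinuous
    { toFun := fun a => (memLp_synth ξ k a).toLp _
      map_add' := fun a b => by
        rw [← MemLp.toLp_add]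
        refine MemLp.toLp_congr _ _ ?_
        filter_upwards [(measurePreserving_height d ℓ).quasiMeasurePreserving.ae
          (Lp.coeFn_add a b)] with z hz
        simp only [Pi.add_apply] at hz ⊢
        rw [hz, smul_add]
      map_smul' := fun c a => by
        rw [RingHom.id_apply, ← MemLp.toLp_const_smul]
        refine MemLp.toLp_congr _ _ ?_
        filter_upwards [(measurePreserving_height d ℓ).quasiMeasurePreserving.ae
          (Lp.coeFn_smul c a)] with z hz
        simp only [Pi.smul_apply] at hz ⊢
        rw [hz, smul_comm] } 1 fun a => by
    rw [← Lp.norm_compMeasurePreserving a (measurePreserving_height d ℓ)]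
    refine Lp.norm_le_mul_norm_of_ae_le_mul ?_
    filter_upwards [(memLp_synth ξ k a).coeFn_toLp,
      Lp.coeFn_compMeasurePreserving a (measurePreserving_height d ℓ)] with z h1 h2
    simp only [LinearMap.coe_mk, AddHom.coe_mk]
    rw [h1, h2, norm_smul]
    exact mul_le_mul_of_nonneg_right (abs_trig_le ξ k z.1) (norm_nonneg _)

lemma coeFn_synth (ξ : Fin d → ℤ) (k : Bool) (a : L2Int ℓ E) :
    synth ξ k a =ᵐ[slabMeasure d ℓ] fun z => trig ξ k z.1 • a z.2 :=
  (memLp_synth ξ k a).coeFn_toLp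

/-- Synthesis multiplies by a scalar function, so it commutes with constant linear maps of the
values. Components and symmetrization therefore pass through it, and through `anal` by duality. -/
lemma synth_compLpL (ξ : Fin d → ℤ) (k : Bool) (T : E →L[ℝ] F) (a : L2Int ℓ E) :
    synth (d := d) ξ k (T.compLpL 2 _ a) = T.compLpL 2 _ (synth ξ k a) := by
  refine Lp.ext ?_
  filter_upwards [coeFn_synth ξ k (T.compLpL 2 _ a), coeFn_synth ξ k a,
    T.coeFn_compLpL (synth (d := d) ξ k a),
    (measurePreserving_height d ℓ).quasiMeasurePreserving.ae (T.coeFn_compLpL a)] with z h1 h2 h3 h4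
  rw [h1, h3, h2, h4, map_smul]

variable [CompleteSpace E] [CompleteSpace F]

lemma inner_compLpL {X : Type*} [MeasurableSpace X] {m : Measure X} (T : E →L[ℝ] F)
    (f : Lp E 2 m) (g : Lp F 2 m) :
    inner ℝ (T.compLpL 2 m f) g = inner ℝ f ((ContinuousLinearMap.adjoint T).compLpL 2 m g) := by
  rw [L2.inner_def, L2.inner_def]
  refine integral_congr_ae ?_
  filter_upwards [T.coeFn_compLpL f, (ContinuousLinearMap.adjoint T).coeFn_compLpL g] with z h1 h2
  rw [h1, h2, ContinuousLinearMap.adjoint_inner_right]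

/-- The analysis operator `f ↦ ∫ f(x, ·) trig(x) dx`. -/
def anal (ξ : Fin d → ℤ) (k : Bool) : Lp E 2 (slabMeasure d ℓ) →L[ℝ] L2Int ℓ E :=
  ContinuousLinearMap.adjoint (synth ξ k)

lemma inner_anal (ξ : Fin d → ℤ) (k : Bool) (f : Lp E 2 (slabMeasure d ℓ)) (a : L2Int ℓ E) :
    inner ℝ (anal ξ k f) a = inner ℝ f (synth ξ k a) :=
  ContinuousLinearMap.adjoint_inner_left _ _ _

lemma anal_compLpL (ξ : Fin d → ℤ) (k : Bool) (T : E →L[ℝ] F) (f : Lp E 2 (slabMeasure d ℓ)) :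
    anal ξ k (T.compLpL 2 _ f) = T.compLpL 2 _ (anal ξ k f) := by
  refine ext_inner_right ℝ fun a => ?_
  rw [inner_anal, inner_compLpL, inner_compLpL, inner_anal, synth_compLpL]

end Modes

/-! ### Components and test functions -/

section Components

variable {ι : Type*} [Fintype ι] {X : Type*} [MeasurableSpace X] {m : Measure X}

/-- The `j`-th component of a vector-valued `L²` function. -/
def comp (j : ι) : Lp (EuclideanSpace ℝ ι) 2 m →L[ℝ] Lp ℝ 2 m :=
  (EuclideanSpace.proj (𝕜 := ℝ) j : EuclideanSpace ℝ ι →L[ℝ] ℝ).compLpL 2 m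

lemma coeFn_comp (j : ι) (f : Lp (EuclideanSpace ℝ ι) 2 m) : comp j f =ᵐ[m] fun z => f z j :=
  ContinuousLinearMap.coeFn_compLpL _ f

lemma inner_eq_sum_comp (f g : Lp (EuclideanSpace ℝ ι) 2 m) :
    inner ℝ f g = ∑ j, inner ℝ (comp j f) (comp j g) := by
  simp only [L2.inner_def]
  rw [← integral_finsetSum _ fun j _ => L2.integrable_inner (comp j f) (comp j g)]
  refine integral_congr_ae ?_
  have h1 : ∀ᵐ z ∂m, ∀ j, comp j f z = f z j := ae_all_iff.2 fun j => coeFn_comp j f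
  have h2 : ∀ᵐ z ∂m, ∀ j, comp j g z = g z j := ae_all_iff.2 fun j => coeFn_comp j g
  filter_upwards [h1, h2] with z a b
  simp [PiLp.inner_apply, a, b]

lemma norm_sq_eq_sum_comp (f : Lp (EuclideanSpace ℝ ι) 2 m) :
    ‖f‖ ^ 2 = ∑ j, ‖comp j f‖ ^ 2 := by
  simp only [← real_inner_self_eq_norm_sq]
  exact inner_eq_sum_comp f f

end Components

section Tests

variable {d : ℕ} {ℓ : ℝ}

lemma comp_synth {ι : Type*} [Fintype ι] (ξ : Fin d → ℤ) (k : Bool) (j : ι)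
    (a : L2Int ℓ (EuclideanSpace ℝ ι)) :
    comp j (synth (d := d) ξ k a) = synth ξ k (comp j a) :=
  (synth_compLpL ξ k _ a).symm

lemma comp_anal {ι : Type*} [Fintype ι] (ξ : Fin d → ℤ) (k : Bool) (j : ι)
    (f : Lp (EuclideanSpace ℝ ι) 2 (slabMeasure d ℓ)) :
    comp j (anal ξ k f) = anal ξ k (comp j f) :=
  (anal_compLpL ξ k _ f).symm

lemma memLp_continuous_slab {ψ : Slab d → ℝ} (hψ : Continuous ψ) :
    MemLp ψ 2 (slabMeasure d ℓ) := by
  have hK : IsCompact ((univ : Set (UnitAddTorus (Fin d))) ×ˢ Icc 0 ℓ) :=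
    isCompact_univ.prod isCompact_Icc
  obtain ⟨C, hC⟩ := hK.exists_bound_of_continuousOn hψ.continuousOn
  refine MemLp.of_bound hψ.aestronglyMeasurable C ?_
  have hmem : ∀ᵐ z ∂(slabMeasure d ℓ), z.2 ∈ Ioo 0 ℓ :=
    Measure.quasiMeasurePreserving_snd.ae (ae_restrict_mem measurableSet_Ioo)
  filter_upwards [hmem] with z hz
  exact hC z ⟨mem_univ _, Ioo_subset_Icc_self hz⟩

lemma memLp_continuous_int {η : ℝ → ℝ} (hη : Continuous η) :
    MemLp η 2 ((volume : Measure ℝ).restrict (Ioo 0 ℓ)) := by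
  obtain ⟨C, hC⟩ := (isCompact_Icc : IsCompact (Icc 0 ℓ)).exists_bound_of_continuousOn
    hη.continuousOn
  refine MemLp.of_bound hη.aestronglyMeasurable C ?_
  filter_upwards [ae_restrict_mem measurableSet_Ioo] with y hy
  exact hC y (Ioo_subset_Icc_self hy)

/-- A continuous function as an element of `L²` of the slab. -/
def slabLp (ℓ : ℝ) {ψ : Slab d → ℝ} (hψ : Continuous ψ) : Lp ℝ 2 (slabMeasure d ℓ) :=
  (memLp_continuous_slab hψ).toLp ψ

/-- A continuous function as an element of `L²(0, ℓ)`. -/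
def intLp (ℓ : ℝ) {η : ℝ → ℝ} (hη : Continuous η) : L2Int ℓ ℝ :=
  (memLp_continuous_int hη).toLp η

lemma coeFn_slabLp {ψ : Slab d → ℝ} (hψ : Continuous ψ) :
    slabLp ℓ hψ =ᵐ[slabMeasure d ℓ] ψ := MemLp.coeFn_toLp _

lemma coeFn_intLp {η : ℝ → ℝ} (hη : Continuous η) :
    intLp ℓ hη =ᵐ[(volume : Measure ℝ).restrict (Ioo 0 ℓ)] η := MemLp.coeFn_toLp _

lemma inner_slabLp (f : Lp ℝ 2 (slabMeasure d ℓ)) {ψ : Slab d → ℝ} (hψ : Continuous ψ) :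
    inner ℝ f (slabLp ℓ hψ) = ∫ z, f z * ψ z ∂(slabMeasure d ℓ) := by
  rw [L2.inner_def]
  refine integral_congr_ae ?_
  filter_upwards [coeFn_slabLp (ℓ := ℓ) hψ] with z hz
  simp [hz, mul_comm]

lemma inner_intLp (a : L2Int ℓ ℝ) {η : ℝ → ℝ} (hη : Continuous η) :
    inner ℝ a (intLp ℓ hη) = ∫ y in Ioo 0 ℓ, a y * η y := by
  rw [L2.inner_def]
  refine integral_congr_ae ?_
  filter_upwards [coeFn_intLp (ℓ := ℓ) hη] with z hz
  simp [hz, mul_comm]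

lemma inner_comp_slabLp {ι : Type*} [Fintype ι]
    (f : Lp (EuclideanSpace ℝ ι) 2 (slabMeasure d ℓ)) (j : ι) {ψ : Slab d → ℝ}
    (hψ : Continuous ψ) :
    inner ℝ (comp j f) (slabLp ℓ hψ) = ∫ z, f z j * ψ z ∂(slabMeasure d ℓ) := by
  rw [inner_slabLp]
  refine integral_congr_ae ?_
  filter_upwards [coeFn_comp j f] with z hz
  rw [hz]

/-- Testing the `k`-th mode of a component. -/
lemma integral_anal_comp_mul {ι : Type*} [Fintype ι] (ξ : Fin d → ℤ) (k : Bool)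
    (f : Lp (EuclideanSpace ℝ ι) 2 (slabMeasure d ℓ)) (j : ι) {η : ℝ → ℝ} (hη : Continuous η) :
    ∫ y in Ioo 0 ℓ, comp j (anal ξ k f) y * η y =
      ∫ z, f z j * (trig ξ k z.1 * η z.2) ∂(slabMeasure d ℓ) := by
  have hc : Continuous fun z : Slab d => trig ξ k z.1 * η z.2 :=
    ((continuous_trig ξ k).comp continuous_fst).mul (hη.comp continuous_snd)
  rw [← inner_intLp _ hη, comp_anal, inner_anal, ← inner_comp_slabLp f j hc]
  congr 1
  refine Lp.ext ?_
  filter_upwards [coeFn_slabLp (ℓ := ℓ) hc, coeFn_synth ξ k (intLp ℓ hη),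
    (measurePreserving_height d ℓ).quasiMeasurePreserving.ae (coeFn_intLp hη)] with z h1 h2 h3
  rw [h1, h2, h3, smul_eq_mul]

lemma integrable_mul_int (a : L2Int ℓ ℝ) {η : ℝ → ℝ} (hη : Continuous η) :
    IntegrableOn (fun y => a y * η y) (Ioo 0 ℓ) :=
  (Lp.memLp a).integrable_mul (memLp_continuous_int hη)

/-- An element of `L²(0, ℓ)` that vanishes against all test functions is zero. -/
lemma eq_of_forall_integral_mul (a b : L2Int ℓ ℝ)
    (h : ∀ η : ℝ → ℝ, ContDiff ℝ ∞ η → HasCompactSupport η → tsupport η ⊆ Ioo 0 ℓ →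
      ∫ y in Ioo 0 ℓ, a y * η y = ∫ y in Ioo 0 ℓ, b y * η y) : a = b := by
  have hint : IntegrableOn (fun y => a y - b y) (Ioo 0 ℓ) :=
    ((Lp.memLp a).integrable (by norm_num)).sub ((Lp.memLp b).integrable (by norm_num))
  have h0 : ∀ᵐ y, y ∈ Ioo 0 ℓ → a y - b y = 0 := by
    refine isOpen_Ioo.ae_eq_zero_of_integral_contDiff_smul_eq_zero
      (hint.locallyIntegrableOn) fun η h1 h2 h3 => ?_
    have hs : ∀ y, y ∉ Ioo 0 ℓ → η y • (a y - b y) = 0 := fun y hy => by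
      rw [image_eq_zero_of_notMem_tsupport fun hh => hy (h3 hh), zero_smul]
    rw [← setIntegral_eq_integral_of_forall_compl_eq_zero hs]
    have := h η h1 h2 h3
    rw [← sub_eq_zero, ← integral_sub (integrable_mul_int a h1.continuous)
      (integrable_mul_int b h1.continuous)] at this
    refine Eq.trans (integral_congr_ae (ae_of_all _ fun y => ?_)) this
    simp only [smul_eq_mul]
    ring
  refine Lp.ext ?_
  rw [EventuallyEq, ae_restrict_iff' measurableSet_Ioo]
  filter_upwards [h0] with y hy hm
  exact sub_eq_zero.1 (hy hm)

end Tests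

end ViscousSlab
end

noncomputable section

namespace ViscousSlab

variable {d : ℕ} {ℓ : ℝ}

/-! ### Solenoidal fields made of a single mode -/

/-- `b` is the weak derivative of `a` on `(0, ℓ)` and `a` vanishes at `0`. -/
def WeakBot (a b : L2Int ℓ ℝ) : Prop :=
  ∀ η : ℝ → ℝ, ContDiff ℝ ∞ η → η ℓ = 0 →
    (∫ y in Ioo 0 ℓ, a y * deriv η y) + ∫ y in Ioo 0 ℓ, b y * η y = 0

/-- `b` is the weak derivative of `a` on `(0, ℓ)` and `a` takes the value `τ` at `ℓ`. -/
def WeakTop (a b : L2Int ℓ ℝ) (τ : ℝ) : Prop :=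
  ∀ η : ℝ → ℝ, ContDiff ℝ ∞ η → η 0 = 0 →
    (∫ y in Ioo 0 ℓ, a y * deriv η y) + ∫ y in Ioo 0 ℓ, b y * η y = τ * η ℓ

/-- The profiles `a` of a field and `b` of its gradient, in the modes of frequency `ξ`, belong to a
solenoidal field that vanishes on the bottom. -/
structure IsMode (ξ : Fin d → ℤ) (a : Bool → L2Int ℓ (EuclideanSpace ℝ (Fin (d + 1))))
    (b : Bool → L2Int ℓ (EuclideanSpace ℝ (Fin (d + 1) × Fin (d + 1)))) : Prop where
  horiz : ∀ k (i : Fin d) j,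
    comp (i.castSucc, j) (b k) = -(2 * Real.pi * ξ i * trigSign k) • comp j (a (!k))
  vert : ∀ k j, WeakBot (comp j (a k)) (comp (Fin.last d, j) (b k))
  div : ∀ k, ∑ i, comp (i, i) (b k) = 0

lemma isSmooth_trig_mul (ξ : Fin d → ℤ) (k : Bool) {η : ℝ → ℝ} (hη : ContDiff ℝ ∞ η) :
    IsSmooth (fun z : Slab d => trig ξ k z.1 * η z.2) :=
  (isSmooth_trig ξ k).mul (isSmooth_vert hη)

lemma pderiv_last_trig_mul (ξ : Fin d → ℤ) (k : Bool) {η : ℝ → ℝ} (hη : ContDiff ℝ ∞ η)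
    (z : Slab d) :
    pderiv (Fin.last d) (fun z : Slab d => trig ξ k z.1 * η z.2) z
      = trig ξ k z.1 * deriv η z.2 := by
  rw [pderiv_mul _ (isSmooth_trig ξ k) (isSmooth_vert hη), pderiv_last_trig, pderiv_last_vert hη]
  ring

lemma pderiv_castSucc_trig_mul (ξ : Fin d → ℤ) (k : Bool) (i : Fin d) {η : ℝ → ℝ}
    (hη : ContDiff ℝ ∞ η) (z : Slab d) :
    pderiv i.castSucc (fun z : Slab d => trig ξ k z.1 * η z.2) z
      = 2 * Real.pi * ξ i * trigSign k * (trig ξ (!k) z.1 * η z.2) := by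
  rw [pderiv_mul _ (isSmooth_trig ξ k) (isSmooth_vert hη), pderiv_castSucc_trig,
    pderiv_castSucc_vert]
  ring

lemma sum_comp_diag_eq_zero {G : L2Grad d ℓ}
    (h : ∀ᵐ z ∂(slabMeasure d ℓ), ∑ i : Fin (d + 1), G z (i, i) = 0) :
    ∑ i : Fin (d + 1), comp (i, i) G = 0 := by
  refine Lp.ext ?_
  have h1 : ∀ᵐ z ∂(slabMeasure d ℓ), ∀ i : Fin (d + 1), comp (i, i) G z = G z (i, i) :=
    ae_all_iff.2 fun i => coeFn_comp (i, i) G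
  filter_upwards [h, h1, Lp.coeFn_finsetSum Finset.univ fun i : Fin (d + 1) => comp (i, i) G,
    Lp.coeFn_zero ℝ 2 (slabMeasure d ℓ)] with z a b c e
  rw [c, e]
  simp [b, a]

lemma sum_diag_eq_zero_of_comp {G : L2Grad d ℓ} (h : ∑ i : Fin (d + 1), comp (i, i) G = 0) :
    ∀ᵐ z ∂(slabMeasure d ℓ), ∑ i : Fin (d + 1), G z (i, i) = 0 := by
  have h1 : ∀ᵐ z ∂(slabMeasure d ℓ), ∀ i : Fin (d + 1), comp (i, i) G z = G z (i, i) :=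
    ae_all_iff.2 fun i => coeFn_comp (i, i) G
  have h2 := Lp.coeFn_finsetSum Finset.univ fun i : Fin (d + 1) => comp (i, i) G
  rw [h] at h2
  filter_upwards [h1, h2, Lp.coeFn_zero ℝ 2 (slabMeasure d ℓ)] with z b c e
  rw [e] at c
  simpa [b] using c.symm

/-- The gradient and bottom conditions come from testing with `trig ξ k x * η y`. A horizontal
derivative of this product only exchanges cosine and sine, which is the origin of `!k` and of the
sign. -/
lemma Hsol.isMode (w : Hsol d ℓ) (ξ : Fin d → ℤ) :
    IsMode ξ (fun k => anal ξ k (Hsol.vel w)) (fun k => anal ξ k (Hsol.grad w)) where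
  horiz k i j := by
    refine eq_of_forall_integral_mul _ _ fun η h1 _ h3 => ?_
    have hsupp : tsupport (fun z : Slab d => trig ξ k z.1 * η z.2) ⊆ {z | z.2 ∈ Ioo 0 ℓ} := by
      refine (tsupport_mul_subset_right (f := fun z : Slab d => trig ξ k z.1)).trans ?_
      exact (tsupport_comp_subset_preimage η continuous_snd).trans (preimage_mono h3)
    have h := w.2.1 i.castSucc j _ (isSmooth_trig_mul ξ k h1) hsupp
    simp only [pderiv_castSucc_trig_mul ξ k i h1] at h
    rw [integral_anal_comp_mul ξ k _ _ h1.continuous, ← neg_eq_iff_eq_neg.2 h, ← inner_intLp _ h1.continuous,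
      inner_smul_left, inner_intLp _ h1.continuous, integral_anal_comp_mul ξ (!k) _ _ h1.continuous,
      ← integral_const_mul, ← integral_neg]
    refine integral_congr_ae (ae_of_all _ fun z => ?_)
    simp only [conj_trivial]
    ring
  vert k j η h1 h2 := by
    have h := w.2.2.1 j _ (isSmooth_trig_mul ξ k h1) (fun x => by simp [h2])
    simp only [pderiv_last_trig_mul ξ k h1] at h
    rw [integral_anal_comp_mul ξ k _ _ (h1.continuous_deriv (by simp)),
      integral_anal_comp_mul ξ k _ _ h1.continuous]
    exact h
  div k := by
    simp only [comp_anal]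
    rw [← map_sum, sum_comp_diag_eq_zero w.2.2.2, map_zero]

lemma IsTopTrace.weakTop {w : Hsol d ℓ} {τ : L2Surf d} (h : IsTopTrace w τ) (ξ : Fin d → ℤ)
    (k : Bool) :
    WeakTop (comp (Fin.last d) (anal ξ k (Hsol.vel w)))
      (comp (Fin.last d, Fin.last d) (anal ξ k (Hsol.grad w)))
      (∫ x, τ x * trig ξ k x ∂(torusMeasure d)) := by
  intro η h1 h2
  have h := h _ (isSmooth_trig_mul ξ k h1) (fun x => by simp [h2])
  simp only [pderiv_last_trig_mul ξ k h1] at h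
  rw [integral_anal_comp_mul ξ k _ _ (h1.continuous_deriv (by simp)),
    integral_anal_comp_mul ξ k _ _ h1.continuous, h, ← integral_mul_const]
  simp only [mul_assoc]

lemma integrable_synth_mul (ξ : Fin d → ℤ) (k : Bool) (a : L2Int ℓ ℝ) {ψ : Slab d → ℝ}
    (hψ : Continuous ψ) :
    Integrable (fun z : Slab d => trig ξ k z.1 * (a z.2 * ψ z)) (slabMeasure d ℓ) := by
  have := (memLp_synth (d := d) ξ k a).integrable_mul (memLp_continuous_slab hψ)
  refine this.congr (ae_of_all _ fun z => ?_)
  simp [mul_assoc]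

/-- Fubini with the vertical integral inside, as needed to integrate by parts in `y`. The primed
version has the horizontal integral inside, for integration by parts in `x`. -/
lemma inner_synth_slabLp (ξ : Fin d → ℤ) (k : Bool) (a : L2Int ℓ ℝ) {ψ : Slab d → ℝ}
    (hψ : Continuous ψ) :
    inner ℝ (synth ξ k a) (slabLp ℓ hψ) =
      ∫ x, trig ξ k x * (∫ y in Ioo 0 ℓ, a y * ψ (x, y)) ∂(torusMeasure d) := by
  have h1 : inner ℝ (synth ξ k a) (slabLp ℓ hψ)
      = ∫ z : Slab d, trig ξ k z.1 * (a z.2 * ψ z) ∂(slabMeasure d ℓ) := by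
    rw [inner_slabLp]
    refine integral_congr_ae ?_
    filter_upwards [coeFn_synth ξ k a] with z hz
    rw [hz, smul_eq_mul, mul_assoc]
  rw [h1]
  unfold slabMeasure
  rw [integral_prod _ (integrable_synth_mul ξ k a hψ)]
  simp only [integral_const_mul]

lemma inner_synth_slabLp' (ξ : Fin d → ℤ) (k : Bool) (a : L2Int ℓ ℝ) {ψ : Slab d → ℝ}
    (hψ : Continuous ψ) :
    inner ℝ (synth ξ k a) (slabLp ℓ hψ) =
      ∫ y in Ioo 0 ℓ, a y * ∫ x, trig ξ k x * ψ (x, y) ∂(torusMeasure d) := by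
  have h1 : inner ℝ (synth ξ k a) (slabLp ℓ hψ)
      = ∫ z : Slab d, trig ξ k z.1 * (a z.2 * ψ z) ∂(slabMeasure d ℓ) := by
    rw [inner_slabLp]
    refine integral_congr_ae ?_
    filter_upwards [coeFn_synth ξ k a] with z hz
    rw [hz, smul_eq_mul, mul_assoc]
  rw [h1]
  unfold slabMeasure
  rw [integral_prod_symm _ (integrable_synth_mul ξ k a hψ)]
  simp only [← integral_const_mul]
  refine integral_congr_ae (ae_of_all _ fun y => integral_congr_ae (ae_of_all _ fun x => ?_))
  simp only
  ring

lemma integrable_inner_synth (ξ : Fin d → ℤ) (k : Bool) (a : L2Int ℓ ℝ) {ψ : Slab d → ℝ}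
    (hψ : Continuous ψ) :
    Integrable (fun x => trig ξ k x * ∫ y in Ioo 0 ℓ, a y * ψ (x, y)) (torusMeasure d) := by
  have := (integrable_synth_mul ξ k a hψ).integral_prod_left
  simpa only [integral_const_mul] using this

/-- Integration by parts in the vertical direction for a synthesized mode. -/
lemma inner_synth_vert (ξ : Fin d → ℤ) (k : Bool) (a b : L2Int ℓ ℝ) {φ : Slab d → ℝ}
    (hφ : IsSmooth φ) {r : UnitAddTorus (Fin d) → ℝ}
    (h : ∀ x, (∫ y in Ioo 0 ℓ, a y * deriv (fun y => φ (x, y)) y) +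
      ∫ y in Ioo 0 ℓ, b y * φ (x, y) = r x) :
    inner ℝ (synth ξ k a) (slabLp ℓ (continuous_pderiv (Fin.last d) hφ))
      + inner ℝ (synth ξ k b) (slabLp ℓ hφ.continuous)
      = ∫ x, trig ξ k x * r x ∂(torusMeasure d) := by
  rw [inner_synth_slabLp, inner_synth_slabLp, ← integral_add (integrable_inner_synth _ _ _
    (continuous_pderiv (Fin.last d) hφ)) (integrable_inner_synth _ _ _ hφ.continuous)]
  refine integral_congr_ae (ae_of_all _ fun x => ?_)
  simp only
  rw [← mul_add, ← h x]
  simp only [(hφ.hasDerivAt_vert x _).deriv]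

lemma inner_sum_synth_slabLp {ι : Type*} [Fintype ι] (ξ : Fin d → ℤ)
    (a : Bool → L2Int ℓ (EuclideanSpace ℝ ι)) (j : ι) {ψ : Slab d → ℝ} (hψ : Continuous ψ) :
    ∫ z, (∑ k, synth ξ k (a k) : Lp (EuclideanSpace ℝ ι) 2 (slabMeasure d ℓ)) z j * ψ z
      ∂(slabMeasure d ℓ) = ∑ k, inner ℝ (synth ξ k (comp j (a k))) (slabLp ℓ hψ) := by
  rw [← inner_comp_slabLp _ _ hψ, map_sum, sum_inner]
  simp only [comp_synth]

section IsMode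

variable {ξ : Fin d → ℤ} {a : Bool → L2Int ℓ (EuclideanSpace ℝ (Fin (d + 1)))}
  {b : Bool → L2Int ℓ (EuclideanSpace ℝ (Fin (d + 1) × Fin (d + 1)))}

/-- For fixed `x` the slice `φ(x, ·)` is an admissible one-dimensional test function, so the
vertical condition on the profiles applies slice by slice. -/
lemma IsMode.bottom (h : IsMode ξ a b) :
    BottomTraceZero (∑ k, synth (d := d) ξ k (a k)) (∑ k, synth ξ k (b k)) := by
  intro j φ hφ h0
  rw [inner_sum_synth_slabLp ξ a j (continuous_pderiv (Fin.last d) hφ),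
    inner_sum_synth_slabLp ξ b _ hφ.continuous, ← Finset.sum_add_distrib]
  refine Finset.sum_eq_zero fun k _ => ?_
  rw [inner_synth_vert ξ k _ _ hφ (r := 0) fun x => h.vert k j _ (hφ.contDiff_vert x) (h0 x)]
  simp

/-- The vertical derivative is already contained in `bottom`, since a test function supported in the
open slab vanishes at `y = ℓ`. For the horizontal ones the derivative moves onto the mode, and the
exchange of cosine and sine matches after summing over both. -/
lemma IsMode.weakGrad (h : IsMode ξ a b) :
    IsWeakGrad (∑ k, synth (d := d) ξ k (a k)) (∑ k, synth ξ k (b k)) := by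
  intro i j φ hφ hs
  refine Fin.lastCases ?_ (fun i => ?_) i
  · refine eq_neg_of_add_eq_zero_left (h.bottom j φ hφ fun x => ?_)
    exact image_eq_zero_of_notMem_tsupport fun hh => lt_irrefl ℓ (hs hh).2
  · rw [inner_sum_synth_slabLp ξ a j (continuous_pderiv _ hφ),
      inner_sum_synth_slabLp ξ b _ hφ.continuous]
    simp only [h.horiz, map_smul, inner_smul_left, inner_synth_slabLp', conj_trivial,
      integral_trig_mul_pderiv _ _ _ hφ, Fintype.sum_bool, Bool.not_true, Bool.not_false,
      mul_left_comm _ (-(2 * Real.pi * (ξ i : ℝ) * trigSign _)), integral_const_mul]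
    simp only [trigSign, if_true, Bool.false_eq_true, if_false]
    ring

lemma IsMode.mem_Hsol (h : IsMode ξ a b) :
    ((∑ k, synth ξ k (a k), ∑ k, synth ξ k (b k)) : L2Vel d ℓ × L2Grad d ℓ) ∈ Hsol d ℓ := by
  refine ⟨h.weakGrad, h.bottom, sum_diag_eq_zero_of_comp ?_⟩
  simp only [map_sum, comp_synth]
  rw [Finset.sum_comm]
  refine Finset.sum_eq_zero fun k _ => ?_
  rw [← map_sum, h.div, map_zero]

/-- The solenoidal field with given mode profiles. -/
def IsMode.field (h : IsMode ξ a b) : Hsol d ℓ := ⟨_, h.mem_Hsol⟩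

/-- A combination of the two modes as an element of `L²(Σ)`. -/
def trigLp (ξ : Fin d → ℤ) (τ : Bool → ℝ) : L2Surf d :=
  (MemLp.of_bound (p := 2) (μ := torusMeasure d)
    (f := fun x => ∑ k, τ k * trig ξ k x)
    (by exact (continuous_finsetSum _ fun k _ =>
      continuous_const.mul (continuous_trig ξ k)).aestronglyMeasurable)
    (∑ k, |τ k|) (ae_of_all _ fun x => (norm_sum_le _ _).trans
      (Finset.sum_le_sum fun k _ => by
        rw [norm_mul]
        exact mul_le_of_le_one_right (norm_nonneg _) (abs_trig_le ξ k x)))).toLp _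

lemma coeFn_trigLp (ξ : Fin d → ℤ) (τ : Bool → ℝ) :
    trigLp ξ τ =ᵐ[torusMeasure d] fun x => ∑ k, τ k * trig ξ k x := MemLp.coeFn_toLp _

lemma IsMode.isTopTrace (h : IsMode ξ a b) {τ : Bool → ℝ}
    (ht : ∀ k, WeakTop (comp (Fin.last d) (a k)) (comp (Fin.last d, Fin.last d) (b k)) (τ k)) :
    IsTopTrace h.field (trigLp ξ τ) := by
  intro φ hφ h0
  have h1 := inner_sum_synth_slabLp ξ a (Fin.last d) (continuous_pderiv (Fin.last d) hφ)
  have h2 := inner_sum_synth_slabLp ξ b (Fin.last d, Fin.last d) hφ.continuous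
  have h3 : ∫ x, trigLp ξ τ x * φ (x, ℓ) ∂(torusMeasure d)
      = ∑ k, ∫ x, trig ξ k x * (τ k * φ (x, ℓ)) ∂(torusMeasure d) := by
    have hc : Continuous fun x => φ (x, ℓ) := hφ.continuous.comp (by fun_prop)
    have hi : ∀ k ∈ (Finset.univ : Finset Bool),
        Integrable (fun x => trig ξ k x * (τ k * φ (x, ℓ))) (torusMeasure d) := fun k _ =>
      integrable_torus ((continuous_trig ξ k).mul (continuous_const.mul hc))
    rw [← integral_finsetSum _ hi]
    refine integral_congr_ae ?_
    filter_upwards [coeFn_trigLp ξ τ] with x hx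
    rw [hx, Finset.sum_mul]
    refine Finset.sum_congr rfl fun k _ => by ring
  refine (congrArg₂ (· + ·) h1 h2).trans ?_
  rw [h3, ← Finset.sum_add_distrib]
  refine Finset.sum_congr rfl fun k _ => ?_
  exact inner_synth_vert ξ k _ _ hφ fun x => ht k _ (hφ.contDiff_vert x) (h0 x)

end IsMode

/-! ### Completeness of the velocity space -/

/-- All defining conditions are vanishing conditions for continuous linear maps. Completeness is
needed later: time averages of solutions are Bochner integrals with values in `Hsol`. -/
lemma isClosed_Hsol (d : ℕ) (ℓ : ℝ) : IsClosed (Hsol d ℓ : Set (L2Vel d ℓ × L2Grad d ℓ)) := by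
  have hv : ∀ (j : Fin (d + 1)) (ψ : Slab d → ℝ), Continuous ψ →
      Continuous fun p : L2Vel d ℓ × L2Grad d ℓ => ∫ z, p.1 z j * ψ z ∂(slabMeasure d ℓ) := by
    intro j ψ hψ
    simp only [← inner_comp_slabLp _ j hψ]
    fun_prop
  have hG : ∀ (j : Fin (d + 1) × Fin (d + 1)) (ψ : Slab d → ℝ), Continuous ψ →
      Continuous fun p : L2Vel d ℓ × L2Grad d ℓ => ∫ z, p.2 z j * ψ z ∂(slabMeasure d ℓ) := by
    intro j ψ hψ
    simp only [← inner_comp_slabLp _ j hψ]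
    fun_prop
  have h1 : IsClosed {p : L2Vel d ℓ × L2Grad d ℓ | IsWeakGrad p.1 p.2} := by
    simp only [IsWeakGrad, ofPred_forall]
    refine isClosed_iInter fun i => isClosed_iInter fun j => isClosed_iInter fun φ =>
      isClosed_iInter fun hφ => isClosed_iInter fun _ => ?_
    exact isClosed_eq (hv _ _ (continuous_pderiv i hφ)) (hG _ _ hφ.continuous).neg
  have h2 : IsClosed {p : L2Vel d ℓ × L2Grad d ℓ | BottomTraceZero p.1 p.2} := by
    simp only [BottomTraceZero, ofPred_forall]
    refine isClosed_iInter fun j => isClosed_iInter fun φ =>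
      isClosed_iInter fun hφ => isClosed_iInter fun _ => ?_
    exact isClosed_eq ((hv _ _ (continuous_pderiv _ hφ)).add (hG _ _ hφ.continuous))
      continuous_const
  have h3 : IsClosed {p : L2Vel d ℓ × L2Grad d ℓ |
      ∀ᵐ z ∂(slabMeasure d ℓ), ∑ i : Fin (d + 1), p.2 z (i, i) = 0} := by
    have : {p : L2Vel d ℓ × L2Grad d ℓ |
        ∀ᵐ z ∂(slabMeasure d ℓ), ∑ i : Fin (d + 1), p.2 z (i, i) = 0}
        = {p | ∑ i : Fin (d + 1), comp (i, i) p.2 = 0} :=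
      Set.ext fun p => ⟨sum_comp_diag_eq_zero, sum_diag_eq_zero_of_comp⟩
    rw [this]
    exact isClosed_eq (by fun_prop) continuous_const
  exact h1.inter (h2.inter h3)

instance (d : ℕ) (ℓ : ℝ) : CompleteSpace (Hsol d ℓ) := (isClosed_Hsol d ℓ).completeSpace_coe

end ViscousSlab
end

noncomputable section

namespace ViscousSlab

variable {d : ℕ} {ℓ : ℝ}

/-! ### One-dimensional inequalities -/

lemma norm_intLp_sq (hℓ : 0 ≤ ℓ) {η : ℝ → ℝ} (hη : Continuous η) :
    ‖intLp ℓ hη‖ ^ 2 = ∫ y in (0 : ℝ)..ℓ, η y ^ 2 := by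
  rw [← real_inner_self_eq_norm_sq, inner_intLp, intervalIntegral.integral_of_le hℓ,
    integral_Ioc_eq_integral_Ioo]
  refine integral_congr_ae ?_
  filter_upwards [coeFn_intLp (ℓ := ℓ) hη] with y hy
  rw [hy, sq]

lemma norm_le_of_ae_abs_le (hℓ : 0 ≤ ℓ) (a : L2Int ℓ ℝ) {C : ℝ} (hC : 0 ≤ C)
    (h : ∀ᵐ y ∂((volume : Measure ℝ).restrict (Ioo 0 ℓ)), |a y| ≤ C) : ‖a‖ ≤ √ℓ * C := by
  have h1 : ‖a‖ ≤ 1 * ‖intLp ℓ (continuous_const (y := C))‖ := by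
    refine Lp.norm_le_mul_norm_of_ae_le_mul ?_
    filter_upwards [h, coeFn_intLp (ℓ := ℓ) (continuous_const (y := C))] with y h1 h2
    rw [h2, one_mul, Real.norm_eq_abs, Real.norm_eq_abs, abs_of_nonneg hC]
    exact h1
  have h2 : ‖intLp ℓ (continuous_const (y := C))‖ = √ℓ * C := by
    refine (pow_left_inj₀ (norm_nonneg _) (by positivity) two_ne_zero).1 ?_
    rw [norm_intLp_sq hℓ, intervalIntegral.integral_const, mul_pow, Real.sq_sqrt hℓ]
    simp
  rwa [h2, one_mul] at h1

/-- Cauchy–Schwarz against the constant `1`. -/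
lemma integral_abs_le (hℓ : 0 ≤ ℓ) (b : L2Int ℓ ℝ) :
    ∫ y in Ioo 0 ℓ, |b y| ≤ √ℓ * ‖b‖ := by
  have hb : MemLp (fun y => |b y|) 2 ((volume : Measure ℝ).restrict (Ioo 0 ℓ)) := (Lp.memLp b).norm
  have h1 : inner ℝ (hb.toLp _) (intLp ℓ (continuous_const (y := (1 : ℝ))))
      = ∫ y in Ioo 0 ℓ, |b y| := by
    rw [inner_intLp]
    refine integral_congr_ae ?_
    filter_upwards [hb.coeFn_toLp] with y hy
    rw [hy, mul_one]
  have h2 : ‖intLp ℓ (continuous_const (y := (1 : ℝ)))‖ ≤ √ℓ * 1 := by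
    refine norm_le_of_ae_abs_le hℓ _ zero_le_one ?_
    filter_upwards [coeFn_intLp (ℓ := ℓ) (continuous_const (y := (1 : ℝ)))] with y hy
    rw [hy, abs_one]
  have h3 : ‖hb.toLp _‖ ≤ 1 * ‖b‖ := by
    refine Lp.norm_le_mul_norm_of_ae_le_mul ?_
    filter_upwards [hb.coeFn_toLp] with y hy
    rw [hy]
    simp
  rw [← h1]
  refine (real_inner_le_norm _ _).trans ?_
  calc _ ≤ (1 * ‖b‖) * (√ℓ * 1) := mul_le_mul h3 h2 (norm_nonneg _) (by positivity)
    _ = √ℓ * ‖b‖ := by ring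

/-- A function with weak derivative `b` and zero boundary value at `0` is the primitive of `b`. -/
lemma WeakBot.ae_eq_primitive (hℓ : 0 < ℓ) {a b : L2Int ℓ ℝ} (h : WeakBot a b) :
    ∀ᵐ y ∂((volume : Measure ℝ).restrict (Ioo 0 ℓ)),
      a y = ∫ t in (0 : ℝ)..y, (Ioo 0 ℓ).indicator b t := by
  set B : ℝ → ℝ := (Ioo 0 ℓ).indicator b with hB
  have hint : Integrable B volume :=
    (integrable_indicator_iff measurableSet_Ioo).2 ((Lp.memLp b).integrable (by norm_num))
  set c : ℝ → ℝ := fun y => ∫ t in (0 : ℝ)..y, B t with hc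
  have hcc : Continuous c :=
    intervalIntegral.continuous_primitive (fun _ _ => hint.intervalIntegrable) 0
  have hac : AbsolutelyContinuousOnInterval c 0 ℓ :=
    (hint.intervalIntegrable).absolutelyContinuousOnInterval_intervalIntegral (by simp [hℓ.le])
  have hderiv : ∀ᵐ y, y ∈ uIcc 0 ℓ → HasDerivAt c (B y) y := by
    filter_upwards [hint.intervalIntegrable.ae_hasDerivAt_integral (a := 0) (b := ℓ)] with y hy hm
    exact hy hm 0 (by simp)
  have key : a = intLp ℓ hcc := by
    refine eq_of_forall_integral_mul _ _ fun ψ h1 _ _ => ?_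
    -- The primitive of `ψ` based at `ℓ` vanishes there, so it is admissible in `WeakBot` and its
    -- derivative is the given test function. Since `c` is only absolutely continuous, the classical
    -- side uses integration by parts for such functions.
    set η : ℝ → ℝ := fun y => ∫ t in ℓ..y, ψ t with hη
    have hd : ∀ y, HasDerivAt η (ψ y) y := fun y =>
      intervalIntegral.integral_hasDerivAt_right (h1.continuous.intervalIntegrable _ _)
        h1.continuous.aestronglyMeasurable.stronglyMeasurableAtFilter h1.continuous.continuousAt
    have hde : deriv η = ψ := funext fun y => (hd y).deriv
    have hs : ContDiff ℝ ∞ η :=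
      contDiff_infty_iff_deriv.2 ⟨fun y => (hd y).differentiableAt, by rwa [hde]⟩
    have h2 := h η hs (by simp [hη])
    rw [hde] at h2
    have hηac : AbsolutelyContinuousOnInterval η 0 ℓ :=
      ContDiffOn.absolutelyContinuousOnInterval (hs.of_le (by simp)).contDiffOn
    have h3 := hac.integral_mul_deriv_eq_deriv_mul hηac
    rw [hde] at h3
    have h4 : ∫ y in (0 : ℝ)..ℓ, deriv c y * η y = ∫ y in Ioo 0 ℓ, b y * η y := by
      rw [← integral_Ioc_eq_integral_Ioo, ← intervalIntegral.integral_of_le hℓ.le]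
      have hne : ∀ᵐ y : ℝ, y ≠ ℓ := by simp [ae_iff, measure_singleton]
      refine intervalIntegral.integral_congr_ae ?_
      filter_upwards [hderiv, hne] with y hy hn hm
      rw [(hy (uIoc_subset_uIcc hm)).deriv, hB, indicator_of_mem]
      rw [uIoc_of_le hℓ.le] at hm
      exact ⟨hm.1, lt_of_le_of_ne hm.2 hn⟩
    have h5 : η ℓ = 0 := by simp [hη]
    have h6 : c 0 = 0 := by simp [hc]
    rw [h4, h5, h6, mul_zero, zero_mul, sub_zero, zero_sub, intervalIntegral.integral_of_le hℓ.le,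
      integral_Ioc_eq_integral_Ioo] at h3
    rw [eq_neg_of_add_eq_zero_left h2, ← h3]
    refine integral_congr_ae ?_
    filter_upwards [coeFn_intLp (ℓ := ℓ) hcc] with y hy
    rw [hy]
  rw [key]
  exact coeFn_intLp hcc

/-- The Poincaré inequality. -/
lemma WeakBot.norm_le (hℓ : 0 < ℓ) {a b : L2Int ℓ ℝ} (h : WeakBot a b) : ‖a‖ ≤ ℓ * ‖b‖ := by
  have h1 : ‖a‖ ≤ √ℓ * (√ℓ * ‖b‖) := by
    refine norm_le_of_ae_abs_le hℓ.le _ (by positivity) ?_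
    filter_upwards [h.ae_eq_primitive hℓ, ae_restrict_mem measurableSet_Ioo] with y hy hm
    rw [hy]
    refine le_trans ?_ (integral_abs_le hℓ.le b)
    have hint : Integrable ((Ioo 0 ℓ).indicator b) volume :=
      (integrable_indicator_iff measurableSet_Ioo).2 ((Lp.memLp b).integrable (by norm_num))
    calc |∫ t in (0 : ℝ)..y, (Ioo 0 ℓ).indicator b t|
        ≤ ∫ t in (0 : ℝ)..y, |(Ioo 0 ℓ).indicator b t| :=
          intervalIntegral.abs_integral_le_integral_abs hm.1.le
      _ ≤ ∫ t, |(Ioo 0 ℓ).indicator b t| := by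
          rw [intervalIntegral.integral_of_le hm.1.le]
          exact setIntegral_le_integral hint.abs (ae_of_all _ fun t => abs_nonneg _)
      _ = ∫ t in Ioo 0 ℓ, |b t| := by
          rw [← integral_indicator measurableSet_Ioo]
          refine integral_congr_ae (ae_of_all _ fun t => ?_)
          by_cases ht : t ∈ Ioo 0 ℓ <;> simp [ht]
  calc ‖a‖ ≤ √ℓ * (√ℓ * ‖b‖) := h1
    _ = ℓ * ‖b‖ := by rw [← mul_assoc, Real.mul_self_sqrt hℓ.le]

/-- The trace inequality. -/
lemma WeakTop.sq_le (hℓ : 0 < ℓ) {a b : L2Int ℓ ℝ} {τ : ℝ} (h : WeakTop a b τ)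
    (h0 : WeakBot a b) : τ ^ 2 ≤ 4 * ℓ * ‖b‖ ^ 2 := by
  -- The test function `η(y) = y` gives `τ ℓ = ∫ a + ∫ y b`.
  have h1 := h id contDiff_id rfl
  have h2 : |∫ y in Ioo 0 ℓ, a y * deriv id y| ≤ √ℓ * ‖a‖ := by
    simp only [deriv_id, mul_one]
    exact (abs_integral_le_integral_abs).trans (integral_abs_le hℓ.le a)
  have h3 : |∫ y in Ioo 0 ℓ, b y * id y| ≤ ℓ * (√ℓ * ‖b‖) := by
    refine (abs_integral_le_integral_abs).trans
      (le_trans ?_ (mul_le_mul_of_nonneg_left (integral_abs_le hℓ.le b) hℓ.le))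
    rw [← integral_const_mul]
    have hb : IntegrableOn b (Ioo 0 ℓ) := (Lp.memLp b).integrable (by norm_num)
    refine setIntegral_mono_on (integrable_mul_int b continuous_id).abs
      (hb.abs.const_mul ℓ) measurableSet_Ioo fun y hy => ?_
    rw [abs_mul, mul_comm]
    refine mul_le_mul_of_nonneg_right ?_ (abs_nonneg _)
    simpa [abs_of_pos hy.1] using hy.2.le
  have h4 := h0.norm_le hℓ
  have hs : 0 < √ℓ := Real.sqrt_pos.2 hℓ
  have h5 : |τ| ≤ 2 * √ℓ * ‖b‖ := by
    have : |τ| * ℓ ≤ (2 * √ℓ * ‖b‖) * ℓ := by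
      calc |τ| * ℓ = |τ * id ℓ| := by simp [abs_mul, abs_of_pos hℓ]
        _ ≤ √ℓ * ‖a‖ + ℓ * (√ℓ * ‖b‖) := by
          rw [← h1]; exact (abs_add_le _ _).trans (add_le_add h2 h3)
        _ ≤ √ℓ * (ℓ * ‖b‖) + ℓ * (√ℓ * ‖b‖) := by gcongr
        _ = _ := by ring
    exact le_of_mul_le_mul_right this hℓ
  calc τ ^ 2 = |τ| ^ 2 := (sq_abs τ).symm
    _ ≤ (2 * √ℓ * ‖b‖) ^ 2 := pow_le_pow_left₀ (abs_nonneg _) h5 2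
    _ = 4 * ℓ * ‖b‖ ^ 2 := by rw [mul_pow, mul_pow, Real.sq_sqrt hℓ.le]; ring

/-! ### Symmetrized gradients -/

/-- `A ↦ A + Aᵀ`. -/
def symMat (n : ℕ) : EuclideanSpace ℝ (Fin n × Fin n) →L[ℝ] EuclideanSpace ℝ (Fin n × Fin n) :=
  LinearMap.toContinuousLinearMap
    { toFun := fun A => WithLp.toLp 2 fun p => A p + A p.swap
      map_add' := fun A B => by ext p; simp; ring
      map_smul' := fun c A => by ext p; simp; ring }

lemma symMat_apply {n : ℕ} (A : EuclideanSpace ℝ (Fin n × Fin n)) (p : Fin n × Fin n) :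
    symMat n A p = A p + A p.swap := rfl

section Sym

variable {n : ℕ} {X : Type*} [MeasurableSpace X] {m : Measure X}

/-- The symmetrization of a matrix-valued `L²` function. -/
def symm (n : ℕ) (m : Measure X) : Lp (EuclideanSpace ℝ (Fin n × Fin n)) 2 m →L[ℝ]
    Lp (EuclideanSpace ℝ (Fin n × Fin n)) 2 m := (symMat n).compLpL 2 m

lemma coeFn_symm (f : Lp (EuclideanSpace ℝ (Fin n × Fin n)) 2 m) :
    symm n m f =ᵐ[m] fun z => symMat n (f z) := ContinuousLinearMap.coeFn_compLpL _ f

lemma comp_symm (f : Lp (EuclideanSpace ℝ (Fin n × Fin n)) 2 m) (p : Fin n × Fin n) :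
    comp p (symm n m f) = comp p f + comp p.swap f := by
  refine Lp.ext ?_
  filter_upwards [coeFn_comp p (symm n m f), coeFn_symm f, coeFn_comp p f, coeFn_comp p.swap f,
    Lp.coeFn_add (comp p f) (comp p.swap f)] with z h1 h2 h3 h4 h5
  rw [h1, h2, h5, Pi.add_apply, h3, h4, symMat_apply]

lemma norm_symm_sq (f : Lp (EuclideanSpace ℝ (Fin n × Fin n)) 2 m) :
    ‖symm n m f‖ ^ 2 = ∑ i, ∑ j, ‖comp (i, j) f + comp (j, i) f‖ ^ 2 := by
  rw [norm_sq_eq_sum_comp, Fintype.sum_prod_type]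
  simp only [comp_symm, Prod.swap]

lemma norm_symm_le (f : Lp (EuclideanSpace ℝ (Fin n × Fin n)) 2 m) :
    ‖symm n m f‖ ^ 2 ≤ 4 * ‖f‖ ^ 2 := by
  have h : ∀ x y : Lp ℝ 2 m, ‖x + y‖ ^ 2 ≤ 2 * ‖x‖ ^ 2 + 2 * ‖y‖ ^ 2 := fun x y => by
    have := parallelogram_law_with_norm ℝ x y
    nlinarith [sq_nonneg ‖x - y‖]
  rw [norm_symm_sq]
  calc _ ≤ ∑ i, ∑ j, (2 * ‖comp (i, j) f‖ ^ 2 + 2 * ‖comp (j, i) f‖ ^ 2) :=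
        Finset.sum_le_sum fun i _ => Finset.sum_le_sum fun j _ => h _ _
    _ = 4 * ‖f‖ ^ 2 := by
        simp only [Finset.sum_add_distrib, ← Finset.mul_sum]
        rw [Finset.sum_comm (f := fun i j => ‖comp (j, i) f‖ ^ 2), norm_sq_eq_sum_comp f,
          Fintype.sum_prod_type]
        ring

end Sym

lemma symGradInner_eq (u v : Hsol d ℓ) :
    symGradInner u v = inner ℝ (symm _ _ (Hsol.grad u)) (symm _ _ (Hsol.grad v)) := by
  rw [L2.inner_def, symGradInner]
  refine integral_congr_ae ?_
  filter_upwards [coeFn_symm (Hsol.grad u), coeFn_symm (Hsol.grad v)] with z h1 h2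
  rw [h1, h2, PiLp.inner_apply, Fintype.sum_prod_type]
  refine Finset.sum_congr rfl fun i _ => Finset.sum_congr rfl fun j _ => ?_
  simp [symMat_apply, mul_comm]

lemma anal_symm (ξ : Fin d → ℤ) (k : Bool) (G : L2Grad d ℓ) :
    anal ξ k (symm _ _ G) = symm _ _ (anal ξ k G) := anal_compLpL ξ k _ G

lemma symm_synth (ξ : Fin d → ℤ) (k : Bool)
    (b : L2Int ℓ (EuclideanSpace ℝ (Fin (d + 1) × Fin (d + 1)))) :
    symm _ _ (synth (d := d) ξ k b) = synth ξ k (symm _ _ b) := (synth_compLpL ξ k _ b).symm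

/-! ### Coercivity of the dissipation at one frequency. -/

section IsMode

variable {ξ : Fin d → ℤ} {a : Bool → L2Int ℓ (EuclideanSpace ℝ (Fin (d + 1)))}
  {b : Bool → L2Int ℓ (EuclideanSpace ℝ (Fin (d + 1) × Fin (d + 1)))}

/-- A field synthesized at frequency `ξ` sees only the `ξ`-modes of `w`, because `anal` is the
adjoint of `synth`. Neither orthogonality nor normalization of the modes is needed. -/
lemma IsMode.symGradInner_field (h : IsMode ξ a b) (w : Hsol d ℓ) :
    symGradInner w h.field
      = ∑ k, inner ℝ (symm _ _ (anal ξ k (Hsol.grad w))) (symm _ _ (b k)) := by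
  rw [symGradInner_eq]
  change inner ℝ _ (symm _ _ (∑ k, synth ξ k (b k))) = _
  rw [map_sum, inner_sum]
  simp only [symm_synth, ← inner_anal, anal_symm]

lemma IsMode.inner_field (h : IsMode ξ a b) (u : L2Vel d ℓ) :
    inner ℝ u (Hsol.vel h.field) = ∑ k, inner ℝ (anal ξ k u) (a k) := by
  change inner ℝ _ (∑ k, synth ξ k (a k)) = _
  rw [inner_sum]
  simp only [inner_anal]

/-- Korn's identity on the Fourier side: the symmetrized product of the vectors `x` and `A` controls
`|x|² |A|²`, because the cross terms add up to the square `|x·A|²`. -/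
lemma sum_sum_norm_sq_smul_add {H : Type*} [NormedAddCommGroup H] [InnerProductSpace ℝ H]
    {ι : Type*} [Fintype ι] (x : ι → ℝ) (A : ι → H) :
    ∑ i, ∑ j, ‖x i • A j + x j • A i‖ ^ 2 =
      2 * (∑ i, x i ^ 2) * (∑ j, ‖A j‖ ^ 2) + 2 * ‖∑ i, x i • A i‖ ^ 2 := by
  have h1 : ∀ i j, ‖x i • A j + x j • A i‖ ^ 2 = x i ^ 2 * ‖A j‖ ^ 2 +
      2 * inner ℝ (x j • A j) (x i • A i) + ‖A i‖ ^ 2 * x j ^ 2 := fun i j => by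
    rw [norm_add_sq_real, norm_smul, norm_smul, mul_pow, mul_pow, Real.norm_eq_abs,
      Real.norm_eq_abs, sq_abs, sq_abs]
    simp only [inner_smul_left, inner_smul_right, conj_trivial]
    ring
  have h2 : ‖∑ i, x i • A i‖ ^ 2 = ∑ i, ∑ j, inner ℝ (x j • A j) (x i • A i) := by
    rw [← real_inner_self_eq_norm_sq, inner_sum]
    simp only [sum_inner]
  simp only [h1, Finset.sum_add_distrib, ← Finset.mul_sum, h2]
  simp only [← Finset.sum_mul]
  ring

lemma freqNorm_sq (ξ : Fin d → ℤ) : freqNorm ξ ^ 2 = ∑ i, (ξ i : ℝ) ^ 2 :=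
  Real.sq_sqrt (Finset.sum_nonneg fun _ _ => sq_nonneg _)

lemma freqNorm_nonneg (ξ : Fin d → ℤ) : 0 ≤ freqNorm ξ := Real.sqrt_nonneg _

lemma one_le_freqNorm {ξ : Fin d → ℤ} (h : ξ ≠ 0) : 1 ≤ freqNorm ξ := by
  obtain ⟨i, hi⟩ := Function.ne_iff.1 h
  rw [freqNorm, Real.one_le_sqrt]
  refine le_trans ?_ (Finset.single_le_sum (f := fun i => (ξ i : ℝ) ^ 2)
    (fun _ _ => sq_nonneg _) (Finset.mem_univ i))
  have h1 : 1 ≤ (ξ i) ^ 2 := Int.one_le_abs hi |> fun h => by nlinarith [sq_abs (ξ i)]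
  exact_mod_cast h1

/-- The dissipation in the modes of frequency `ξ`. -/
def dissip (b : Bool → L2Int ℓ (EuclideanSpace ℝ (Fin (d + 1) × Fin (d + 1)))) : ℝ :=
  ∑ k, ‖symm _ _ (b k)‖ ^ 2

lemma dissip_nonneg (b : Bool → L2Int ℓ (EuclideanSpace ℝ (Fin (d + 1) × Fin (d + 1)))) :
    0 ≤ dissip b := Finset.sum_nonneg fun _ _ => sq_nonneg _

/-- The last diagonal entry of `A + Aᵀ` is twice that of `A`. So the vertical component needs no
Korn inequality, only Poincaré and trace estimates in `y`. -/
lemma sq_norm_comp_le_norm_symm (f : L2Int ℓ (EuclideanSpace ℝ (Fin (d + 1) × Fin (d + 1)))) :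
    4 * ‖comp (Fin.last d, Fin.last d) f‖ ^ 2 ≤ ‖symm _ _ f‖ ^ 2 := by
  rw [norm_symm_sq]
  have h1 := Finset.single_le_sum
    (f := fun i => ∑ j, ‖comp (i, j) f + comp (j, i) f‖ ^ 2)
    (fun i _ => Finset.sum_nonneg fun j _ => sq_nonneg _) (Finset.mem_univ (Fin.last d))
  have h2 := Finset.single_le_sum
    (f := fun j => ‖comp (Fin.last d, j) f + comp (j, Fin.last d) f‖ ^ 2)
    (fun i _ => sq_nonneg _) (Finset.mem_univ (Fin.last d))
  refine le_trans (le_of_eq ?_) (h2.trans h1)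
  rw [← two_smul ℝ, norm_smul, mul_pow]
  norm_num

lemma IsMode.trace_sq_le (hℓ : 0 < ℓ) (h : IsMode ξ a b) {k : Bool} {τ : ℝ}
    (ht : WeakTop (comp (Fin.last d) (a k)) (comp (Fin.last d, Fin.last d) (b k)) τ) :
    τ ^ 2 ≤ ℓ * ‖symm _ _ (b k)‖ ^ 2 := by
  have h1 := ht.sq_le hℓ (h.vert k _)
  have h2 := sq_norm_comp_le_norm_symm (b k)
  nlinarith

lemma IsMode.norm_last_sq_le (hℓ : 0 < ℓ) (h : IsMode ξ a b) (k : Bool) :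
    ‖comp (Fin.last d) (a k)‖ ^ 2 ≤ ℓ ^ 2 * ‖symm _ _ (b k)‖ ^ 2 := by
  have h1 := (h.vert k (Fin.last d)).norm_le hℓ
  have h2 := sq_norm_comp_le_norm_symm (b k)
  have h3 : ‖comp (Fin.last d) (a k)‖ ^ 2
      ≤ ℓ ^ 2 * ‖comp (Fin.last d, Fin.last d) (b k)‖ ^ 2 := by
    rw [← mul_pow]
    exact pow_le_pow_left₀ (norm_nonneg _) h1 2
  nlinarith [sq_nonneg ℓ, sq_nonneg ‖comp (Fin.last d, Fin.last d) (b k)‖,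
    mul_le_mul_of_nonneg_left h2 (sq_nonneg ℓ)]

/-- In the horizontal block the derivatives are multiplications by `2πξ_i`, so the block controls
the horizontal velocity through the preceding identity. Integrality of the nonzero frequency gives
`|ξ| ≥ 1` and hence a constant independent of `ξ`. -/
lemma IsMode.sum_norm_castSucc_sq_le (h : IsMode ξ a b) (hξ : ξ ≠ 0) (k : Bool) :
    ∑ j : Fin d, ‖comp j.castSucc (a (!k))‖ ^ 2 ≤ ‖symm _ _ (b k)‖ ^ 2 := by
  set A : Fin d → L2Int ℓ ℝ := fun j => comp j.castSucc (a (!k))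
  set S := ∑ j : Fin d, ‖A j‖ ^ 2
  have hS : 0 ≤ S := Finset.sum_nonneg fun _ _ => sq_nonneg _
  have h1 : ∀ i j : Fin d, ‖comp (i.castSucc, j.castSucc) (b k) +
      comp (j.castSucc, i.castSucc) (b k)‖ ^ 2
      = (2 * Real.pi) ^ 2 * ‖(ξ i : ℝ) • A j + (ξ j : ℝ) • A i‖ ^ 2 := by
    intro i j
    have : comp (i.castSucc, j.castSucc) (b k) + comp (j.castSucc, i.castSucc) (b k)
        = (-(2 * Real.pi * trigSign k)) • ((ξ i : ℝ) • A j + (ξ j : ℝ) • A i) := by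
      rw [h.horiz, h.horiz, smul_add, smul_smul, smul_smul]
      congr 2 <;> ring
    rw [this, norm_smul, mul_pow, Real.norm_eq_abs, sq_abs, neg_sq, mul_pow, sq (trigSign k),
      trigSign_sq, mul_one]
  have h2 : ∑ i : Fin d, ∑ j : Fin d, ‖comp (i.castSucc, j.castSucc) (b k) +
      comp (j.castSucc, i.castSucc) (b k)‖ ^ 2 ≤ ‖symm _ _ (b k)‖ ^ 2 := by
    rw [norm_symm_sq, Fin.sum_univ_castSucc]
    refine le_add_of_le_of_nonneg (Finset.sum_le_sum fun i _ => ?_)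
      (Finset.sum_nonneg fun _ _ => sq_nonneg _)
    rw [Fin.sum_univ_castSucc]
    exact le_add_of_nonneg_right (sq_nonneg _)
  refine le_trans ?_ h2
  simp only [h1, ← Finset.mul_sum]
  rw [sum_sum_norm_sq_smul_add, ← freqNorm_sq]
  have h3 : 1 ≤ freqNorm ξ ^ 2 := one_le_pow₀ (one_le_freqNorm hξ)
  have h4 : 1 ≤ (2 * Real.pi) ^ 2 := one_le_pow₀ (by linarith [Real.pi_gt_three])
  have h5 : S ≤ 2 * freqNorm ξ ^ 2 * S := le_mul_of_one_le_left hS (by linarith)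
  have h6 : S ≤ 2 * freqNorm ξ ^ 2 * S + 2 * ‖∑ i, (ξ i : ℝ) • A i‖ ^ 2 :=
    le_add_of_le_of_nonneg h5 (mul_nonneg two_pos.le (sq_nonneg _))
  exact h6.trans (le_mul_of_one_le_left (hS.trans h6) h4)

/-- At frequency zero the horizontal block is no help, but the mixed entries of the symmetrized
gradient reduce to pure vertical derivatives, to which Poincaré applies. -/
lemma IsMode.sum_norm_castSucc_sq_le_of_zero (hℓ : 0 < ℓ) (h : IsMode ξ a b) (hξ : ξ = 0)
    (k : Bool) :
    ∑ j : Fin d, ‖comp j.castSucc (a k)‖ ^ 2 ≤ ℓ ^ 2 * ‖symm _ _ (b k)‖ ^ 2 := by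
  have h1 : ∑ j : Fin d, ‖comp (Fin.last d, j.castSucc) (b k) +
      comp (j.castSucc, Fin.last d) (b k)‖ ^ 2 ≤ ‖symm _ _ (b k)‖ ^ 2 := by
    rw [norm_symm_sq, Fin.sum_univ_castSucc]
    refine le_add_of_nonneg_of_le
      (Finset.sum_nonneg fun _ _ => Finset.sum_nonneg fun _ _ => sq_nonneg _) ?_
    rw [Fin.sum_univ_castSucc]
    exact le_add_of_nonneg_right (sq_nonneg _)
  refine le_trans ?_ (mul_le_mul_of_nonneg_left h1 (sq_nonneg ℓ))
  rw [Finset.mul_sum]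
  refine Finset.sum_le_sum fun j _ => ?_
  have h0 : comp (j.castSucc, Fin.last d) (b k) = 0 := by
    rw [h.horiz, hξ]
    simp
  rw [h0, add_zero, ← mul_pow]
  exact pow_le_pow_left₀ (norm_nonneg _) ((h.vert k _).norm_le hℓ) 2

/-- The Korn–Poincaré inequality for the modes of one frequency. -/
lemma IsMode.sum_norm_sq_le (hℓ : 0 < ℓ) (h : IsMode ξ a b) :
    ∑ k, ‖a k‖ ^ 2 ≤ (1 + 2 * ℓ ^ 2) * dissip b := by
  have hN : ∑ k, ‖comp (Fin.last d) (a k)‖ ^ 2 ≤ ℓ ^ 2 * dissip b := by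
    rw [dissip, Finset.mul_sum]
    exact Finset.sum_le_sum fun k _ => h.norm_last_sq_le hℓ k
  have hT : ∑ k, ∑ j : Fin d, ‖comp j.castSucc (a k)‖ ^ 2 ≤ (1 + ℓ ^ 2) * dissip b := by
    have hd := dissip_nonneg b
    by_cases hξ : ξ = 0
    · refine le_trans (b := ℓ ^ 2 * dissip b) ?_ (by nlinarith)
      rw [dissip, Finset.mul_sum]
      exact Finset.sum_le_sum fun k _ => h.sum_norm_castSucc_sq_le_of_zero hℓ hξ k
    · refine le_trans (b := dissip b) ?_ (by nlinarith [sq_nonneg ℓ])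
      have h1 := h.sum_norm_castSucc_sq_le hξ false
      have h2 := h.sum_norm_castSucc_sq_le hξ true
      simp only [dissip, Fintype.sum_bool]
      simp only [Bool.not_false, Bool.not_true] at h1 h2
      linarith
  have : ∑ k, ‖a k‖ ^ 2 = ∑ k, ∑ j : Fin d, ‖comp j.castSucc (a k)‖ ^ 2
      + ∑ k, ‖comp (Fin.last d) (a k)‖ ^ 2 := by
    rw [← Finset.sum_add_distrib]
    refine Finset.sum_congr rfl fun k _ => ?_
    rw [norm_sq_eq_sum_comp, Fin.sum_univ_castSucc]
  rw [this]
  linarith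

end IsMode

end ViscousSlab
end

noncomputable section

namespace ViscousSlab

variable {d : ℕ} {ℓ : ℝ}

/-! ### Extension of a boundary mode to a solenoidal field -/

section Assemble

variable {ι : Type*} [Fintype ι] [DecidableEq ι] {X : Type*} [MeasurableSpace X] {m : Measure X}

/-- The vector-valued `L²` function with given components. -/
def assemble (f : ι → Lp ℝ 2 m) : Lp (EuclideanSpace ℝ ι) 2 m :=
  ∑ j, (ContinuousLinearMap.toSpanSingleton ℝ
    (EuclideanSpace.single j (1 : ℝ) : EuclideanSpace ℝ ι)).compLpL 2 m (f j)

lemma comp_assemble (f : ι → Lp ℝ 2 m) (i : ι) : comp i (assemble f) = f i := by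
  rw [assemble, map_sum, Finset.sum_eq_single i]
  · refine Lp.ext ?_
    filter_upwards [coeFn_comp i ((ContinuousLinearMap.toSpanSingleton ℝ
      (EuclideanSpace.single i (1 : ℝ) : EuclideanSpace ℝ ι)).compLpL 2 m (f i)),
      (ContinuousLinearMap.toSpanSingleton ℝ
      (EuclideanSpace.single i (1 : ℝ) : EuclideanSpace ℝ ι)).coeFn_compLpL (f i)] with z h1 h2
    rw [h1, h2]
    simp
  · intro j _ hj
    refine Lp.ext ?_
    filter_upwards [coeFn_comp i ((ContinuousLinearMap.toSpanSingleton ℝ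
      (EuclideanSpace.single j (1 : ℝ) : EuclideanSpace ℝ ι)).compLpL 2 m (f j)),
      (ContinuousLinearMap.toSpanSingleton ℝ
      (EuclideanSpace.single j (1 : ℝ) : EuclideanSpace ℝ ι)).coeFn_compLpL (f j),
      Lp.coeFn_zero ℝ 2 m] with z h1 h2 h3
    rw [h1, h2, h3]
    simp [hj.symm]
  · simp

end Assemble

lemma integral_classical (hℓ : 0 ≤ ℓ) {χ χ' η : ℝ → ℝ} (h : ∀ y, HasDerivAt χ (χ' y) y)
    (hχ' : Continuous χ') (hη : ContDiff ℝ ∞ η) :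
    (∫ y in Ioo 0 ℓ, χ y * deriv η y) + ∫ y in Ioo 0 ℓ, χ' y * η y = χ ℓ * η ℓ - χ 0 * η 0 := by
  have h1 := intervalIntegral.integral_mul_deriv_eq_deriv_mul (a := 0) (b := ℓ)
    (fun y _ => h y) (fun y _ => ((hη.differentiable (by simp)) y).hasDerivAt)
    (hχ'.intervalIntegrable _ _) ((hη.continuous_deriv (by simp)).intervalIntegrable _ _)
  simp only [intervalIntegral.integral_of_le hℓ, integral_Ioc_eq_integral_Ioo] at h1
  rw [h1]
  ring

lemma integral_intLp_mul {χ : ℝ → ℝ} (hχ : Continuous χ) (η : ℝ → ℝ) :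
    ∫ y in Ioo 0 ℓ, intLp ℓ hχ y * η y = ∫ y in Ioo 0 ℓ, χ y * η y := by
  refine integral_congr_ae ?_
  filter_upwards [coeFn_intLp (ℓ := ℓ) hχ] with y hy
  rw [hy]

lemma weakBot_intLp (hℓ : 0 ≤ ℓ) {χ χ' : ℝ → ℝ} (h : ∀ y, HasDerivAt χ (χ' y) y)
    (hχ : Continuous χ) (hχ' : Continuous χ') (h0 : χ 0 = 0) :
    WeakBot (intLp ℓ hχ) (intLp ℓ hχ') := by
  intro η h1 h2
  rw [integral_intLp_mul, integral_intLp_mul, integral_classical hℓ h hχ' h1, h2, h0]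
  ring

lemma weakTop_intLp (hℓ : 0 ≤ ℓ) {χ χ' : ℝ → ℝ} (h : ∀ y, HasDerivAt χ (χ' y) y)
    (hχ : Continuous χ) (hχ' : Continuous χ') : WeakTop (intLp ℓ hχ) (intLp ℓ hχ') (χ ℓ) := by
  intro η h1 h2
  rw [integral_intLp_mul, integral_intLp_mul, integral_classical hℓ h hχ' h1, h2]
  ring

/-- In this form the condition is visibly linear and continuous in `a` and `b`. The analogue for
`WeakTop` is what lets the trace relation pass through integrals in time. -/
lemma weakBot_iff_inner {a b : L2Int ℓ ℝ} : WeakBot a b ↔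
    ∀ (η : ℝ → ℝ) (hη : ContDiff ℝ ∞ η), η ℓ = 0 →
      inner ℝ a (intLp ℓ (hη.continuous_deriv (by simp)))
        + inner ℝ b (intLp ℓ hη.continuous) = 0 := by
  simp only [WeakBot, inner_intLp]

lemma weakTop_iff_inner {a b : L2Int ℓ ℝ} {τ : ℝ} : WeakTop a b τ ↔
    ∀ (η : ℝ → ℝ) (hη : ContDiff ℝ ∞ η), η 0 = 0 →
      inner ℝ a (intLp ℓ (hη.continuous_deriv (by simp)))
        + inner ℝ b (intLp ℓ hη.continuous) = τ * η ℓ := by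
  simp only [WeakTop, inner_intLp]

lemma WeakBot.smul {a b : L2Int ℓ ℝ} (h : WeakBot a b) (c : ℝ) : WeakBot (c • a) (c • b) := by
  rw [weakBot_iff_inner] at h ⊢
  intro η h1 h2
  rw [inner_smul_left, inner_smul_left, ← mul_add, h η h1 h2, mul_zero]

lemma weakBot_zero : WeakBot (0 : L2Int ℓ ℝ) 0 := by
  rw [weakBot_iff_inner]
  simp

lemma weakTop_zero : WeakTop (0 : L2Int ℓ ℝ) 0 0 := by
  rw [weakTop_iff_inner]
  simp

section Extension

variable (ξ : Fin d → ℤ) (k₀ : Bool) (p q r : L2Int ℓ ℝ)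

/-- Components of the mode profile of the extension of a boundary mode; here `p` is the vertical
profile and `q` its derivative. -/
def extVel (k : Bool) (j : Fin (d + 1)) : L2Int ℓ ℝ :=
  Fin.lastCases (motive := fun _ => L2Int ℓ ℝ) (if k = k₀ then p else 0)
    (fun j => if k = k₀ then 0
      else (trigSign k₀ * ξ j / (2 * Real.pi * freqNorm ξ ^ 2)) • q) j

/-- Components of the gradient of the extension. -/
def extGrad (k : Bool) (ij : Fin (d + 1) × Fin (d + 1)) : L2Int ℓ ℝ :=
  Fin.lastCases (motive := fun _ => L2Int ℓ ℝ) (extVel ξ k₀ q r k ij.2)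
    (fun i => -(2 * Real.pi * ξ i * trigSign k) • extVel ξ k₀ p q (!k) ij.2) ij.1

lemma extVel_last (k : Bool) :
    extVel ξ k₀ p q k (Fin.last d) = if k = k₀ then p else 0 := by
  simp [extVel]

lemma extVel_castSucc (k : Bool) (j : Fin d) :
    extVel ξ k₀ p q k j.castSucc = if k = k₀ then 0
      else (trigSign k₀ * ξ j / (2 * Real.pi * freqNorm ξ ^ 2)) • q := by
  simp [extVel]

lemma extGrad_last (k : Bool) (j : Fin (d + 1)) :
    extGrad ξ k₀ p q r k (Fin.last d, j) = extVel ξ k₀ q r k j := by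
  simp [extGrad]

lemma extGrad_castSucc (k : Bool) (i : Fin d) (j : Fin (d + 1)) :
    extGrad ξ k₀ p q r k (i.castSucc, j)
      = -(2 * Real.pi * ξ i * trigSign k) • extVel ξ k₀ p q (!k) j := by
  simp [extGrad]

variable {ξ p q r}

/-- The horizontal velocity points along `ξ`, in the mode of opposite parity, with amplitude
`q/(2π|ξ|)` so that its divergence cancels the vertical derivative `q`. Hence both `p` and `q` must
vanish at the bottom. -/
lemma isMode_ext (hξ : ξ ≠ 0) (h1 : WeakBot p q) (h2 : WeakBot q r) :
    IsMode ξ (fun k => assemble (extVel ξ k₀ p q k)) (fun k => assemble (extGrad ξ k₀ p q r k)) where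
  horiz k i j := by
    rw [comp_assemble, comp_assemble, extGrad_castSucc]
  vert k j := by
    rw [comp_assemble, comp_assemble, extGrad_last]
    refine Fin.lastCases ?_ (fun j => ?_) j
    · rw [extVel_last, extVel_last]
      split_ifs
      exacts [h1, weakBot_zero]
    · rw [extVel_castSucc, extVel_castSucc]
      split_ifs
      exacts [weakBot_zero, h2.smul _]
  div k := by
    simp only [comp_assemble]
    rw [Fin.sum_univ_castSucc]
    simp only [extGrad_last, extGrad_castSucc, extVel_last, extVel_castSucc]
    by_cases hk : k = k₀
    · subst hk
      have hne : (!k) ≠ k := by cases k <;> simp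
      have hR : freqNorm ξ ^ 2 ≠ 0 := by
        have := one_le_freqNorm hξ
        positivity
      simp only [if_neg hne, if_true, smul_smul, ← Finset.sum_smul]
      have : ∑ i, -(2 * Real.pi * (ξ i : ℝ) * trigSign k) *
          (trigSign k * ξ i / (2 * Real.pi * freqNorm ξ ^ 2)) = -1 := by
        have h3 : ∀ i, -(2 * Real.pi * (ξ i : ℝ) * trigSign k) *
          (trigSign k * ξ i / (2 * Real.pi * freqNorm ξ ^ 2))
            = (ξ i : ℝ) ^ 2 * (-1 / freqNorm ξ ^ 2) := fun i => by
          have := trigSign_sq k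
          have hpi := Real.pi_ne_zero
          field_simp
          rw [sq (trigSign k), this, mul_one]
        simp only [h3]
        rw [← Finset.sum_mul, ← freqNorm_sq, mul_div_cancel₀ _ hR]
      rw [this]
      simp
    · have hk' : (!k) = k₀ := by
        cases k <;> cases k₀ <;> simp_all
      simp [hk, hk']

lemma weakTop_ext {t : ℝ} (h : WeakTop p q t) (k : Bool) :
    WeakTop (comp (Fin.last d) (assemble (extVel ξ k₀ p q k)))
      (comp (Fin.last d, Fin.last d) (assemble (extGrad ξ k₀ p q r k)))
      (if k = k₀ then t else 0) := by
  rw [comp_assemble, comp_assemble, extGrad_last, extVel_last, extVel_last]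
  split_ifs
  exacts [h, weakTop_zero]

lemma sum_norm_extVel_sq (hξ : ξ ≠ 0) :
    ∑ k, ∑ j, ‖extVel ξ k₀ p q k j‖ ^ 2
      = ‖p‖ ^ 2 + ‖q‖ ^ 2 / ((2 * Real.pi) ^ 2 * freqNorm ξ ^ 2) := by
  have hR : 0 < freqNorm ξ := lt_of_lt_of_le one_pos (one_le_freqNorm hξ)
  have h1 : ∑ j, ‖extVel ξ k₀ p q k₀ j‖ ^ 2 = ‖p‖ ^ 2 := by
    simp [Fin.sum_univ_castSucc, extVel_last, extVel_castSucc]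
  have h2 : ∑ j, ‖extVel ξ k₀ p q (!k₀) j‖ ^ 2
      = ‖q‖ ^ 2 / ((2 * Real.pi) ^ 2 * freqNorm ξ ^ 2) := by
    have hne : (!k₀) ≠ k₀ := by cases k₀ <;> simp
    simp only [Fin.sum_univ_castSucc, extVel_last, extVel_castSucc, if_neg hne, norm_smul, mul_pow,
      Real.norm_eq_abs, sq_abs, norm_zero]
    rw [← Finset.sum_mul]
    have : ∑ i, (trigSign k₀ * (ξ i : ℝ) / (2 * Real.pi * freqNorm ξ ^ 2)) ^ 2
        = 1 / ((2 * Real.pi) ^ 2 * freqNorm ξ ^ 2) := by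
      have h3 : ∀ i, (trigSign k₀ * (ξ i : ℝ) / (2 * Real.pi * freqNorm ξ ^ 2)) ^ 2
          = (ξ i : ℝ) ^ 2 * (1 / (2 * Real.pi * freqNorm ξ ^ 2) ^ 2) := fun i => by
        rw [div_pow, mul_pow, sq (trigSign k₀), trigSign_sq]
        ring
      simp only [h3]
      rw [← Finset.sum_mul, ← freqNorm_sq]
      field_simp
    rw [this]
    simp only [ne_eq, OfNat.ofNat_ne_zero, not_false_eq_true, zero_pow]
    ring
  cases k₀ <;> simp only [Fintype.sum_bool, Bool.not_true, Bool.not_false] at h1 h2 ⊢ <;>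
    rw [h1, h2]
  ring

/-- Horizontal derivatives multiply by `2π|ξ|` in norm; the vertical derivative replaces the pair
`(p, q)` by `(q, r)`. -/
lemma sum_norm_extGrad_sq :
    ∑ k, ∑ ij, ‖extGrad ξ k₀ p q r k ij‖ ^ 2
      = (2 * Real.pi) ^ 2 * freqNorm ξ ^ 2 * (∑ k, ∑ j, ‖extVel ξ k₀ p q k j‖ ^ 2)
        + ∑ k, ∑ j, ‖extVel ξ k₀ q r k j‖ ^ 2 := by
  have h1 : ∀ k, ∑ ij, ‖extGrad ξ k₀ p q r k ij‖ ^ 2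
      = (2 * Real.pi) ^ 2 * freqNorm ξ ^ 2 * (∑ j, ‖extVel ξ k₀ p q (!k) j‖ ^ 2)
        + ∑ j, ‖extVel ξ k₀ q r k j‖ ^ 2 := by
    intro k
    rw [Fintype.sum_prod_type, Fin.sum_univ_castSucc]
    simp only [extGrad_last, extGrad_castSucc, norm_smul, mul_pow, Real.norm_eq_abs, sq_abs, neg_sq]
    congr 1
    simp only [← Finset.mul_sum]
    rw [← Finset.sum_mul, sq (trigSign k), trigSign_sq]
    simp only [mul_one]
    rw [← Finset.mul_sum, ← freqNorm_sq]
  simp only [h1, Fintype.sum_bool, Bool.not_true, Bool.not_false]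
  ring

end Extension

/-! ### Boundary-layer profiles and the extension estimate. -/

section Profile

/-- The profiles `c (y / ℓ) ^ n`. -/
lemma continuous_profile (ℓ c : ℝ) (n : ℕ) : Continuous fun y : ℝ => c * (y / ℓ) ^ n := by fun_prop

lemma hasDerivAt_profile (ℓ c : ℝ) (n : ℕ) (y : ℝ) :
    HasDerivAt (fun y : ℝ => c * (y / ℓ) ^ (n + 1)) (c * ((n + 1) / ℓ) * (y / ℓ) ^ n) y := by
  refine ((((hasDerivAt_id y).div_const ℓ).pow (n + 1)).const_mul c).congr_deriv ?_
  simp only [id, Nat.cast_add, Nat.cast_one, Nat.add_sub_cancel]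
  ring

lemma norm_profile_sq (hℓ : 0 < ℓ) (c : ℝ) (n : ℕ) :
    ‖intLp ℓ (continuous_profile ℓ c n)‖ ^ 2 = c ^ 2 * ℓ / (2 * n + 1) := by
  rw [norm_intLp_sq hℓ.le]
  have : ∀ y : ℝ, (c * (y / ℓ) ^ n) ^ 2 = c ^ 2 * (y / ℓ) ^ (2 * n) := fun y => by ring
  simp only [this]
  rw [intervalIntegral.integral_const_mul,
    intervalIntegral.integral_comp_div (fun y => y ^ (2 * n)) hℓ.ne', integral_pow]
  simp [hℓ.ne']
  ring

/-- Every boundary mode extends to a solenoidal field vanishing on the bottom, with the natural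
bounds in terms of the frequency. -/
lemma exists_extension (hℓ : 0 < ℓ) : ∃ C : ℝ, 0 < C ∧ ∀ {d : ℕ} (ξ : Fin d → ℤ), ξ ≠ 0 →
    ∀ k₀ : Bool, ∃ (a : Bool → L2Int ℓ (EuclideanSpace ℝ (Fin (d + 1))))
      (b : Bool → L2Int ℓ (EuclideanSpace ℝ (Fin (d + 1) × Fin (d + 1)))),
      IsMode ξ a b ∧
      (∀ k, WeakTop (comp (Fin.last d) (a k)) (comp (Fin.last d, Fin.last d) (b k))
        (if k = k₀ then 1 else 0)) ∧
      ∑ k, ‖a k‖ ^ 2 ≤ C ∧ ∑ k, ‖b k‖ ^ 2 ≤ C * freqNorm ξ := by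
  set C₁ : ℝ := ℓ + 4 / ℓ with hC₁
  set C₂ : ℝ := 4 / ℓ + 64 / ℓ ^ 3 with hC₂
  -- `C₁` bounds the velocity and `40 * C₁ + C₂` the gradient; `40` is an upper bound for `(2π)²`.
  refine ⟨C₁ + (40 * C₁ + C₂), by positivity, fun {d} ξ hξ k₀ => ?_⟩
  set R := freqNorm ξ with hR
  have hR1 : 1 ≤ R := one_le_freqNorm hξ
  -- The vertical profile is `(y/ℓ)^(n+2)` with `n` comparable to `|ξ|`, which lives in a layer of
  -- thickness about `ℓ/|ξ|` below the surface. The extra `2` makes the profile and its derivative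
  -- vanish at the bottom.
  set n : ℕ := ⌈R⌉₊ with hn
  have hn1 : R ≤ n := Nat.le_ceil R
  have hn2 : (n : ℝ) ≤ R + 1 := (Nat.ceil_lt_add_one (by linarith)).le
  -- Coefficients of the first and second derivatives of the profile, in the shape produced by
  -- `hasDerivAt_profile`.
  set c₁ : ℝ := 1 * (((n + 1 : ℕ) + 1 : ℝ) / ℓ)
  set c₂ : ℝ := c₁ * ((n + 1 : ℝ) / ℓ)
  set p := intLp ℓ (continuous_profile ℓ 1 (n + 2)) with hp
  set q := intLp ℓ (continuous_profile ℓ c₁ (n + 1)) with hq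
  set r := intLp ℓ (continuous_profile ℓ c₂ n) with hr
  have hpq : WeakBot p q := weakBot_intLp hℓ.le (hasDerivAt_profile ℓ 1 (n + 1)) _ _ (by simp)
  have hqr : WeakBot q r := weakBot_intLp hℓ.le (hasDerivAt_profile ℓ c₁ n) _ _ (by simp)
  have hpqt : WeakTop p q 1 := by
    have := weakTop_intLp hℓ.le (hasDerivAt_profile ℓ 1 (n + 1))
      (continuous_profile ℓ 1 (n + 2)) (continuous_profile ℓ c₁ (n + 1))
    simpa only [div_self hℓ.ne', one_pow, mul_one] using this
  have hRpos : 0 < R := by linarith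
  have hpn : ‖p‖ ^ 2 ≤ ℓ / R := by
    rw [hp, norm_profile_sq hℓ, one_pow, one_mul]
    refine div_le_div_of_nonneg_left hℓ.le hRpos ?_
    push_cast
    linarith
  have hqn : ‖q‖ ^ 2 ≤ 4 * R / ℓ := by
    rw [hq, norm_profile_sq hℓ]
    have h1 : c₁ = (n + 2) / ℓ := by simp only [c₁]; push_cast; ring
    rw [h1, div_pow, div_le_div_iff₀ (by positivity) hℓ]
    push_cast
    field_simp
    nlinarith
  have hrn : ‖r‖ ^ 2 ≤ 64 * R ^ 3 / ℓ ^ 3 := by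
    rw [hr, norm_profile_sq hℓ]
    have h1 : c₂ = (n + 2) * (n + 1) / ℓ ^ 2 := by
      simp only [c₂, c₁]; push_cast; field_simp; ring
    have h2 : c₂ ^ 2 * ℓ / (2 * n + 1) = ((n + 2) * (n + 1)) ^ 2 / (2 * n + 1) / ℓ ^ 3 := by
      rw [h1]
      field_simp
    rw [h2]
    refine div_le_div_of_nonneg_right ?_ (by positivity)
    rw [div_le_iff₀ (by positivity)]
    have h3 : (n + 2 : ℝ) ≤ 4 * R := by linarith
    have h4 : (n + 1 : ℝ) ≤ 2 * n + 1 := by linarith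
    have h5 : (n + 1 : ℝ) ≤ 4 * R := by linarith
    calc ((n + 2) * (n + 1) : ℝ) ^ 2 = ((n + 2) * (n + 2) * (n + 1)) * (n + 1) := by ring
      _ ≤ ((4 * R) * (4 * R) * (4 * R)) * (2 * n + 1) := by gcongr
      _ = 64 * R ^ 3 * (2 * n + 1) := by ring
  have hpi1 : 1 ≤ (2 * Real.pi) ^ 2 := one_le_pow₀ (by linarith [Real.pi_gt_three])
  have hpi2 : (2 * Real.pi) ^ 2 ≤ 40 := by
    have := Real.pi_lt_d2
    nlinarith [Real.pi_pos]
  have hdiv : ∀ x : ℝ, 0 ≤ x → x / ((2 * Real.pi) ^ 2 * R ^ 2) ≤ x / R ^ 2 := fun x hx =>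
    div_le_div_of_nonneg_left hx (by positivity) (le_mul_of_one_le_left (by positivity) hpi1)
  have hA : ∑ k, ∑ j, ‖extVel ξ k₀ p q k j‖ ^ 2 ≤ C₁ / R := by
    rw [sum_norm_extVel_sq k₀ hξ]
    calc _ ≤ ℓ / R + (4 * R / ℓ) / R ^ 2 :=
          add_le_add hpn ((hdiv _ (sq_nonneg _)).trans (by gcongr))
      _ = C₁ / R := by rw [hC₁]; field_simp
  have hB : ∑ k, ∑ j, ‖extVel ξ k₀ q r k j‖ ^ 2 ≤ C₂ * R := by
    rw [sum_norm_extVel_sq k₀ hξ]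
    calc _ ≤ 4 * R / ℓ + (64 * R ^ 3 / ℓ ^ 3) / R ^ 2 :=
          add_le_add hqn ((hdiv _ (sq_nonneg _)).trans (by gcongr))
      _ = C₂ * R := by rw [hC₂]; field_simp
  have hC₁0 : 0 ≤ C₁ := by positivity
  have hC₂0 : 0 ≤ C₂ := by positivity
  refine ⟨_, _, isMode_ext k₀ hξ hpq hqr, weakTop_ext k₀ hpqt, ?_, ?_⟩
  · simp only [norm_sq_eq_sum_comp, comp_assemble]
    have : C₁ / R ≤ C₁ := div_le_self hC₁0 hR1
    linarith
  · simp only [norm_sq_eq_sum_comp, comp_assemble]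
    rw [sum_norm_extGrad_sq k₀]
    calc _ ≤ 40 * R ^ 2 * (C₁ / R) + C₂ * R := by gcongr
      _ = (40 * C₁ + C₂) * R := by field_simp
      _ ≤ _ := mul_le_mul_of_nonneg_right (by linarith) hRpos.le

end Profile

end ViscousSlab
end

noncomputable section

namespace ViscousSlab

variable {d : ℕ} {ℓ : ℝ}

/-! ### Decay of one frequency for solutions that are differentiable in time -/

/-- Grönwall: `exp(c t) F(t)` is nonincreasing. -/
lemma le_mul_exp_of_deriv_le {F F' : ℝ → ℝ} {c : ℝ} (hF : ∀ t, 0 ≤ t → HasDerivAt F (F' t) t)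
    (h : ∀ t, 0 ≤ t → F' t ≤ -c * F t) {t : ℝ} (ht : 0 ≤ t) :
    F t ≤ Real.exp (-c * t) * F 0 := by
  have hd : ∀ t, 0 ≤ t → HasDerivAt (fun t => Real.exp (c * t) * F t)
      (Real.exp (c * t) * c * F t + Real.exp (c * t) * F' t) t := fun t ht => by
    have h1 : HasDerivAt (fun t => Real.exp (c * t)) (Real.exp (c * t) * c) t := by
      simpa using ((hasDerivAt_id t).const_mul c).exp
    exact h1.mul (hF t ht)
  have hanti : AntitoneOn (fun t => Real.exp (c * t) * F t) (Ici 0) := by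
    refine antitoneOn_of_deriv_nonpos (convex_Ici 0)
      (fun t ht => (hd t ht).continuousAt.continuousWithinAt)
      (fun t ht => (hd t (interior_subset ht)).differentiableAt.differentiableWithinAt)
      fun t ht => ?_
    have ht := interior_subset ht
    rw [(hd t ht).deriv]
    have := h t ht
    have := mul_le_mul_of_nonneg_left this (Real.exp_pos (c * t)).le
    nlinarith
  have h1 := hanti (self_mem_Ici) (mem_Ici.2 ht) ht
  simp only [mul_zero, Real.exp_zero, one_mul] at h1
  calc F t = Real.exp (-c * t) * (Real.exp (c * t) * F t) := by
        rw [← mul_assoc, ← Real.exp_add]; simp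
    _ ≤ _ := by gcongr

lemma sq_sum_inner_le {ι H : Type*} [Fintype ι] [NormedAddCommGroup H] [InnerProductSpace ℝ H]
    (x y : ι → H) : (∑ k, inner ℝ (x k) (y k)) ^ 2 ≤ (∑ k, ‖x k‖ ^ 2) * ∑ k, ‖y k‖ ^ 2 := by
  refine le_trans ?_ (Finset.sum_mul_sq_le_sq_mul_sq Finset.univ (fun k => ‖x k‖) fun k => ‖y k‖)
  rw [← sq_abs]
  refine pow_le_pow_left₀ (abs_nonneg _) ?_ 2
  exact (Finset.abs_sum_le_sum_abs _ _).trans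
    (Finset.sum_le_sum fun k _ => abs_real_inner_le_norm _ _)

/-- The energy in the modes of frequency `ξ`; `η` are the Fourier coefficients of the height. -/
def modeEnergy (ξ : Fin d → ℤ) (m : ℝ) (u : L2Vel d ℓ) (η : Bool → ℝ) : ℝ :=
  1 / 2 * ∑ k, ‖anal ξ k u‖ ^ 2 + 1 / 2 * (m * ∑ k, η k ^ 2)

/-- The equations for the modes of frequency `ξ`, with symbol `m` at this frequency, for a velocity
that is differentiable in time. -/
structure IsModeFlow (ξ : Fin d → ℤ) (m : ℝ) (U U' : ℝ → L2Vel d ℓ) (W : ℝ → Hsol d ℓ)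
    (η τ : Bool → ℝ → ℝ) : Prop where
  hasDerivAt_vel : ∀ t, 0 ≤ t → HasDerivAt U (U' t) t
  vel_eq : ∀ t, 0 ≤ t → Hsol.vel (W t) = U t
  hasDerivAt_height : ∀ t, 0 ≤ t → ∀ k, HasDerivAt (η k) (τ k t) t
  trace : ∀ t, 0 ≤ t → ∀ k, WeakTop (comp (Fin.last d) (anal ξ k (Hsol.vel (W t))))
    (comp (Fin.last d, Fin.last d) (anal ξ k (Hsol.grad (W t)))) (τ k t)
  momentum : ∀ t, 0 ≤ t → ∀ (a : Bool → L2Int ℓ (EuclideanSpace ℝ (Fin (d + 1))))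
    (b : Bool → L2Int ℓ (EuclideanSpace ℝ (Fin (d + 1) × Fin (d + 1)))) (h : IsMode ξ a b)
    (κ : Bool → ℝ),
    (∀ k, WeakTop (comp (Fin.last d) (a k)) (comp (Fin.last d, Fin.last d) (b k)) (κ k)) →
    inner ℝ (U' t) (Hsol.vel h.field)
      = -(1 / 2) * symGradInner (W t) h.field - m * ∑ k, κ k * η k t

section Flow

variable {ξ : Fin d → ℤ} {m : ℝ} {U U' : ℝ → L2Vel d ℓ} {W : ℝ → Hsol d ℓ} {η τ : Bool → ℝ → ℝ}

/-- The momentum equation is tested with the `ξ`-modes of the solution itself. Their top trace is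
the time derivative of the height, so the surface term cancels the derivative of the potential
energy. -/
lemma IsModeFlow.hasDerivAt_energy (h : IsModeFlow ξ m U U' W η τ) {t : ℝ} (ht : 0 ≤ t) :
    HasDerivAt (fun t => modeEnergy ξ m (U t) (fun k => η k t))
      (-(1 / 2) * dissip (fun k => anal ξ k (Hsol.grad (W t)))) t := by
  have h1 : HasDerivAt (fun t => modeEnergy ξ m (U t) (fun k => η k t))
      (1 / 2 * (∑ k, 2 * inner ℝ (anal ξ k (U t)) (anal ξ k (U' t)))
        + 1 / 2 * (m * ∑ k, 2 * η k t * τ k t)) t := by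
    refine ((HasDerivAt.fun_sum fun k _ => ?_).const_mul _).add
      (((HasDerivAt.fun_sum fun k _ => ?_).const_mul m).const_mul _)
    · exact ((anal ξ k).hasFDerivAt.comp_hasDerivAt t (h.hasDerivAt_vel t ht)).norm_sq
    · exact ((h.hasDerivAt_height t ht k).pow 2).congr_deriv (by simp)
  refine h1.congr_deriv ?_
  have hm := Hsol.isMode (W t) ξ
  have h2 := h.momentum t ht _ _ hm (fun k => τ k t) (h.trace t ht)
  rw [hm.inner_field, hm.symGradInner_field] at h2
  simp only [h.vel_eq t ht, real_inner_self_eq_norm_sq] at h2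
  rw [dissip]
  have h3 : ∀ k, inner ℝ (anal ξ k (U' t)) (anal ξ k (U t))
      = inner ℝ (anal ξ k (U t)) (anal ξ k (U' t)) := fun k => real_inner_comm _ _
  simp only [h3, Fintype.sum_bool] at h2 ⊢
  linarith

/-- With no height the energy is purely kinetic and Korn–Poincaré suffices. This serves `ξ = 0`,
where a boundary mode has no solenoidal extension. -/
lemma IsModeFlow.decay_zero (hℓ : 0 < ℓ) (h : IsModeFlow ξ m U U' W η τ)
    (hη : ∀ t, 0 ≤ t → ∀ k, η k t = 0) {t : ℝ} (ht : 0 ≤ t) :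
    modeEnergy ξ m (U t) (fun k => η k t) ≤
      Real.exp (-(1 / (1 + 2 * ℓ ^ 2)) * t) * modeEnergy ξ m (U 0) (fun k => η k 0) := by
  refine le_mul_exp_of_deriv_le (fun t ht => h.hasDerivAt_energy ht) (fun t ht => ?_) ht
  have h1 := (Hsol.isMode (W t) ξ).sum_norm_sq_le hℓ
  simp only [h.vel_eq t ht] at h1
  simp only [modeEnergy, hη t ht]
  have h2 : 0 < 1 + 2 * ℓ ^ 2 := by positivity
  rw [← div_le_iff₀' h2] at h1
  simp only [ne_eq, OfNat.ofNat_ne_zero, not_false_eq_true, zero_pow, Finset.sum_const_zero,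
    mul_zero, add_zero]
  calc _ ≤ -(1 / 2) * ((∑ k, ‖anal ξ k (U t)‖ ^ 2) / (1 + 2 * ℓ ^ 2)) := by linarith
    _ = _ := by ring

/-- The scalar computation behind the Lyapunov functional. -/
lemma lyapunov_scalar {C C₃ ℓ m R δ nA nH nT Q : ℝ} {x s η τ : Bool → ℝ} (hm : 0 < m)
    (hC : 0 < C) (hC₃ : 0 < C₃) (hδ : 0 ≤ δ)
    (hx : ∀ k, x k ^ 2 ≤ C * nA) (hs : ∀ k, s k ^ 2 ≤ 4 * C * R * Q) (hQ : 0 ≤ Q)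
    (hH : nH = ∑ k, η k ^ 2) (hT : nT = ∑ k, τ k ^ 2) (hT2 : nT ≤ ℓ * Q) (hA : nA ≤ C₃ * Q)
    (hδ1 : δ * ((ℓ + 2 * C * C₃ + C) * (1 + R / m)) ≤ 1 / 4) (hℓ : 0 < ℓ) (hR : 0 ≤ R)
    (hδ2 : δ ≤ 1 / (2 * C₃)) (hδ3 : δ ≤ m / 2) (hδ4 : δ ≤ 1 / (4 * C)) (hnA : 0 ≤ nA) :
    -(1 / 2) * Q + δ * (∑ k, (τ k * x k + η k * (-(1 / 2) * s k - m * η k)))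
      ≤ -(δ / 2) * ((1 / 2 * nA + 1 / 2 * (m * nH)) + δ * ∑ k, η k * x k) ∧
    |δ * ∑ k, η k * x k| ≤ 1 / 2 * (1 / 2 * nA + 1 / 2 * (m * nH)) := by
  have hCnA : 0 ≤ C * nA := by positivity
  have hnH : 0 ≤ nH := hH ▸ Finset.sum_nonneg fun _ _ => sq_nonneg _
  -- Here `x k` is the pairing of the velocity with the `k`-th extension and `s k` that of the
  -- symmetrized gradients. This bound makes the corrected functional comparable to the energy, by
  -- `δ ≤ m/2` and `δ ≤ 1/(4C)`.
  have h1 : |∑ k, η k * x k| ≤ 1 / 2 * nH + C * nA := by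
    have h2 : ∀ k, |η k * x k| ≤ 1 / 2 * η k ^ 2 + 1 / 2 * (C * nA) := fun k => by
      have := hx k
      rw [abs_le]
      constructor <;> nlinarith [sq_nonneg (η k - x k), sq_nonneg (η k + x k)]
    refine (Finset.abs_sum_le_sum_abs _ _).trans ((Finset.sum_le_sum fun k _ => h2 k).trans ?_)
    rw [hH]
    simp only [Fintype.sum_bool]
    linarith
  have hX : |δ * ∑ k, η k * x k| ≤ 1 / 2 * (1 / 2 * nA + 1 / 2 * (m * nH)) := by
    rw [abs_mul, abs_of_nonneg hδ]
    have h2 : δ * (C * nA) ≤ 1 / 4 * nA := by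
      have : δ * C ≤ 1 / 4 := by
        rw [le_div_iff₀ (by positivity)] at hδ4
        linarith
      nlinarith
    have h3 : δ * nH ≤ m / 2 * nH := mul_le_mul_of_nonneg_right hδ3 hnH
    nlinarith [mul_le_mul_of_nonneg_left h1 hδ]
  refine ⟨?_, hX⟩
  have h2 : ∑ k, (τ k * x k + η k * (-(1 / 2) * s k - m * η k))
      ≤ (ℓ + 2 * C * C₃ + C) * (1 + R / m) * Q - 1 / 2 * (m * nH) := by
    have h3 : ∀ k, τ k * x k + η k * (-(1 / 2) * s k - m * η k)
        ≤ 1 / 2 * τ k ^ 2 + 1 / 2 * (C * nA) - 1 / 2 * (m * η k ^ 2) + C * (R / m) * Q / 2 := by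
      intro k
      have h4 : τ k * x k ≤ 1 / 2 * τ k ^ 2 + 1 / 2 * (C * nA) := by
        nlinarith [hx k, sq_nonneg (τ k - x k)]
      -- Half of the gain `-m η²` pays for the viscous cross term; the remainder `s²/(8m)` is where
      -- `R/m` enters the rate.
      have h5 : -(1 / 2) * s k * η k ≤ 1 / 2 * (m * η k ^ 2) + s k ^ 2 / (8 * m) := by
        have : 0 ≤ (s k + 2 * m * η k) ^ 2 / (8 * m) := by positivity
        have h6 : (s k + 2 * m * η k) ^ 2 / (8 * m)
            = s k ^ 2 / (8 * m) + 1 / 2 * s k * η k + 1 / 2 * (m * η k ^ 2) := by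
          field_simp
          ring
        linarith
      have h6 : s k ^ 2 / (8 * m) ≤ C * (R / m) * Q / 2 := by
        calc s k ^ 2 / (8 * m) ≤ 4 * C * R * Q / (8 * m) := by gcongr; exact hs k
          _ = C * (R / m) * Q / 2 := by field_simp; ring
      nlinarith
    refine (Finset.sum_le_sum fun k _ => h3 k).trans ?_
    simp only [Fintype.sum_bool] at hH hT ⊢
    have h4 : C * nA ≤ C * (C₃ * Q) := mul_le_mul_of_nonneg_left hA hC.le
    have h5 : 0 ≤ R / m := by positivity
    have h6 : 0 ≤ (ℓ + 2 * C * C₃) * (R / m) * Q := by positivity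
    have h7 : 0 ≤ ℓ * Q := by positivity
    have h8 : 0 ≤ C * C₃ * Q := by positivity
    have h9 : 0 ≤ C * Q := by positivity
    nlinarith
  have h3 : δ * (∑ k, (τ k * x k + η k * (-(1 / 2) * s k - m * η k)))
      ≤ 1 / 4 * Q - δ / 2 * (m * nH) := by
    have := mul_le_mul_of_nonneg_left h2 hδ
    have := mul_le_mul_of_nonneg_right hδ1 hQ
    nlinarith
  have h4 : δ * nA ≤ 1 / 2 * Q := by
    calc δ * nA ≤ 1 / (2 * C₃) * (C₃ * Q) := by gcongr
      _ = 1 / 2 * Q := by field_simp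
  have h5 := (abs_le.1 hX).2
  have h6 : δ / 2 * (δ * ∑ k, η k * x k) ≤ δ / 2 * (1 / 2 * (1 / 2 * nA + 1 / 2 * (m * nH))) :=
    mul_le_mul_of_nonneg_left h5 (by positivity)
  have h7 : 0 ≤ δ * (m * nH) := by positivity
  nlinarith

end Flow

/-- Exponential decay of the modes of one frequency, with a rate that is explicit in the
frequency and in the symbol. -/
lemma exists_decay_rate (hℓ : 0 < ℓ) {θ : ℝ} (hθ : 0 < θ) : ∃ c : ℝ, 0 < c ∧
    ∀ {d : ℕ} (ξ : Fin d → ℤ) (m : ℝ), θ ≤ m → ∀ (U U' : ℝ → L2Vel d ℓ) (W : ℝ → Hsol d ℓ)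
      (η τ : Bool → ℝ → ℝ), IsModeFlow ξ m U U' W η τ →
      (ξ = 0 → ∀ t, 0 ≤ t → ∀ k, η k t = 0) → ∀ t, 0 ≤ t →
      modeEnergy ξ m (U t) (fun k => η k t) ≤
        3 * Real.exp (-(c / (1 + freqNorm ξ / m)) * t) *
          modeEnergy ξ m (U 0) (fun k => η k 0) := by
  obtain ⟨C, hC, hext⟩ := exists_extension hℓ
  set C₃ : ℝ := 1 + 2 * ℓ ^ 2 with hC₃
  have hC₃pos : 0 < C₃ := by positivity
  set C₄ : ℝ := ℓ + 2 * C * C₃ + C with hC₄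
  have hC₄pos : 0 < C₄ := by positivity
  -- One entry for each smallness condition on `δ` in `lyapunov_scalar`; the lower bound `θ` for the
  -- symbol turns `δ ≤ m/2` into a condition independent of the frequency.
  set c : ℝ := min (min (1 / (4 * C₄)) (1 / (2 * C₃))) (min (θ / 2) (1 / (4 * C))) with hc
  have hcpos : 0 < c := by
    simp only [hc, lt_min_iff]
    exact ⟨⟨by positivity, by positivity⟩, by positivity, by positivity⟩
  have hc1 : c ≤ 1 / (4 * C₄) := (min_le_left _ _).trans (min_le_left _ _)
  have hc2 : c ≤ 1 / (2 * C₃) := (min_le_left _ _).trans (min_le_right _ _)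
  have hc3 : c ≤ θ / 2 := (min_le_right _ _).trans (min_le_left _ _)
  have hc4 : c ≤ 1 / (4 * C) := (min_le_right _ _).trans (min_le_right _ _)
  refine ⟨c / 2, by positivity, fun {d} ξ m hm U U' W η τ h h0 t ht => ?_⟩
  have hmpos : 0 < m := hθ.trans_le hm
  have hEnn : ∀ t, 0 ≤ modeEnergy ξ m (U t) (fun k => η k t) := fun t =>
    add_nonneg (mul_nonneg (by norm_num) (Finset.sum_nonneg fun _ _ => sq_nonneg _))
      (mul_nonneg (by norm_num) (mul_nonneg hmpos.le (Finset.sum_nonneg fun _ _ => sq_nonneg _)))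
  by_cases hξ : ξ = 0
  · refine (h.decay_zero hℓ (h0 hξ) ht).trans ?_
    refine mul_le_mul_of_nonneg_right ?_ (hEnn 0)
    have h1 : freqNorm ξ = 0 := by simp [hξ, freqNorm]
    have h2 : Real.exp (-(1 / (1 + 2 * ℓ ^ 2)) * t)
        ≤ Real.exp (-(c / 2 / (1 + freqNorm ξ / m)) * t) := by
      rw [Real.exp_le_exp, h1, zero_div, add_zero, div_one]
      refine mul_le_mul_of_nonneg_right (neg_le_neg ?_) ht
      have : 1 / (2 * C₃) ≤ 1 / C₃ := one_div_le_one_div_of_le hC₃pos (by linarith)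
      rw [hC₃] at this hc2
      linarith
    linarith [Real.exp_pos (-(c / 2 / (1 + freqNorm ξ / m)) * t)]
  · choose a b hmode htop hna hnb using hext ξ hξ
    set R := freqNorm ξ
    have hR : 0 ≤ R := freqNorm_nonneg ξ
    set δ : ℝ := c / (1 + R / m) with hδ
    have h1R : 1 ≤ 1 + R / m := by
      have : 0 ≤ R / m := by positivity
      linarith
    have hδnn : 0 ≤ δ := by positivity
    have hδc : δ ≤ c := div_le_self hcpos.le h1R
    -- The correction pairs the velocity with the extension of the current height mode;
    -- differentiating it uses the momentum equation and yields `-m ∑ η_k²`.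
    set X : ℝ → ℝ := fun t => ∑ k, η k t * inner ℝ (U t) (Hsol.vel (hmode k).field) with hX
    set F : ℝ → ℝ := fun t => modeEnergy ξ m (U t) (fun k => η k t) + δ * X t with hF
    have hXd : ∀ t, 0 ≤ t → HasDerivAt X (∑ k, (τ k t * inner ℝ (U t) (Hsol.vel (hmode k).field)
        + η k t * (-(1 / 2) * symGradInner (W t) (hmode k).field - m * η k t))) t := by
      intro t ht
      refine HasDerivAt.fun_sum fun k _ => ?_
      have h1 := h.momentum t ht _ _ (hmode k) _ (htop k)
      have h2 : ∑ k', (if k' = k then (1 : ℝ) else 0) * η k' t = η k t := by simp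
      rw [h2] at h1
      rw [← h1]
      refine (h.hasDerivAt_height t ht k).mul ?_
      have h3 := (h.hasDerivAt_vel t ht).inner ℝ (hasDerivAt_const t (Hsol.vel (hmode k).field))
      simpa using h3
    have hscal : ∀ t, 0 ≤ t → (-(1 / 2) * dissip (fun k => anal ξ k (Hsol.grad (W t))) +
        δ * ∑ k, (τ k t * inner ℝ (U t) (Hsol.vel (hmode k).field)
        + η k t * (-(1 / 2) * symGradInner (W t) (hmode k).field - m * η k t))
        ≤ -(δ / 2) * F t) ∧ |δ * X t| ≤ 1 / 2 * modeEnergy ξ m (U t) (fun k => η k t) := by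
      intro t ht
      have hm' := Hsol.isMode (W t) ξ
      refine lyapunov_scalar (C := C) (C₃ := C₃) (ℓ := ℓ) (m := m) (R := R) (δ := δ)
        (nA := ∑ k, ‖anal ξ k (U t)‖ ^ 2) (nT := ∑ k, τ k t ^ 2) hmpos hC hC₃pos hδnn
        (fun k => ?_) (fun k => ?_) (dissip_nonneg _) rfl rfl ?_ ?_ ?_ hℓ hR
        (hδc.trans hc2) ?_ (hδc.trans hc4) (Finset.sum_nonneg fun _ _ => sq_nonneg _)
      · rw [(hmode k).inner_field, mul_comm]
        exact (sq_sum_inner_le _ _).trans (mul_le_mul_of_nonneg_left (hna k)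
          (Finset.sum_nonneg fun _ _ => sq_nonneg _))
      · rw [(hmode k).symGradInner_field, mul_comm]
        refine (sq_sum_inner_le _ _).trans (mul_le_mul_of_nonneg_left ?_
          (Finset.sum_nonneg fun _ _ => sq_nonneg _))
        calc _ ≤ ∑ k', 4 * ‖b k k'‖ ^ 2 := Finset.sum_le_sum fun k' _ => norm_symm_le _
          _ ≤ 4 * (C * R) := by rw [← Finset.mul_sum]; gcongr; exact hnb k
          _ = 4 * C * R := by ring
      · rw [dissip, Finset.mul_sum]
        exact Finset.sum_le_sum fun k _ => hm'.trace_sq_le hℓ (h.trace t ht k)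
      · have := hm'.sum_norm_sq_le hℓ
        simpa only [h.vel_eq t ht] using this
      · have h1 : δ * (C₄ * (1 + R / m)) = c * C₄ := by
          rw [hδ]
          field_simp
        rw [← hC₄, h1]
        calc c * C₄ ≤ 1 / (4 * C₄) * C₄ := by gcongr
          _ = 1 / 4 := by field_simp
      · linarith
    have hdec := le_mul_exp_of_deriv_le (F := F) (c := δ / 2)
      (fun t ht => (h.hasDerivAt_energy ht).add ((hXd t ht).const_mul δ))
      (fun t ht => (hscal t ht).1) ht
    have hu := (abs_le.1 (hscal t ht).2).1
    have hv := (abs_le.1 (hscal 0 le_rfl).2).2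
    have hrate : -(c / 2 / (1 + R / m)) * t = -(δ / 2) * t := by rw [hδ]; ring
    rw [hrate]
    have he := Real.exp_pos (-(δ / 2) * t)
    -- The functional lies between `1/2` and `3/2` of the energy, whence the factor `3`.
    have hF0 : F 0 ≤ 3 / 2 * modeEnergy ξ m (U 0) (fun k => η k 0) := by
      simp only [hF]; linarith
    have hFt : 1 / 2 * modeEnergy ξ m (U t) (fun k => η k t) ≤ F t := by
      simp only [hF]; linarith
    have := mul_le_mul_of_nonneg_left hF0 he.le
    nlinarith

end ViscousSlab
end

noncomputable section

namespace ViscousSlab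

/-! ### Regularization in time -/

section Mollify

variable {X : Type*} [NormedAddCommGroup X] [NormedSpace ℝ X]

/-- The constant extension to negative times. -/
def extendBack {X : Type*} (f : ℝ → X) (t : ℝ) : X := f (max t 0)

lemma continuous_extendBack {X : Type*} [NormedAddCommGroup X] {f : ℝ → X} (hf : ContinuousOn f (Ici 0)) :
    Continuous (extendBack f) :=
  hf.comp_continuous (by fun_prop) fun _ => mem_Ici.2 (le_max_right _ _)

/-- The average `∫ φ(r - t) f(r) dr` over later times. -/
def mollify (φ : ℝ → ℝ) (f : ℝ → X) (t : ℝ) : X := ∫ r, φ (r - t) • extendBack f r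

lemma mollify_eq_convolution (φ : ℝ → ℝ) (f : ℝ → X) :
    mollify φ f = convolution (fun s => φ (-s)) (extendBack f) (ContinuousLinearMap.lsmul ℝ ℝ)
      volume := by
  funext t
  rw [mollify, convolution, ← integral_sub_left_eq_self _ volume t]
  simp

lemma hasDerivAt_mollify {φ : ℝ → ℝ} (hφ : ContDiff ℝ ∞ φ) (hc : HasCompactSupport φ) {f : ℝ → X}
    (hf : ContinuousOn f (Ici 0)) (t : ℝ) :
    HasDerivAt (mollify φ f) (-mollify (deriv φ) f t) t := by
  rw [mollify_eq_convolution]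
  have h1 : HasCompactSupport fun s => φ (-s) := hc.comp_homeomorph (Homeomorph.neg ℝ)
  have h2 := h1.hasDerivAt_convolution_left (ContinuousLinearMap.lsmul ℝ ℝ) (μ := volume)
    (g₀ := extendBack f) ((hφ.comp contDiff_neg).of_le (by simp))
    (continuous_extendBack hf).locallyIntegrable t
  refine h2.congr_deriv ?_
  rw [mollify_eq_convolution]
  simp only [convolution, deriv_comp_neg, ContinuousLinearMap.lsmul_apply,
    neg_smul, integral_neg]

/-- The kernels are supported at positive times, so only values at times after `t` enter.
Convergence therefore holds at `t = 0` too and recovers the initial data. -/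
lemma tendsto_mollify [CompleteSpace X] {φ : ℕ → ℝ → ℝ} {ε : ℕ → ℝ} (hε : Tendsto ε atTop (𝓝 0))
    (h0 : ∀ n r, 0 ≤ φ n r) (h1 : ∀ n, ∫ r, φ n r = 1)
    (hs : ∀ n, Function.support (φ n) ⊆ Ioo 0 (ε n))
    {f : ℝ → X} (hf : ContinuousOn f (Ici 0)) {t : ℝ} (ht : 0 ≤ t) :
    Tendsto (fun n => mollify (φ n) f t) atTop (𝓝 (f t)) := by
  have hft : extendBack f t = f t := by rw [extendBack, max_eq_left ht]
  have hc := continuous_extendBack hf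
  rw [Metric.tendsto_atTop]
  intro e he
  obtain ⟨δ, hδ, hball⟩ := Metric.continuous_iff.1 hc t (e / 2) (by positivity)
  obtain ⟨N, hN⟩ := (Metric.tendsto_atTop.1 hε) δ hδ
  refine ⟨N, fun n hn => ?_⟩
  have hn := hN n hn
  rw [Real.dist_eq, sub_zero] at hn
  rw [mollify_eq_convolution]
  refine lt_of_le_of_lt (dist_convolution_le (R := δ) (ε := e / 2) (by positivity) ?_
    (fun s => h0 n (-s)) ?_ hc.aestronglyMeasurable fun r hr => ?_) (by linarith)
  · intro s hs'
    have := hs n (show -s ∈ Function.support (φ n) from hs')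
    rw [mem_ball_zero_iff, Real.norm_eq_abs, abs_lt]
    constructor
    · linarith [this.2, le_abs_self (ε n)]
    · linarith [this.1]
  · rw [integral_neg_eq_self (fun s => φ n s), h1]
  · rw [← hft]
    exact (hball r hr).le

lemma tsupport_shift_subset {φ : ℝ → ℝ} (hs : tsupport φ ⊆ Ioi 0) {t : ℝ} (ht : 0 ≤ t) :
    tsupport (fun r => φ (r - t)) ⊆ Ioi 0 := by
  refine (tsupport_comp_subset_preimage φ (by fun_prop : Continuous fun r : ℝ => r - t)).trans
    fun r hr => ?_
  have := hs hr
  simp only [mem_Ioi] at this ⊢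
  linarith

lemma mollify_eq_setIntegral {φ : ℝ → ℝ} (hs : tsupport φ ⊆ Ioi 0) (f : ℝ → X) {t : ℝ}
    (ht : 0 ≤ t) : mollify φ f t = ∫ r in Ioi 0, φ (r - t) • f r := by
  rw [mollify, ← setIntegral_eq_integral_of_forall_compl_eq_zero (s := Ioi 0)]
  · refine setIntegral_congr_fun measurableSet_Ioi fun r hr => ?_
    simp only [extendBack, max_eq_left (le_of_lt (mem_Ioi.1 hr))]
  · intro r hr
    have h0 : φ (r - t) = 0 := image_eq_zero_of_notMem_tsupport fun h => hr <| by
      have : 0 < r - t := hs h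
      exact mem_Ioi.2 (by linarith)
    rw [h0, zero_smul]

lemma IsL2Loc.integrableOn_smul {f : ℝ → X} (hf : IsL2Loc f) {ψ : ℝ → ℝ} (hψ : Continuous ψ)
    (hc : HasCompactSupport ψ) : IntegrableOn (fun r => ψ r • f r) (Ioi 0) := by
  obtain ⟨T, hT⟩ := hc.isBounded.subset_closedBall 0
  obtain ⟨C, hC⟩ := hc.exists_bound_of_continuous hψ
  set T' := max T 0 + 1
  have hT' : 0 < T' := by positivity
  have h1 : IntegrableOn (fun r => ψ r • f r) (Ioo 0 T') :=
    ((hf T' hT').integrable (by norm_num)).bdd_smul C hψ.aestronglyMeasurable (ae_of_all _ hC)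
  refine h1.of_forall_sdiff_eq_zero measurableSet_Ioi fun r hr => ?_
  have h0 : ψ r = 0 := image_eq_zero_of_notMem_tsupport fun h => hr.2 ⟨hr.1, by
    have h2 := hT h
    rw [mem_closedBall_zero_iff, Real.norm_eq_abs] at h2
    have := le_max_left T 0
    linarith [le_abs_self r]⟩
  rw [h0, zero_smul]

lemma isL2Loc_of_continuousOn {X : Type*} [NormedAddCommGroup X] {f : ℝ → X} (hf : ContinuousOn f (Ici 0)) : IsL2Loc f := by
  intro T hT
  obtain ⟨C, hC⟩ := (isCompact_Icc (a := (0 : ℝ)) (b := T)).exists_bound_of_continuousOn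
    (hf.mono Icc_subset_Ici_self)
  refine MemLp.of_bound ((hf.mono (Ioo_subset_Icc_self.trans Icc_subset_Ici_self)).aestronglyMeasurable
    measurableSet_Ioo) C ?_
  filter_upwards [ae_restrict_mem measurableSet_Ioo] with r hr
  exact hC r (Ioo_subset_Icc_self hr)

/-- For `t ≥ 0` the shifted kernel is still supported in positive times and is admissible in the
weak derivative. -/
lemma HasWeakTimeDeriv.setIntegral_shift {f f' : ℝ → X} (h : HasWeakTimeDeriv f f') {φ : ℝ → ℝ}
    (hφ : ContDiff ℝ ∞ φ) (hc : HasCompactSupport φ) (hs : tsupport φ ⊆ Ioi 0) {t : ℝ}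
    (ht : 0 ≤ t) :
    -∫ r in Ioi 0, deriv φ (r - t) • f r = ∫ r in Ioi 0, φ (r - t) • f' r := by
  have h1 := h (fun r => φ (r - t)) (hφ.comp (contDiff_id.sub contDiff_const))
    (hc.comp_homeomorph (Homeomorph.subRight t)) (tsupport_shift_subset hs ht)
  simp only [deriv_comp_sub_const] at h1
  rw [h1, neg_neg]

/-- An approximate identity supported at small positive times. -/
lemma exists_mollifier : ∃ (φ : ℕ → ℝ → ℝ) (ε : ℕ → ℝ), Tendsto ε atTop (𝓝 0) ∧
    ∀ n, ContDiff ℝ ∞ (φ n) ∧ HasCompactSupport (φ n) ∧ tsupport (φ n) ⊆ Ioi 0 ∧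
      (∀ r, 0 ≤ φ n r) ∧ ∫ r, φ n r = 1 ∧ Function.support (φ n) ⊆ Ioo 0 (ε n) := by
  have hpos : ∀ n : ℕ, (0 : ℝ) < 1 / (n + 1) := fun n => Nat.one_div_pos_of_nat
  let b : ∀ n : ℕ, ContDiffBump (1 / (n + 1) : ℝ) := fun n =>
    ⟨1 / (n + 1) / 4, 1 / (n + 1) / 2, by have := hpos n; positivity,
      by have := hpos n; linarith⟩
  refine ⟨fun n => (b n).normed volume, fun n => 2 * (1 / (n + 1)), ?_, fun n =>
    ⟨(b n).contDiff_normed, (b n).hasCompactSupport_normed, ?_, (b n).nonneg_normed,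
      (b n).integral_normed, ?_⟩⟩
  · simpa using (tendsto_one_div_add_atTop_nhds_zero_nat (𝕜 := ℝ)).const_mul 2
  · rw [(b n).tsupport_normed_eq]
    intro r hr
    rw [Metric.mem_closedBall, Real.dist_eq, abs_le] at hr
    have h1 : (b n).rOut = 1 / (n + 1) / 2 := rfl
    have := hpos n
    exact mem_Ioi.2 (by linarith [hr.1])
  · rw [(b n).support_normed_eq]
    intro r hr
    rw [Metric.mem_ball, Real.dist_eq, abs_lt] at hr
    have h1 : (b n).rOut = 1 / (n + 1) / 2 := rfl
    have := hpos n
    exact ⟨by linarith [hr.1], by linarith [hr.2]⟩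

end Mollify

/-! ### Fourier coefficients on the surface -/

variable {d : ℕ} {ℓ : ℝ}

lemma memLp_trig (ξ : Fin d → ℤ) (k : Bool) : MemLp (trig ξ k) 2 (torusMeasure d) :=
  MemLp.of_bound (continuous_trig ξ k).aestronglyMeasurable 1 (ae_of_all _ (abs_trig_le ξ k))

/-- The real Fourier coefficient `∫ f trig`. -/
def surfCoef (ξ : Fin d → ℤ) (k : Bool) : L2Surf d →L[ℝ] ℝ :=
  innerSL ℝ ((memLp_trig ξ k).toLp _)

lemma surfCoef_apply (ξ : Fin d → ℤ) (k : Bool) (f : L2Surf d) :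
    surfCoef ξ k f = ∫ x, f x * trig ξ k x ∂(torusMeasure d) := by
  rw [surfCoef, innerSL_apply_apply, L2.inner_def]
  refine integral_congr_ae ?_
  filter_upwards [(memLp_trig ξ k).coeFn_toLp] with x hx
  simp [hx]

lemma integrable_mul_trig (ξ : Fin d → ℤ) (k : Bool) (f : L2Surf d) :
    Integrable (fun x => f x * trig ξ k x) (torusMeasure d) :=
  (Lp.memLp f).integrable_mul (memLp_trig ξ k)

/-- The complex Fourier coefficient in terms of the real ones. -/
lemma surfFourier_eq {f : UnitAddTorus (Fin d) → ℝ} (ξ : Fin d → ℤ)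
    (hf : ∀ k, Integrable (fun x => f x * trig ξ k x) (torusMeasure d)) :
    surfFourier f ξ = ((∫ x, f x * trig ξ false x ∂(torusMeasure d) : ℝ) : ℂ)
      - ((∫ x, f x * trig ξ true x ∂(torusMeasure d) : ℝ) : ℂ) * Complex.I := by
  have h0 : surfFourier f ξ = ∫ x, UnitAddTorus.mFourier (-ξ) x * (f x : ℂ) ∂(torusMeasure d) := rfl
  rw [h0, ← integral_complex_ofReal, ← integral_complex_ofReal, ← integral_mul_const,
    ← integral_sub (hf false).ofReal ((hf true).ofReal.mul_const _)]
  refine integral_congr_ae (ae_of_all _ fun x => ?_)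
  simp only [UnitAddTorus.mFourier_neg, trig, Bool.false_eq_true, if_false, if_true]
  apply Complex.ext <;> simp <;> ring

lemma surfFourier_coe (f : L2Surf d) (ξ : Fin d → ℤ) :
    surfFourier f ξ = (surfCoef ξ false f : ℂ) - (surfCoef ξ true f : ℂ) * Complex.I := by
  rw [surfFourier_eq ξ (fun k => integrable_mul_trig ξ k f), surfCoef_apply, surfCoef_apply]

lemma norm_sub_mul_I_sq (x y : ℝ) : ‖(x : ℂ) - (y : ℂ) * Complex.I‖ ^ 2 = x ^ 2 + y ^ 2 := by
  rw [← Complex.normSq_eq_norm_sq, Complex.normSq_apply]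
  simp
  ring

lemma norm_surfFourier_sq (f : L2Surf d) (ξ : Fin d → ℤ) :
    ‖surfFourier f ξ‖ ^ 2 = ∑ k, surfCoef ξ k f ^ 2 := by
  rw [surfFourier_coe, norm_sub_mul_I_sq, Fintype.sum_bool, add_comm]

/-- The symbol is real, so the complex relation separates into its cosine and sine parts. -/
lemma IsMultiplier.surfCoef {μ : (Fin d → ℤ) → ℝ} {f g : L2Surf d} (h : IsMultiplier μ f g)
    (ξ : Fin d → ℤ) (k : Bool) : surfCoef ξ k g = μ ξ * surfCoef ξ k f := by
  have h1 := h ξ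
  rw [surfFourier_coe, surfFourier_coe] at h1
  cases k
  · simpa using congrArg Complex.re h1
  · simpa using congrArg Complex.im h1

lemma integral_mul_trigLp (f : L2Surf d) (ξ : Fin d → ℤ) (κ : Bool → ℝ) :
    ∫ x, f x * trigLp ξ κ x ∂(torusMeasure d) = ∑ k, κ k * surfCoef ξ k f := by
  simp only [surfCoef_apply, ← integral_const_mul]
  rw [← integral_finsetSum _ fun k _ => (integrable_mul_trig ξ k f).const_mul (κ k)]
  refine integral_congr_ae ?_
  filter_upwards [coeFn_trigLp ξ κ] with x hx
  rw [hx, Finset.mul_sum]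
  exact Finset.sum_congr rfl fun k _ => by ring

lemma surfCoef_zero_freq {f : L2Surf d} (hf : ∫ x, f x ∂(torusMeasure d) = 0) (k : Bool) :
    surfCoef 0 k f = 0 := by
  rw [surfCoef_apply]
  cases k
  · simpa [trig, UnitAddTorus.mFourier_zero] using hf
  · simp [trig, UnitAddTorus.mFourier_zero]

/-! ### Weak solutions -/

/-- The velocity as a continuous linear map. -/
def velL (d : ℕ) (ℓ : ℝ) : Hsol d ℓ →L[ℝ] L2Vel d ℓ :=
  (ContinuousLinearMap.fst ℝ (L2Vel d ℓ) (L2Grad d ℓ)).comp (Hsol d ℓ).subtypeL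

/-- The gradient as a continuous linear map. -/
def gradL (d : ℕ) (ℓ : ℝ) : Hsol d ℓ →L[ℝ] L2Grad d ℓ :=
  (ContinuousLinearMap.snd ℝ (L2Vel d ℓ) (L2Grad d ℓ)).comp (Hsol d ℓ).subtypeL

lemma velL_apply (w : Hsol d ℓ) : velL d ℓ w = Hsol.vel w := rfl

lemma toDual_apply (u : L2Vel d ℓ) (v : Hsol d ℓ) : toDual u v = inner ℝ u (Hsol.vel v) := rfl

lemma continuous_toDual : Continuous (toDual : L2Vel d ℓ → StrongDual ℝ (Hsol d ℓ)) := by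
  unfold toDual
  exact ((innerSL ℝ).continuous).clm_comp continuous_const

lemma setIntegral_clm_comm {X Y : Type*} [NormedAddCommGroup X] [NormedSpace ℝ X] [CompleteSpace X]
    [NormedAddCommGroup Y] [NormedSpace ℝ Y] [CompleteSpace Y] (L : X →L[ℝ] Y) {f : ℝ → X}
    {ψ : ℝ → ℝ} (h : IntegrableOn (fun r => ψ r • f r) (Ioi 0)) :
    L (∫ r in Ioi 0, ψ r • f r) = ∫ r in Ioi 0, ψ r • L (f r) := by
  rw [← L.integral_comp_comm h]
  simp only [map_smul]

lemma setIntegral_mul_sub_sum {f : ℝ → ℝ} {g : Bool → ℝ → ℝ} (hf : IntegrableOn f (Ioi 0))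
    (hg : ∀ k, IntegrableOn (g k) (Ioi 0)) {a m : ℝ} {κ : Bool → ℝ} :
    ∫ r in Ioi 0, (a * f r - m * ∑ k, κ k * g k r) =
      a * (∫ r in Ioi 0, f r) - m * ∑ k, κ k * ∫ r in Ioi 0, g k r := by
  simp only [Fintype.sum_bool]
  have h1 : IntegrableOn (fun r => κ true * g true r) (Ioi 0) := (hg true).const_mul _
  have h2 : IntegrableOn (fun r => κ false * g false r) (Ioi 0) := (hg false).const_mul _
  have h3 : IntegrableOn (fun r => m * (κ true * g true r + κ false * g false r)) (Ioi 0) :=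
    (h1.add h2).const_mul m
  rw [integral_sub (hf.const_mul a) h3, integral_const_mul, integral_const_mul,
    integral_add h1 h2, integral_const_mul, integral_const_mul]

/-- The time derivative of `u` exists only in the dual of `Hsol`, whereas that of the average is in
`L²` because the kernel is differentiated. The two agree on `Hsol`. -/
lemma inner_mollify_deriv {u : ℝ → L2Vel d ℓ} {u' : ℝ → StrongDual ℝ (Hsol d ℓ)}
    (hu : ContinuousOn u (Ici 0)) (hu' : IsL2Loc u')
    (hdu : HasWeakTimeDeriv (fun t => toDual (u t)) u') {φ : ℝ → ℝ} (hφ : ContDiff ℝ ∞ φ)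
    (hc : HasCompactSupport φ) (hs : tsupport φ ⊆ Ioi 0) {t : ℝ} (ht : 0 ≤ t) (v : Hsol d ℓ) :
    inner ℝ (-mollify (deriv φ) u t) (Hsol.vel v) = ∫ r in Ioi 0, φ (r - t) • u' r v := by
  have hds : tsupport (deriv φ) ⊆ Ioi 0 := tsupport_deriv_subset.trans hs
  have hφt : Continuous fun r => φ (r - t) := hφ.continuous.comp (by fun_prop)
  have hiu' := hu'.integrableOn_smul hφt (hc.comp_homeomorph (Homeomorph.subRight t))
  have hdl : IsL2Loc fun r => toDual (ℓ := ℓ) (u r) :=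
    isL2Loc_of_continuousOn (by exact continuous_toDual.comp_continuousOn hu)
  have hdφ : Continuous fun r => deriv φ (r - t) :=
    (hφ.continuous_deriv (by simp)).comp (by fun_prop)
  have hdc := hdl.integrableOn_smul hdφ (hc.deriv.comp_homeomorph (Homeomorph.subRight t))
  have hdu' : IntegrableOn (fun r => deriv φ (r - t) • u r) (Ioi 0) :=
    (isL2Loc_of_continuousOn hu).integrableOn_smul hdφ
      (hc.deriv.comp_homeomorph (Homeomorph.subRight t))
  have h2 := congrArg (ContinuousLinearMap.apply ℝ ℝ v) (hdu.setIntegral_shift hφ hc hs ht)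
  rw [map_neg, setIntegral_clm_comm _ hdc, setIntegral_clm_comm _ hiu'] at h2
  simp only [ContinuousLinearMap.apply_apply, toDual_apply] at h2
  rw [← h2, mollify_eq_setIntegral hds u ht, inner_neg_left, real_inner_comm,
    ← innerSL_apply_apply ℝ, setIntegral_clm_comm _ hdu']
  simp only [innerSL_apply_apply, real_inner_comm]

/-- Regularizing a weak solution in time gives solutions, mode by mode, that are differentiable in
time. -/
lemma IsWeakSolution.exists_isModeFlow {μ : (Fin d → ℤ) → ℝ} {u₀ : L2Vel d ℓ} {h₀ : L2Surf d}
    {u : ℝ → L2Vel d ℓ} {h : ℝ → L2Surf d} (hsol : IsWeakSolution μ u₀ h₀ u h)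
    {φ : ℝ → ℝ} (hφ : ContDiff ℝ ∞ φ) (hc : HasCompactSupport φ) (hs : tsupport φ ⊆ Ioi 0)
    (ξ : Fin d → ℤ) :
    ∃ (U' : ℝ → L2Vel d ℓ) (W : ℝ → Hsol d ℓ) (τ : Bool → ℝ → ℝ),
      IsModeFlow ξ (μ ξ) (mollify φ u) U' W (fun k t => surfCoef ξ k (mollify φ h t)) τ := by
  obtain ⟨w, u', Mh, h', hwu, hw, hu', hdu, hh, -, hmul, hh', hdh, -, hmom, htr⟩ := hsol.weak_form
  have hcs : ∀ t, HasCompactSupport fun r => φ (r - t) := fun t =>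
    hc.comp_homeomorph (Homeomorph.subRight t)
  have hcont : ∀ t, Continuous fun r => φ (r - t) := fun t => hφ.continuous.comp (by fun_prop)
  have hiw : ∀ t, IntegrableOn (fun r => φ (r - t) • w r) (Ioi 0) := fun t =>
    hw.integrableOn_smul (hcont t) (hcs t)
  have hih' : ∀ t, IntegrableOn (fun r => φ (r - t) • h' r) (Ioi 0) := fun t =>
    hh'.integrableOn_smul (hcont t) (hcs t)
  have hih : ∀ t, IntegrableOn (fun r => φ (r - t) • h r) (Ioi 0) := fun t =>
    hh.integrableOn_smul (hcont t) (hcs t)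
  have hds : tsupport (deriv φ) ⊆ Ioi 0 := tsupport_deriv_subset.trans hs
  -- All witnesses are averages with the same kernel. Since the equations are linear with
  -- coefficients independent of time, each follows by applying a continuous linear functional under
  -- the integral.
  refine ⟨fun t => -mollify (deriv φ) u t, fun t => ∫ r in Ioi 0, φ (r - t) • w r,
    fun k t => surfCoef ξ k (∫ r in Ioi 0, φ (r - t) • h' r), ?_, ?_, ?_, ?_, ?_⟩
  · exact fun t _ => hasDerivAt_mollify hφ hc hsol.continuousOn_u t
  · intro t ht
    rw [mollify_eq_setIntegral hs u ht, ← velL_apply, setIntegral_clm_comm _ (hiw t)]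
    refine integral_congr_ae ?_
    filter_upwards [hwu] with r hr
    rw [velL_apply, hr]
  · intro t ht k
    have h1 := (surfCoef ξ k).hasFDerivAt.comp_hasDerivAt t
      (hasDerivAt_mollify hφ hc hsol.continuousOn_h t)
    rw [mollify_eq_setIntegral hds h ht, hdh.setIntegral_shift hφ hc hs ht] at h1
    exact h1
  · intro t ht k
    rw [weakTop_iff_inner]
    intro η hη h0
    set e₁ := intLp ℓ (hη.continuous_deriv (by simp))
    set e₂ := intLp ℓ hη.continuous
    let Λ : Hsol d ℓ →L[ℝ] ℝ :=
      (innerSL ℝ e₁).comp ((comp (Fin.last d)).comp ((anal ξ k).comp (velL d ℓ)))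
      + (innerSL ℝ e₂).comp ((comp (Fin.last d, Fin.last d)).comp ((anal ξ k).comp (gradL d ℓ)))
    have hΛ : ∀ v : Hsol d ℓ, inner ℝ (comp (Fin.last d) (anal ξ k (Hsol.vel v))) e₁
        + inner ℝ (comp (Fin.last d, Fin.last d) (anal ξ k (Hsol.grad v))) e₂ = Λ v := by
      intro v
      rw [real_inner_comm, real_inner_comm e₂]
      rfl
    rw [hΛ, setIntegral_clm_comm _ (hiw t), setIntegral_clm_comm _ (hih' t), ← integral_mul_const]
    refine integral_congr_ae ?_
    filter_upwards [htr] with r hr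
    rw [← hΛ, weakTop_iff_inner.1 (hr.weakTop ξ k) η hη h0, surfCoef_apply, smul_eq_mul,
      smul_eq_mul, mul_assoc]
  · intro t ht a b hm κ hκ
    set v := hm.field
    let Λ : Hsol d ℓ →L[ℝ] ℝ := (innerSL ℝ (symm _ _ (Hsol.grad v))).comp
      ((symm _ _).comp (gradL d ℓ))
    have hΛ : ∀ w : Hsol d ℓ, symGradInner w v = Λ w := by
      intro w
      rw [symGradInner_eq, real_inner_comm]
      rfl
    have h1 := inner_mollify_deriv hsol.continuousOn_u hu' hdu hφ hc hs ht v
    have h2 : ∫ r in Ioi 0, φ (r - t) • u' r v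
        = ∫ r in Ioi 0, (-(1 / 2) * (φ (r - t) • Λ (w r))
          - μ ξ * ∑ k, κ k * (φ (r - t) • surfCoef ξ k (h r))) := by
      refine integral_congr_ae ?_
      filter_upwards [hmom, hmul] with r hr1 hr2
      have h3 := hr1 v (trigLp ξ κ) (hm.isTopTrace hκ)
      rw [hΛ, integral_mul_trigLp] at h3
      simp only [hr2.surfCoef ξ, Fintype.sum_bool] at h3
      have h4 : u' r v = -(1 / 2) * Λ (w r) - μ ξ * (κ true * surfCoef ξ true (h r)
        + κ false * surfCoef ξ false (h r)) := by linarith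
      simp only [smul_eq_mul, Fintype.sum_bool, h4]
      ring
    have hiΛ : IntegrableOn (fun r => φ (r - t) • Λ (w r)) (Ioi 0) := by
      have := Λ.integrable_comp (hiw t)
      simp only [map_smul] at this
      exact this
    have hic : ∀ k, IntegrableOn (fun r => φ (r - t) • surfCoef ξ k (h r)) (Ioi 0) := fun k => by
      have := (surfCoef ξ k).integrable_comp (hih t)
      simp only [map_smul] at this
      exact this
    have h3 : symGradInner (∫ r in Ioi 0, φ (r - t) • w r) v
        = ∫ r in Ioi 0, φ (r - t) • Λ (w r) := by
      rw [hΛ, setIntegral_clm_comm _ (hiw t)]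
    have h4 : ∀ k, surfCoef ξ k (mollify φ h t)
        = ∫ r in Ioi 0, φ (r - t) • surfCoef ξ k (h r) := fun k => by
      rw [mollify_eq_setIntegral hs h ht, setIntegral_clm_comm _ (hih t)]
    simp only [h4]
    rw [h3, h1, h2, setIntegral_mul_sub_sum hiΛ hic]

/-- Exponential decay of the modes of one frequency of a weak solution. -/
lemma exists_modeEnergy_decay (hℓ : 0 < ℓ) {θ : ℝ} (hθ : 0 < θ) : ∃ c : ℝ, 0 < c ∧
    ∀ {d : ℕ} (μ : (Fin d → ℤ) → ℝ), (∀ ξ, θ ≤ μ ξ) → ∀ (u₀ : L2Vel d ℓ) (h₀ : L2Surf d)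
      (u : ℝ → L2Vel d ℓ) (h : ℝ → L2Surf d), IsWeakSolution μ u₀ h₀ u h →
      ∀ (ξ : Fin d → ℤ) (t : ℝ), 0 ≤ t →
      modeEnergy ξ (μ ξ) (u t) (fun k => surfCoef ξ k (h t)) ≤
        3 * Real.exp (-(c / (1 + freqNorm ξ / μ ξ)) * t) *
          modeEnergy ξ (μ ξ) u₀ (fun k => surfCoef ξ k h₀) := by
  obtain ⟨c, hc, hdec⟩ := exists_decay_rate hℓ hθ
  refine ⟨c, hc, fun {d} μ hμ u₀ h₀ u h hsol ξ t ht => ?_⟩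
  obtain ⟨φ, ε, hε, hφ⟩ := exists_mollifier
  have hu : ∀ t, 0 ≤ t → Tendsto (fun n => mollify (φ n) u t) atTop (𝓝 (u t)) := fun t ht =>
    tendsto_mollify hε (fun n => (hφ n).2.2.2.1) (fun n => (hφ n).2.2.2.2.1)
      (fun n => (hφ n).2.2.2.2.2) hsol.continuousOn_u ht
  have hh : ∀ t, 0 ≤ t → Tendsto (fun n => mollify (φ n) h t) atTop (𝓝 (h t)) := fun t ht =>
    tendsto_mollify hε (fun n => (hφ n).2.2.2.1) (fun n => (hφ n).2.2.2.2.1)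
      (fun n => (hφ n).2.2.2.2.2) hsol.continuousOn_h ht
  have hE : ∀ t, 0 ≤ t → Tendsto (fun n => modeEnergy ξ (μ ξ) (mollify (φ n) u t)
      (fun k => surfCoef ξ k (mollify (φ n) h t))) atTop
      (𝓝 (modeEnergy ξ (μ ξ) (u t) (fun k => surfCoef ξ k (h t)))) := by
    intro t ht
    refine ((tendsto_finsetSum _ fun k _ => ?_).const_mul _).add
      (((tendsto_finsetSum _ fun k _ => ?_).const_mul _).const_mul _)
    · exact (((anal ξ k).continuous.tendsto _).comp (hu t ht)).norm.pow 2
    · exact (((surfCoef ξ k).continuous.tendsto _).comp (hh t ht)).pow 2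
  have h0 := hE 0 le_rfl
  rw [hsol.initial_u, hsol.initial_h] at h0
  refine le_of_tendsto_of_tendsto' (hE t ht) (h0.const_mul _) fun n => ?_
  obtain ⟨h1, h2, h3, -⟩ := hφ n
  obtain ⟨U', W, τ, hflow⟩ := hsol.exists_isModeFlow h1 h2 h3 ξ
  -- It remains to check that the averaged height has no mode at `ξ = 0`, which follows from the
  -- zero mean of `h`.
  refine hdec ξ (μ ξ) (hμ ξ) _ _ _ _ _ hflow (fun hξ s hs k => ?_) t ht
  subst hξ
  have hi : IntegrableOn (fun r => φ n (r - s) • h r) (Ioi 0) :=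
    (isL2Loc_of_continuousOn hsol.continuousOn_h).integrableOn_smul
      (h1.continuous.comp (by fun_prop)) (h2.comp_homeomorph (Homeomorph.subRight s))
  rw [mollify_eq_setIntegral h3 h hs, setIntegral_clm_comm _ hi]
  refine integral_eq_zero_of_ae ?_
  filter_upwards [ae_restrict_mem measurableSet_Ioi] with r hr
  rw [surfCoef_zero_freq (hsol.zero_average r (le_of_lt hr)), smul_zero]
  rfl

end ViscousSlab
end

noncomputable section

namespace ViscousSlab

variable {d : ℕ} {ℓ : ℝ}

/-! ### Parseval identities -/

lemma lintegral_ofReal_norm_sq {X E : Type*} [MeasurableSpace X] {m : Measure X}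
    [NormedAddCommGroup E] [InnerProductSpace ℝ E] (f : Lp E 2 m) :
    ∫⁻ x, ENNReal.ofReal (‖f x‖ ^ 2) ∂m = ENNReal.ofReal (‖f‖ ^ 2) := by
  have h : Integrable (fun x => ‖f x‖ ^ 2) m := (Lp.memLp f).integrable_norm_pow (by norm_num)
  rw [← ofReal_integral_eq_lintegral_ofReal h (ae_of_all _ fun x => sq_nonneg _),
    ← real_inner_self_eq_norm_sq, L2.inner_def]
  simp only [real_inner_self_eq_norm_sq]

/-- Parseval's identity on the torus. -/
lemma tsum_norm_surfFourier_sq {f : UnitAddTorus (Fin d) → ℝ} (hf : MemLp f 2 (torusMeasure d)) :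
    ∑' ξ, ENNReal.ofReal (‖surfFourier f ξ‖ ^ 2)
      = ∫⁻ x, ENNReal.ofReal (f x ^ 2) ∂(torusMeasure d) := by
  have hF : MemLp (fun x => (f x : ℂ)) 2 (torusMeasure d) := hf.ofReal
  have h1 : HasSum (fun ξ => ‖UnitAddTorus.mFourierCoeff (hF.toLp _) ξ‖ ^ 2)
      (∫ x, ‖hF.toLp _ x‖ ^ 2 ∂(torusMeasure d)) :=
    UnitAddTorus.hasSum_sq_mFourierCoeff (hF.toLp _)
  have h2 : ∀ ξ, UnitAddTorus.mFourierCoeff (hF.toLp _) ξ = surfFourier f ξ := fun ξ =>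
    integral_congr_ae (μ := torusMeasure d) (by
      filter_upwards [hF.coeFn_toLp] with x hx
      rw [hx])
  have h3 : ∫ x, ‖hF.toLp _ x‖ ^ 2 ∂(torusMeasure d) = ∫ x, f x ^ 2 ∂(torusMeasure d) := by
    refine integral_congr_ae ?_
    filter_upwards [hF.coeFn_toLp] with x hx
    rw [hx]
    simp
  simp only [h2, h3] at h1
  rw [← ENNReal.ofReal_tsum_of_nonneg (fun ξ => sq_nonneg _) h1.summable, h1.tsum_eq,
    ofReal_integral_eq_lintegral_ofReal hf.integrable_sq (ae_of_all _ fun x => sq_nonneg _)]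

/-- The analysis operator computes the real Fourier coefficients on horizontal slices. -/
lemma comp_anal_ae (ξ : Fin d → ℤ) (k : Bool) (u : L2Vel d ℓ) (j : Fin (d + 1)) :
    comp j (anal ξ k u) =ᵐ[(volume : Measure ℝ).restrict (Ioo 0 ℓ)]
      fun y => ∫ x, u (x, y) j * trig ξ k x ∂(torusMeasure d) := by
  have hi : Integrable (fun z : Slab d => u z j * trig ξ k z.1) (slabMeasure d ℓ) :=
    integrable_coord_mul u j ((continuous_trig ξ k).comp continuous_fst)
  have hg : IntegrableOn (fun y => ∫ x, u (x, y) j * trig ξ k x ∂(torusMeasure d)) (Ioo 0 ℓ) :=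
    Integrable.integral_prod_right hi
  have ha : IntegrableOn (comp j (anal ξ k u)) (Ioo 0 ℓ) :=
    (Lp.memLp (comp j (anal ξ k u))).integrable (by norm_num)
  have h0 : ∀ᵐ y, y ∈ Ioo 0 ℓ → comp j (anal ξ k u) y
      - ∫ x, u (x, y) j * trig ξ k x ∂(torusMeasure d) = 0 := by
    refine isOpen_Ioo.ae_eq_zero_of_integral_contDiff_smul_eq_zero
      (ha.sub hg).locallyIntegrableOn fun η h1 h2 h3 => ?_
    have hs : ∀ y, y ∉ Ioo 0 ℓ → η y • (comp j (anal ξ k u) y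
        - ∫ x, u (x, y) j * trig ξ k x ∂(torusMeasure d)) = 0 := fun y hy => by
      rw [image_eq_zero_of_notMem_tsupport fun hh => hy (h3 hh), zero_smul]
    rw [← setIntegral_eq_integral_of_forall_compl_eq_zero hs]
    have hc : Continuous fun z : Slab d => trig ξ k z.1 * η z.2 :=
      ((continuous_trig ξ k).comp continuous_fst).mul (h1.continuous.comp continuous_snd)
    have hi2 := integrable_coord_mul u j hc
    have h4 : ∫ z, u z j * (trig ξ k z.1 * η z.2) ∂(slabMeasure d ℓ) = ∫ y in Ioo 0 ℓ,
        (∫ x, u (x, y) j * trig ξ k x ∂(torusMeasure d)) * η y := by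
      refine (integral_prod_symm _ hi2).trans (integral_congr_ae (ae_of_all _ fun y => ?_))
      simp only
      rw [← integral_mul_const]
      simp only [mul_assoc]
    have h5 : IntegrableOn (fun y => (∫ x, u (x, y) j * trig ξ k x ∂(torusMeasure d)) * η y)
        (Ioo 0 ℓ) := by
      refine (Integrable.integral_prod_right hi2).congr (ae_of_all _ fun y => ?_)
      simp only
      rw [← integral_mul_const]
      simp only [mul_assoc]
    have h6 := integral_anal_comp_mul ξ k u j h1.continuous
    rw [h4, ← sub_eq_zero, ← integral_sub (integrable_mul_int _ h1.continuous) h5] at h6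
    refine Eq.trans (integral_congr_ae (ae_of_all _ fun y => ?_)) h6
    simp only [smul_eq_mul]
    ring
  rw [EventuallyEq, ae_restrict_iff' measurableSet_Ioo]
  filter_upwards [h0] with y hy hm
  exact sub_eq_zero.1 (hy hm)

/-- The Fourier coefficients of almost every horizontal slice. -/
lemma sum_norm_surfFourier_slice_sq (u : L2Vel d ℓ) :
    ∀ᵐ y ∂((volume : Measure ℝ).restrict (Ioo 0 ℓ)), ∀ ξ : Fin d → ℤ,
      ∑ j : Fin (d + 1), ‖surfFourier (fun x => u (x, y) j) ξ‖ ^ 2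
        = ∑ k, ‖anal ξ k u y‖ ^ 2 := by
  refine ae_all_iff.2 fun ξ => ?_
  have h1 : ∀ᵐ y ∂((volume : Measure ℝ).restrict (Ioo 0 ℓ)), ∀ (j : Fin (d + 1)) (k : Bool),
      Integrable (fun x => u (x, y) j * trig ξ k x) (torusMeasure d) :=
    ae_all_iff.2 fun j => ae_all_iff.2 fun k =>
      (integrable_coord_mul u j ((continuous_trig ξ k).comp continuous_fst)).prod_left_ae
  have h2 : ∀ᵐ y ∂((volume : Measure ℝ).restrict (Ioo 0 ℓ)), ∀ (j : Fin (d + 1)) (k : Bool),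
      anal ξ k u y j = ∫ x, u (x, y) j * trig ξ k x ∂(torusMeasure d) :=
    ae_all_iff.2 fun j => ae_all_iff.2 fun k =>
      (coeFn_comp j (anal ξ k u)).symm.trans (comp_anal_ae ξ k u j)
  filter_upwards [h1, h2] with y a b
  simp only [Fintype.sum_bool, EuclideanSpace.real_norm_sq_eq, b]
  rw [← Finset.sum_add_distrib]
  refine Finset.sum_congr rfl fun j _ => ?_
  rw [surfFourier_eq ξ (a j), norm_sub_mul_I_sq, add_comm]

lemma aemeasurable_norm_anal_sq (ξ : Fin d → ℤ) (u : L2Vel d ℓ) :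
    AEMeasurable (fun y => ∑ k, ‖anal ξ k u y‖ ^ 2) ((volume : Measure ℝ).restrict (Ioo 0 ℓ)) :=
  Finset.aemeasurable_fun_sum _ fun k _ =>
    ((Lp.aestronglyMeasurable (anal ξ k u)).norm.aemeasurable).pow_const 2

/-- Tonelli exchanges the frequency sum with the integral in `y`, once the slice coefficients are
identified with the profiles from `anal`. -/
lemma slabSobolevSq_eq (s : ℝ) (u : L2Vel d ℓ) :
    slabSobolevSq s u = ∑' ξ : Fin d → ℤ, ENNReal.ofReal ((1 + freqNorm ξ ^ 2) ^ s *
      ∑ k, ‖anal ξ k u‖ ^ 2) := by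
  have h1 : slabSobolevSq s u = ∫⁻ y in Ioo 0 ℓ, ∑' ξ : Fin d → ℤ,
      ENNReal.ofReal ((1 + freqNorm ξ ^ 2) ^ s * ∑ k, ‖anal ξ k u y‖ ^ 2) := by
    refine lintegral_congr_ae ?_
    filter_upwards [sum_norm_surfFourier_slice_sq u] with y hy
    simp only [hy]
  rw [h1, lintegral_tsum fun ξ => ((aemeasurable_norm_anal_sq ξ u).const_mul _).ennreal_ofReal]
  refine tsum_congr fun ξ => ?_
  have hp : (0 : ℝ) ≤ (1 + freqNorm ξ ^ 2) ^ s := by positivity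
  simp only [ENNReal.ofReal_mul hp]
  rw [lintegral_const_mul' _ _ ENNReal.ofReal_ne_top]
  congr 1
  simp only [ENNReal.ofReal_sum_of_nonneg fun k _ => sq_nonneg _]
  rw [lintegral_finsetSum' _ fun k _ =>
    (((Lp.aestronglyMeasurable (anal ξ k u)).norm.aemeasurable).pow_const 2).ennreal_ofReal]
  exact Finset.sum_congr rfl fun k _ => lintegral_ofReal_norm_sq _

/-- Parseval's identity on the slab. -/
lemma ofReal_integral_norm_sq (u : L2Vel d ℓ) :
    ENNReal.ofReal (∫ z, ‖u z‖ ^ 2 ∂(slabMeasure d ℓ))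
      = ∑' ξ : Fin d → ℤ, ENNReal.ofReal (∑ k, ‖anal ξ k u‖ ^ 2) := by
  -- With weight exponent `0` the sum over modes is an integral of slice sums, to which Parseval on
  -- the torus applies for almost every height.
  have h0 := slabSobolevSq_eq 0 u
  simp only [Real.rpow_zero, one_mul] at h0
  rw [← h0]
  have hi : Integrable (fun z => ‖u z‖ ^ 2) (slabMeasure d ℓ) :=
    (Lp.memLp u).integrable_norm_pow (by norm_num)
  rw [ofReal_integral_eq_lintegral_ofReal hi (ae_of_all _ fun z => sq_nonneg _)]
  refine (lintegral_prod_symm _ hi.aestronglyMeasurable.aemeasurable.ennreal_ofReal).trans ?_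
  refine lintegral_congr_ae ?_
  have hj : ∀ j : Fin (d + 1), MemLp (fun z => u z j) 2 (slabMeasure d ℓ) := fun j =>
    (EuclideanSpace.proj (𝕜 := ℝ) j : EuclideanSpace ℝ (Fin (d + 1)) →L[ℝ] ℝ).comp_memLp'
      (Lp.memLp u)
  have h1 : ∀ᵐ y ∂((volume : Measure ℝ).restrict (Ioo 0 ℓ)), ∀ j : Fin (d + 1),
      MemLp (fun x => u (x, y) j) 2 (torusMeasure d) := by
    refine ae_all_iff.2 fun j => ?_
    have h2 : ∀ᵐ y ∂((volume : Measure ℝ).restrict (Ioo 0 ℓ)),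
        Integrable (fun x => u (x, y) j ^ 2) (torusMeasure d) := (hj j).integrable_sq.prod_left_ae
    have h3 : ∀ᵐ y ∂((volume : Measure ℝ).restrict (Ioo 0 ℓ)),
        Integrable (fun x => u (x, y) j) (torusMeasure d) :=
      ((hj j).integrable (by norm_num)).prod_left_ae
    filter_upwards [h2, h3] with y a b
    exact (memLp_two_iff_integrable_sq b.aestronglyMeasurable).2 a
  filter_upwards [h1] with y hy
  simp only [Real.rpow_zero, one_mul, EuclideanSpace.real_norm_sq_eq,
    ENNReal.ofReal_sum_of_nonneg fun _ _ => sq_nonneg _]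
  rw [lintegral_finsetSum' _ fun j _ =>
    ((hy j).aestronglyMeasurable.aemeasurable.pow_const 2).ennreal_ofReal]
  simp only [← tsum_norm_surfFourier_sq (hy _)]
  exact (Summable.tsum_finsetSum fun _ _ => ENNReal.summable).symm

lemma energy_eq_tsum {μ : (Fin d → ℤ) → ℝ} (hμ : ∀ ξ, 0 ≤ μ ξ) (u : L2Vel d ℓ) (h : L2Surf d) :
    energy μ u h = ∑' ξ, ENNReal.ofReal (modeEnergy ξ (μ ξ) u (fun k => surfCoef ξ k h)) := by
  rw [energy, ENNReal.ofReal_mul (by norm_num), ofReal_integral_norm_sq, ← ENNReal.tsum_mul_left,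
    ← ENNReal.tsum_add]
  refine tsum_congr fun ξ => ?_
  have h2 : 0 ≤ μ ξ * ∑ k, surfCoef ξ k h ^ 2 :=
    mul_nonneg (hμ ξ) (Finset.sum_nonneg fun _ _ => sq_nonneg _)
  rw [norm_surfFourier_sq, ← ENNReal.ofReal_mul (by norm_num),
    ← ENNReal.ofReal_add (by positivity) (by positivity), modeEnergy]

/-- The initial energy of all modes, with the Sobolev weight. -/
lemma tsum_weighted_modeEnergy_le {θ s : ℝ} (hθ : 0 < θ) {μ : (Fin d → ℤ) → ℝ}
    (hμ : SymbolBound θ μ) (u : L2Vel d ℓ) (h : L2Surf d) :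
    ∑' ξ, ENNReal.ofReal ((1 + freqNorm ξ ^ 2) ^ s *
        modeEnergy ξ (μ ξ) u (fun k => surfCoef ξ k h)) ≤
      ENNReal.ofReal (1 + 4 / θ) * (slabSobolevSq s u + surfSobolevSq (s + 3) h) := by
  rw [slabSobolevSq_eq, surfSobolevSq, ← ENNReal.tsum_add, ← ENNReal.tsum_mul_left]
  refine ENNReal.tsum_le_tsum fun ξ => ?_
  have hq : 0 ≤ ∑ k, surfCoef ξ k h ^ 2 := Finset.sum_nonneg fun _ _ => sq_nonneg _
  have hp : 0 ≤ ∑ k, ‖anal ξ k u‖ ^ 2 := Finset.sum_nonneg fun _ _ => sq_nonneg _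
  rw [norm_surfFourier_sq, ← ENNReal.ofReal_add (by positivity) (by positivity),
    ← ENNReal.ofReal_mul (by positivity)]
  refine ENNReal.ofReal_le_ofReal ?_
  have hR := freqNorm_nonneg ξ
  set R := freqNorm ξ
  set q := ∑ k, surfCoef ξ k h ^ 2
  set p := ∑ k, ‖anal ξ k u‖ ^ 2
  -- The cubic bound on the symbol is absorbed by the three extra powers in the weight for `h₀`.
  have h1 : (1 + R) ^ 3 ≤ 8 * (1 + R ^ 2) ^ 3 := by
    have : 1 + R ≤ 2 * (1 + R ^ 2) := by nlinarith [sq_nonneg (R - 1)]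
    calc (1 + R) ^ 3 ≤ (2 * (1 + R ^ 2)) ^ 3 := by gcongr
      _ = _ := by ring
  have h2 : μ ξ ≤ 8 / θ * (1 + R ^ 2) ^ 3 := by
    refine (hμ ξ).2.trans ?_
    calc 1 / θ * (1 + R) ^ 3 ≤ 1 / θ * (8 * (1 + R ^ 2) ^ 3) := by gcongr
      _ = _ := by ring
  have h3 : (1 + R ^ 2) ^ (s + 3) = (1 + R ^ 2) ^ s * (1 + R ^ 2) ^ 3 := by
    rw [Real.rpow_add (by positivity)]
    norm_cast
  rw [modeEnergy, h3]
  have hA : 0 < (1 + R ^ 2) ^ s := by positivity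
  set A := (1 + R ^ 2) ^ s
  calc A * (1 / 2 * p + 1 / 2 * (μ ξ * q))
      ≤ A * (1 / 2 * p + 1 / 2 * (8 / θ * (1 + R ^ 2) ^ 3 * q)) := by gcongr
    _ = 1 / 2 * (A * p) + 4 / θ * (A * (1 + R ^ 2) ^ 3 * q) := by ring
    _ ≤ (1 + 4 / θ) * (A * p) + (1 + 4 / θ) * (A * (1 + R ^ 2) ^ 3 * q) := by
        have : 0 < 4 / θ := by positivity
        gcongr <;> linarith
    _ = _ := by ring

end ViscousSlab
end

noncomputable section

namespace ViscousSlab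

/-! ### From the decay of modes to the decay of the energy -/

/-- Multiplying and dividing by `(1 + |ξ|²)^s` leaves the weighted initial energy, which the data
control, times an exponential whose exponent is bounded by `-b` uniformly in `ξ`. -/
lemma exists_energy_le {ℓ θ : ℝ} (hℓ : 0 < ℓ) (hθ : 0 < θ) (s : ℝ) : ∃ c : ℝ, 0 < c ∧
    ∀ {d : ℕ} (μ : (Fin d → ℤ) → ℝ), SymbolBound θ μ → ∀ (u₀ : L2Vel d ℓ) (h₀ : L2Surf d)
      (u : ℝ → L2Vel d ℓ) (h : ℝ → L2Surf d), IsWeakSolution μ u₀ h₀ u h → ∀ t b : ℝ, 0 ≤ t →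
      (∀ ξ, b ≤ c / (1 + freqNorm ξ / μ ξ) * t + s * Real.log (1 + freqNorm ξ ^ 2)) →
      energy μ (u t) (h t) ≤ ENNReal.ofReal (3 * (1 + 4 / θ) * Real.exp (-b)) *
        (slabSobolevSq s u₀ + surfSobolevSq (s + 3) h₀) := by
  obtain ⟨c, hc, hdec⟩ := exists_modeEnergy_decay hℓ hθ
  refine ⟨c, hc, fun {d} μ hμ u₀ h₀ u h hsol t b ht hb => ?_⟩
  have hμ0 : ∀ ξ, 0 ≤ μ ξ := fun ξ => hθ.le.trans (hμ ξ).1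
  have h1 : energy μ (u t) (h t) ≤ ∑' ξ, ENNReal.ofReal (3 * Real.exp (-b)) *
      ENNReal.ofReal ((1 + freqNorm ξ ^ 2) ^ s *
        modeEnergy ξ (μ ξ) u₀ (fun k => surfCoef ξ k h₀)) := by
    rw [energy_eq_tsum hμ0]
    refine ENNReal.tsum_le_tsum fun ξ => ?_
    rw [← ENNReal.ofReal_mul (by positivity)]
    refine ENNReal.ofReal_le_ofReal
      ((hdec μ (fun ξ => (hμ ξ).1) u₀ h₀ u h hsol ξ t ht).trans ?_)
    have hE : 0 ≤ modeEnergy ξ (μ ξ) u₀ (fun k => surfCoef ξ k h₀) := by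
      have := hμ0 ξ
      unfold modeEnergy
      have h2 : 0 ≤ ∑ k, surfCoef ξ k h₀ ^ 2 := Finset.sum_nonneg fun _ _ => sq_nonneg _
      positivity
    rw [← mul_assoc]
    refine mul_le_mul_of_nonneg_right ?_ hE
    rw [Real.rpow_def_of_pos (by positivity), mul_assoc, ← Real.exp_add]
    have := hb ξ
    gcongr
    linarith
  refine h1.trans ?_
  rw [ENNReal.tsum_mul_left]
  refine (mul_le_mul_right (tsum_weighted_modeEnergy_le hθ hμ u₀ h₀) _).trans (le_of_eq ?_)
  rw [← mul_assoc, ← ENNReal.ofReal_mul (by positivity)]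
  congr 2
  ring

/-! ### Balancing the modal decay rate against the Sobolev weight. -/

lemma rate_mul_ge {c a q t F : ℝ} (hc : 0 < c) (ha : 0 < a) (hq : 0 ≤ q) (ht : 0 ≤ t) (hF : 1 ≤ F)
    (h : q ≤ F / a) : c / (1 + 1 / a) * (t / F) ≤ c / (1 + q) * t := by
  have h1 : 1 + q ≤ (1 + 1 / a) * F := by
    calc 1 + q ≤ F + F / a := add_le_add hF h
      _ = _ := by ring
  calc c / (1 + 1 / a) * (t / F) = c / ((1 + 1 / a) * F) * t := by
        field_simp
    _ ≤ c / (1 + q) * t := by gcongr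

lemma div_le_of_eq_add_mul_div {g a R m F : ℝ} (hg : 0 < g) (ha : 0 < a) (hR : 0 < R) (hF : 0 < F)
    (h : m = g + a * (R / F)) : R / m ≤ F / a := by
  have h1 : a * (R / F) ≤ m := by linarith
  calc R / m ≤ R / (a * (R / F)) := by gcongr
    _ = F / a := by field_simp

lemma two_mul_log_le {R : ℝ} (hR : 0 < R) : 2 * Real.log R ≤ Real.log (1 + R ^ 2) := by
  have h : Real.log (R ^ 2) = 2 * Real.log R := by simp [Real.log_pow]
  rw [← h]
  exact Real.log_le_log (by positivity) (by linarith)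

/-- Above the threshold `log R = t^p` the weight gives `2s t^p`; below it the rate gives a multiple
of `t/t^(pα)`. The two powers agree exactly when `p = 1/(1 + α)`. -/
lemma exists_exponent_log {c g a θ s α : ℝ} (hc : 0 < c) (hg : 0 < g) (ha : 0 < a) (hθ : 0 < θ)
    (hs : 0 < s) (hα : 0 < α) : ∃ C : ℝ, 0 < C ∧ ∀ R m t : ℝ, 0 ≤ R → θ ≤ m → 0 ≤ t →
      (1 < R → m = g + a * (R / Real.log R ^ α)) →
      C * t ^ (1 / (1 + α)) - C ≤ c / (1 + R / m) * t + s * Real.log (1 + R ^ 2) := by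
  set C := min (c / (1 + 1 / θ)) (min (2 * s) (c / (1 + 1 / a))) with hC
  have hC0 : 0 < C := lt_min (by positivity) (lt_min (by positivity) (by positivity))
  have hC1 : C ≤ c / (1 + 1 / θ) := min_le_left _ _
  have hC2 : C ≤ 2 * s := (min_le_right _ _).trans (min_le_left _ _)
  have hC3 : C ≤ c / (1 + 1 / a) := (min_le_right _ _).trans (min_le_right _ _)
  refine ⟨C, hC0, fun R m t hR hm ht hsym => ?_⟩
  have hm0 : 0 < m := hθ.trans_le hm
  have hq : 0 ≤ R / m := by positivity
  have hrate : 0 ≤ c / (1 + R / m) * t := by positivity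
  have hlog : 0 ≤ s * Real.log (1 + R ^ 2) :=
    mul_nonneg hs.le (Real.log_nonneg (by nlinarith))
  set p := 1 / (1 + α) with hp
  have hp0 : 0 < p := by positivity
  have hp1 : p ≤ 1 := by rw [hp, div_le_one (by positivity)]; linarith
  -- For `t ≤ 1` the subtracted `C` makes the left side nonpositive.
  rcases le_total t 1 with ht1 | ht1
  · have := mul_le_mul_of_nonneg_left (Real.rpow_le_one ht ht1 hp0.le) hC0.le
    linarith
  have ht0 : 0 < t := zero_lt_one.trans_le ht1
  have htp : 0 ≤ t ^ p := by positivity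
  rcases le_or_gt R 1 with hR1 | hR1
  · have h1 : t ^ p ≤ t := by simpa using Real.rpow_le_rpow_of_exponent_le ht1 hp1
    have h2 : R / m ≤ 1 / θ := by gcongr
    have h3 : c / (1 + 1 / θ) * t ≤ c / (1 + R / m) * t := by gcongr
    have h4 : C * t ^ p ≤ c / (1 + 1 / θ) * t := by gcongr
    linarith
  have hL : 0 < Real.log R := Real.log_pos hR1
  have hlog2 := mul_le_mul_of_nonneg_left (two_mul_log_le (zero_lt_one.trans hR1)) hs.le
  rcases le_total (t ^ p) (Real.log R) with h | h
  · have h1 : C * t ^ p ≤ 2 * s * Real.log R := by gcongr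
    linarith
  · have h1 := div_le_of_eq_add_mul_div hg ha (zero_lt_one.trans hR1)
      (Real.rpow_pos_of_pos hL α) (hsym hR1)
    have h2 : Real.log R ^ α ≤ (t ^ p) ^ α := Real.rpow_le_rpow hL.le h hα.le
    have h3 := rate_mul_ge (F := (t ^ p) ^ α) hc ha hq ht
      (Real.one_le_rpow (Real.one_le_rpow ht1 hp0.le) hα.le) (h1.trans (by gcongr))
    have h4 : t / (t ^ p) ^ α = t ^ p := by
      have h5 : t ^ p * (t ^ p) ^ α = t := by
        rw [← Real.rpow_mul ht, ← Real.rpow_add ht0]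
        have : p + p * α = 1 := by rw [hp]; field_simp
        rw [this, Real.rpow_one]
      rw [div_eq_iff (by positivity), h5]
    rw [h4] at h3
    have h5 : C * t ^ p ≤ c / (1 + 1 / a) * t ^ p := by gcongr
    linarith

/-- The threshold is now `log R = t`: above it the weight gives `2s t`, below it `log log R ≤ log t`
and the rate loses only the factor `(log t)^α`. -/
lemma exists_exponent_loglog {c g a θ s α : ℝ} (hc : 0 < c) (hg : 0 < g) (ha : 0 < a) (hθ : 0 < θ)
    (hs : 0 < s) (hα : 0 < α) : ∃ C : ℝ, 0 < C ∧ ∀ t₀ : ℝ, 1 < t₀ → ∃ D : ℝ, ∀ R m t : ℝ,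
      0 ≤ R → θ ≤ m → t₀ ≤ t →
      (Real.exp 1 < R → m = g + a * (R / Real.log (Real.log R) ^ α)) →
      C * (t / Real.log t ^ α) - D ≤ c / (1 + R / m) * t + s * Real.log (1 + R ^ 2) := by
  set C := min (c / (1 + Real.exp 1 / θ)) (min (2 * s) (c / (1 + 1 / a))) with hC
  have hC0 : 0 < C := lt_min (by positivity) (lt_min (by positivity) (by positivity))
  have hC1 : C ≤ c / (1 + Real.exp 1 / θ) := min_le_left _ _
  have hC2 : C ≤ 2 * s := (min_le_right _ _).trans (min_le_left _ _)
  have hC3 : C ≤ c / (1 + 1 / a) := (min_le_right _ _).trans (min_le_right _ _)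
  refine ⟨C, hC0, fun t₀ ht₀ => ⟨C * (Real.exp 1 / Real.log t₀ ^ α),
    fun R m t hR hm htt hsym => ?_⟩⟩
  have hm0 : 0 < m := hθ.trans_le hm
  have ht1 : 1 < t := ht₀.trans_le htt
  have ht : 0 < t := zero_lt_one.trans ht1
  have hq : 0 ≤ R / m := by positivity
  have hrate : 0 ≤ c / (1 + R / m) * t := by positivity
  have hlog : 0 ≤ s * Real.log (1 + R ^ 2) :=
    mul_nonneg hs.le (Real.log_nonneg (by nlinarith))
  have hl₀ : 0 < Real.log t₀ := Real.log_pos ht₀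
  have hD : 0 ≤ C * (Real.exp 1 / Real.log t₀ ^ α) := by positivity
  -- Between `t₀` and `e` the quantity `t/(log t)^α` is at most `e/(log t₀)^α`, since `log t` is
  -- bounded away from zero by `log t₀`. This fixes `D`, the only constant that depends on `t₀`.
  rcases le_total t (Real.exp 1) with hte | hte
  · have h1 : Real.log t₀ ≤ Real.log t := Real.log_le_log (by linarith) htt
    have h2 : C * (t / Real.log t ^ α) ≤ C * (Real.exp 1 / Real.log t₀ ^ α) := by gcongr
    linarith
  have hlt : 1 ≤ Real.log t := (Real.le_log_iff_exp_le ht).2 hte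
  have hF : 1 ≤ Real.log t ^ α := Real.one_le_rpow hlt hα.le
  have hF0 : 0 ≤ t / Real.log t ^ α := by positivity
  have htF : t / Real.log t ^ α ≤ t := div_le_self ht.le hF
  rcases le_or_gt R (Real.exp 1) with hR1 | hR1
  · have h2 : R / m ≤ Real.exp 1 / θ := by gcongr
    have h3 : c / (1 + Real.exp 1 / θ) * t ≤ c / (1 + R / m) * t := by gcongr
    have h4 : C * (t / Real.log t ^ α) ≤ c / (1 + Real.exp 1 / θ) * t := by gcongr
    linarith
  have hR0 : 0 < R := (Real.exp_pos 1).trans hR1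
  have hL : 1 < Real.log R := (Real.lt_log_iff_exp_lt hR0).2 hR1
  have hLL : 0 < Real.log (Real.log R) := Real.log_pos hL
  have hlog2 := mul_le_mul_of_nonneg_left (two_mul_log_le hR0) hs.le
  rcases le_total t (Real.log R) with h | h
  · have h1 : C * (t / Real.log t ^ α) ≤ 2 * s * Real.log R := by
      have := htF.trans h
      gcongr
    linarith
  · have h1 := div_le_of_eq_add_mul_div hg ha hR0 (Real.rpow_pos_of_pos hLL α) (hsym hR1)
    have h2 : Real.log (Real.log R) ≤ Real.log t := Real.log_le_log (by linarith) h
    have h3 := rate_mul_ge (F := Real.log t ^ α) hc ha hq ht.le hF (h1.trans (by gcongr))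
    have h4 : C * (t / Real.log t ^ α) ≤ c / (1 + 1 / a) * (t / Real.log t ^ α) := by gcongr
    linarith

end ViscousSlab
end

/-! ### The two decay estimates. -/

theorem theorem4p4 (d : ℕ) (hd : 1 ≤ d) (ℓ g σ θ s α : ℝ) (hℓ : 0 < ℓ) (hg : 0 < g) (hσ : 0 < σ)
    (hθ : 0 < θ) (hs : 0 < s) (hα : 0 < α) :
    (∃ K C : ℝ, 0 < K ∧ 0 < C ∧
      ∀ μ : (Fin d → ℤ) → ℝ, ViscousSlab.SymbolBound θ μ →
        (∀ ξ, 1 < ViscousSlab.freqNorm ξ → μ ξ = g + 2 * Real.pi * σ *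
          (ViscousSlab.freqNorm ξ / Real.log (ViscousSlab.freqNorm ξ) ^ α)) →
        ∀ (u₀ : ViscousSlab.L2Vel d ℓ) (h₀ : ViscousSlab.L2Surf d)
          (u : ℝ → ViscousSlab.L2Vel d ℓ) (h : ℝ → ViscousSlab.L2Surf d),
          ViscousSlab.IsWeakSolution μ u₀ h₀ u h →
          ViscousSlab.slabSobolevSq s u₀ < ⊤ → ViscousSlab.surfSobolevSq (s + 3) h₀ < ⊤ →
          ∀ t : ℝ, 0 ≤ t →
            ViscousSlab.energy μ (u t) (h t) ≤
              ENNReal.ofReal (K * Real.exp (-C * t ^ (1 / (1 + α)))) *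
                (ViscousSlab.slabSobolevSq s u₀ + ViscousSlab.surfSobolevSq (s + 3) h₀)) ∧
    (∃ C : ℝ, 0 < C ∧ ∀ t₀ : ℝ, 1 < t₀ → ∃ K : ℝ, 0 < K ∧
      ∀ μ : (Fin d → ℤ) → ℝ, ViscousSlab.SymbolBound θ μ →
        (∀ ξ, Real.exp 1 < ViscousSlab.freqNorm ξ → μ ξ = g + 2 * Real.pi * σ *
          (ViscousSlab.freqNorm ξ /
            Real.log (Real.log (ViscousSlab.freqNorm ξ)) ^ α)) →
        ∀ (u₀ : ViscousSlab.L2Vel d ℓ) (h₀ : ViscousSlab.L2Surf d)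
          (u : ℝ → ViscousSlab.L2Vel d ℓ) (h : ℝ → ViscousSlab.L2Surf d),
          ViscousSlab.IsWeakSolution μ u₀ h₀ u h →
          ViscousSlab.slabSobolevSq s u₀ < ⊤ → ViscousSlab.surfSobolevSq (s + 3) h₀ < ⊤ →
          ∀ t : ℝ, t₀ ≤ t →
            ViscousSlab.energy μ (u t) (h t) ≤
              ENNReal.ofReal (K * Real.exp (-C * (t / Real.log t ^ α))) *
                (ViscousSlab.slabSobolevSq s u₀ + ViscousSlab.surfSobolevSq (s + 3) h₀)) := by
  have ha : 0 < 2 * Real.pi * σ := by positivity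
  obtain ⟨c, hc, hen⟩ := ViscousSlab.exists_energy_le hℓ hθ s
  refine ⟨?_, ?_⟩
  · obtain ⟨C, hC, hexp⟩ := ViscousSlab.exists_exponent_log hc hg ha hθ hs hα
    -- The factor `exp C` compensates the constant subtracted from the exponent; `exp D` plays the
    -- same role in the second part.
    refine ⟨3 * (1 + 4 / θ) * Real.exp C, C, by positivity, hC,
      fun μ hμ hsym u₀ h₀ u h hsol _ _ t ht => ?_⟩
    refine (hen μ hμ u₀ h₀ u h hsol t (C * t ^ (1 / (1 + α)) - C) ht fun ξ =>
      hexp _ _ t (ViscousSlab.freqNorm_nonneg ξ) (hμ ξ).1 ht (hsym ξ)).trans (le_of_eq ?_)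
    rw [mul_assoc _ (Real.exp C), ← Real.exp_add]
    congr 4
    ring
  · obtain ⟨C, hC, hexp⟩ := ViscousSlab.exists_exponent_loglog hc hg ha hθ hs hα
    refine ⟨C, hC, fun t₀ ht₀ => ?_⟩
    obtain ⟨D, hD⟩ := hexp t₀ ht₀
    refine ⟨3 * (1 + 4 / θ) * Real.exp D, by positivity,
      fun μ hμ hsym u₀ h₀ u h hsol _ _ t ht => ?_⟩
    refine (hen μ hμ u₀ h₀ u h hsol t (C * (t / Real.log t ^ α) - D) (by linarith) fun ξ =>
      hD _ _ t (ViscousSlab.freqNorm_nonneg ξ) (hμ ξ).1 ht (hsym ξ)).trans (le_of_eq ?_)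
    rw [mul_assoc _ (Real.exp D), ← Real.exp_add]
    congr 4
    ring
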